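/- Let $\xi_1,\xi_2,\dots$ be i.i.d. random elements with law $\Pi$, let $f(x,\xi)$ be a real loss with $x\in\mathbb{R}^d$, let $F(x)=\mathbb{E}_{\xi\sim\Pi}f(x,\xi)$ (assumed finite), and let $x^*$ be the minimizer of $F$. Let $\|\cdot\|_2$ denote the Euclidean norm of vectors and the operator norm of matrices. Let $x_0\in\mathbb{R}^d$ be deterministic and let $x_i=x_{i-1}-\eta_i\nabla f(x_{i-1},\xi_i)$ for $i\ge1$ be the stochastic gradient iterates ($\nabla$ is the gradient in $x$) with steps $\eta_i=\eta i^{-\alpha}$, $\eta>0$, $\tfrac12<\alpha<1$. Put $\bar x_n=n^{-1}\sum_{i=1}^n x_i$, $\delta_n=x_n-x^*$, $\epsilon_n=\nabla F(x_{n-1})-\nabla f(x_{n-1},\xi_n)$, and let $\mathbb{E}_{n-1}$ be conditional expectation given $\xi_1,\dots,\xi_{n-1}$. Assume: (1) $F$ is continuously differentiable and strongly convex: for some $\mu>0$ and all $x_1,x_2$, $F(x_2)\ge F(x_1)+\langle\nabla F(x_1),x_2-x_1\rangle+\frac{\mu}{2}\|x_1-x_2\|_2^2$; $\nabla F$ is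 Lipschitz; the Hessian $A=\nabla^2F(x^*)$ exists and $\nabla F(x)=A(x-x^*)+O(\|x-x^*\|_2^2)$ as $x\to x^*$. (2) $f(\cdot,\xi)$ is continuously differentiable for every $\xi$, and every $x\in\mathbb{R}^d$ has a neighbourhood $U$ such that the family $\{\nabla f(u,\xi)\}_{u\in U}$, $\xi\sim\Pi$, is uniformly integrable. (3) $S=\mathbb{E}_{\xi\sim\Pi}\left[\nabla f(x^*,\xi)\nabla f(x^*,\xi)^T\right]$ is finite and there is a constant $c$ such that, almost surely for all $n\ge1$, $\|\mathbb{E}_{n-1}\epsilon_n\epsilon_n^T-S\|_2\le c(\|\delta_{n-1}\|_2+\|\delta_{n-1}\|_2^2)$. (4) There is a constant $c'$ such that, almost surely for all $n\ge1$, $\mathbb{E}_{n-1}\|\epsilon_n\|_2^4\le c'(1+\|\delta_{n-1}\|_2^4)$. Let $C>0$ and $\beta>\frac1{1-\alpha}$, and let $a_1=1$ and $a_k=\lfloor Ck^\beta\rfloor$ for $k\ge2$, where $C$ is such that $(a_k)_{k\ge1}$ is strictly increasing. For $i\ge1$ let $t_i=a_m$ when $a_m\le i<a_{m+1}$, let $l_i=i-t_i+1$,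 and define $$\hat\Sigma_n=\frac{\sum_{i=1}^n\left(\sum_{k=t_i}^i x_k-l_i\bar x_n\right)\left(\sum_{k=t_i}^i x_k-l_i\bar x_n\right)^T}{\sum_{i=1}^n l_i},\qquad \Sigma=A^{-1}SA^{-1}.$$ Then there are constants $K$ and $M_0$ such that for all $M\ge M_0$ and all $n$ with $a_M\le n<a_{M+1}$ the expectation below is finite and $$\mathbb{E}\|\hat\Sigma_n-\Sigma\|_2\le K\left(M^{-\alpha\beta/4}+M^{-1/2}+M^{((\alpha-1)\beta+1)/2}\right).$$ -/

import Mathlib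

open MeasureTheory ProbabilityTheory Filter Topology Asymptotics

noncomputable section

namespace OnlineSGD

/-- `ℝ^d` with the Euclidean norm. -/
abbrev Vec (d : ℕ) : Type := EuclideanSpace ℝ (Fin d)

/-- The spectral (operator) norm of a matrix, induced by the Euclidean norm. -/
def opNorm {d : ℕ} (B : Matrix (Fin d) (Fin d) ℝ) : ℝ :=
  ‖Matrix.toEuclideanCLM (n := Fin d) (𝕜 := ℝ) B‖

section Problem

variable {d : ℕ} {𝓧 : Type*} [MeasurableSpace 𝓧]

/-- The objective function `F(x) = 𝔼_{z ∼ P} f(x, z)`. -/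
def risk (f : Vec d → 𝓧 → ℝ) (P : Measure 𝓧) (x : Vec d) : ℝ :=
  ∫ z, f x z ∂P

/-- `∇f(x, z)`, the gradient of the loss in its first argument. -/
def lossGrad (f : Vec d → 𝓧 → ℝ) (x : Vec d) (z : 𝓧) : Vec d :=
  gradient (fun y => f y z) x

/-- The Hessian matrix `∇²F(x)`, the Jacobian matrix of `∇F` at `x`. -/
def hessian (F : Vec d → ℝ) (x : Vec d) : Matrix (Fin d) (Fin d) ℝ :=
  Matrix.of fun i j => fderiv ℝ (gradient F) x (EuclideanSpace.single j (1 : ℝ)) i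

/-- `𝔼 (∇f(x, z) ∇f(x, z)ᵀ)` for `z ∼ P`. -/
def gradSecondMoment (f : Vec d → 𝓧 → ℝ) (P : Measure 𝓧) (x : Vec d) :
    Matrix (Fin d) (Fin d) ℝ :=
  Matrix.of fun i j => ∫ z, lossGrad f x z i * lossGrad f x z j ∂P

/-- The sandwich matrix `Σ = A⁻¹ S A⁻¹` at the point `x`. -/
def sandwich (f : Vec d → 𝓧 → ℝ) (P : Measure 𝓧) (x : Vec d) : Matrix (Fin d) (Fin d) ℝ :=
  (hessian (risk f P) x)⁻¹ * gradSecondMoment f P x * (hessian (risk f P) x)⁻¹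

/-- The step size `η_i = η i^{-α}`. -/
def stepSize (η α : ℝ) (i : ℕ) : ℝ := η * (i : ℝ) ^ (-α)

variable {Ω : Type*}

/-- The SGD iterates `x_i = x_{i-1} - η_i ∇f(x_{i-1}, ξ_i)`, started at the point `x₀`.
The samples are `ξ 1, ξ 2, …`; the value `ξ 0` is never used. -/
def sgd (f : Vec d → 𝓧 → ℝ) (step : ℕ → ℝ) (x₀ : Vec d) (ξ : ℕ → Ω → 𝓧) : ℕ → Ω → Vec d
  | 0, _ => x₀
  | i + 1, ω =>
      sgd f step x₀ ξ i ω - step (i + 1) • lossGrad f (sgd f step x₀ ξ i ω) (ξ (i + 1) ω)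

/-- The gradient noise `ε_n = ∇F(x_{n-1}) - ∇f(x_{n-1}, ξ_n)`, for `n ≥ 1`. -/
def noise (f : Vec d → 𝓧 → ℝ) (P : Measure 𝓧) (ξ : ℕ → Ω → 𝓧) (x : ℕ → Ω → Vec d)
    (n : ℕ) (ω : Ω) : Vec d :=
  gradient (risk f P) (x (n - 1) ω) - lossGrad f (x (n - 1) ω) (ξ n ω)

/-- The σ-algebra generated by `ξ 1, …, ξ n`. -/
abbrev past (ξ : ℕ → Ω → 𝓧) (n : ℕ) : MeasurableSpace Ω :=
  ⨆ i ∈ Finset.Icc 1 n, MeasurableSpace.comap (ξ i) inferInstance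

/-- The conditional second moment matrix `𝔼(Y Yᵀ | m)`, entry by entry. -/
def condSecondMoment [MeasurableSpace Ω] (μ : Measure Ω) (m : MeasurableSpace Ω)
    (Y : Ω → Vec d) (ω : Ω) : Matrix (Fin d) (Fin d) ℝ :=
  Matrix.of fun i j => (μ[fun ω' => Y ω' i * Y ω' j | m]) ω

end Problem

section Batches

/-- The batch starts: `a_1 = 1` and `a_k = ⌊C k^β⌋` for `k ≥ 2`. -/
def batchStart (C β : ℝ) (k : ℕ) : ℕ :=
  if k = 1 then 1 else ⌊C * (k : ℝ) ^ β⌋₊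

/-- `t_i = a_m`, where `m` is the largest index (at most `i`) with `a_m ≤ i`. -/
def blockStart (a : ℕ → ℕ) (i : ℕ) : ℕ :=
  a (Nat.findGreatest (fun m => a m ≤ i) i)

/-- For a strictly increasing sequence `1 = a_1 < a_2 < …`, the number `t_i` is `a_m` whenever
`a_m ≤ i < a_{m+1}`. -/
theorem blockStart_eq {a : ℕ → ℕ} (h1 : a 1 = 1) (ha : StrictMonoOn a (Set.Ici 1))
    {m i : ℕ} (hm : 1 ≤ m) (h : a m ≤ i) (h' : i < a (m + 1)) : blockStart a i = a m := by
  have hid : ∀ k, 1 ≤ k → k ≤ a k := by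
    intro k hk
    induction k, hk using Nat.le_induction with
    | base => omega
    | succ k hk ih =>
      have hlt : a k < a (k + 1) :=
        ha (Set.mem_Ici.2 hk) (Set.mem_Ici.2 (by omega)) (Nat.lt_succ_self k)
      omega
  have hmi : m ≤ i := (hid m hm).trans h
  unfold blockStart
  congr 1
  rw [Nat.findGreatest_eq_iff]
  refine ⟨hmi, fun _ => h, fun {k} hk _ hle => ?_⟩
  have hmono : a (m + 1) ≤ a k :=
    ha.monotoneOn (Set.mem_Ici.2 (by omega)) (Set.mem_Ici.2 (by omega)) hk
  omega

/-- `l_i = i - t_i + 1`, the size of the batch `{x_{t_i}, …, x_i}`. -/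
def batchSize (a : ℕ → ℕ) (i : ℕ) : ℕ := i - blockStart a i + 1

variable {d : ℕ}

/-- The average `n⁻¹ ∑_{i=1}^n x_i`. -/
def average (x : ℕ → Vec d) (n : ℕ) : Vec d :=
  (n : ℝ)⁻¹ • ∑ i ∈ Finset.Icc 1 n, x i

/-- The centred batch sum `∑_{k=t_i}^i x_k - l_i x̄_n`. -/
def centredSum (a : ℕ → ℕ) (x : ℕ → Vec d) (n i : ℕ) : Vec d :=
  ∑ k ∈ Finset.Icc (blockStart a i) i, x k - (batchSize a i : ℝ) • average x n

/-- The overlapping batch-means estimator of the trajectory `x` at step `n`. -/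
def batchMeansEstimator (a : ℕ → ℕ) (x : ℕ → Vec d) (n : ℕ) : Matrix (Fin d) (Fin d) ℝ :=
  (∑ i ∈ Finset.Icc 1 n, (batchSize a i : ℝ))⁻¹ •
    ∑ i ∈ Finset.Icc 1 n,
      Matrix.vecMulVec (centredSum a x n i).ofLp (centredSum a x n i).ofLp

end Batches

end OnlineSGD

end

open OnlineSGD

open OnlineSGD

/-! Write δ_k = x_k - x*, h(v) = ∇F(x* + v) and e_k = ε_{k+1}. Dividing the recursion by the step
gives A δ_k = e_k + (δ_k - δ_{k+1})/η_{k+1} - (h(δ_k) - A δ_k). Summed over a batch, the iterates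
are therefore A⁻¹ times a martingale sum plus two small remainders. The outer product of such a
martingale sum has mean close to the batch length times S, so the normalized average of outer
products is close to A⁻¹ S A⁻¹.

The remainders are controlled by E‖δ_k‖⁴ = O(k^{-2α}) (`exists_integral_pow_four_le`). The scaled
increments, summed by parts, are O(j^α) in mean square (`integral_norm_sum_increments_sq_le`). The
remainder of the linearization is quadratic in δ and is handled by Cauchy-Schwarz, where α > 1/2
makes Σ k^{-2α} finite (`exists_integral_sum_error_sub_le`).

Let ℓ bound the batch sizes. Compensated products of martingale sums over disjoint windows are
uncorrelated, so their sum over i ≤ n has mean square O(n ℓ³) (`integral_abs_sum_compProd_le`).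
Conditional covariances differ from S by O(k^{-α/2}) in mean.

For a_M ≤ n < a_{M+1} one has n ≍ M^β and ℓ ≍ M^{β-1}, and the normalization Λ is of order n ℓ
(`exists_batch_bounds`). Relative to Λ, the martingale fluctuation is (ℓ/n)^{1/2} ≍ M^{-1/2} and the
covariance drift is n^{-α/2} ≍ M^{-αβ/2}, better than the M^{-αβ/4} claimed. Replacing iterates by
martingale sums costs ρ + ρ⁻¹(n^α/ℓ + ℓ/n) by Young's inequality; taking ρ = M^{-1/2} +
M^{((α-1)β+1)/2} balances this (`integral_opNorm_batchMeans_sub_sandwich_le`). -/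

namespace OnlineSGD

/-! ### Power sums, summation by parts and a scalar recursion. -/

section PowerSums

theorem natCast_rpow_mul_le {n : ℕ} (hn : 1 ≤ n) {p : ℝ} (hp0 : 0 ≤ p) (hp1 : p ≤ 1) :
    ((n : ℝ) + 1) ^ p ≤ 2 * (n : ℝ) ^ p := by
  have hn' : (1 : ℝ) ≤ n := by exact_mod_cast hn
  calc ((n : ℝ) + 1) ^ p ≤ (2 * (n : ℝ)) ^ p := by gcongr; linarith
    _ = 2 ^ p * (n : ℝ) ^ p := Real.mul_rpow (by norm_num) (by positivity)
    _ ≤ 2 ^ (1 : ℝ) * (n : ℝ) ^ p := by gcongr; norm_num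
    _ = 2 * (n : ℝ) ^ p := by norm_num

theorem sum_rpow_neg_le {s : ℝ} (hs0 : 0 ≤ s) (hs1 : s < 1) (n : ℕ) :
    ∑ k ∈ Finset.Icc 1 n, (k : ℝ) ^ (-s) ≤ (n : ℝ) ^ (1 - s) / (1 - s) := by
  have hp : 0 < 1 - s := by linarith
  induction n with
  | zero => simp [Real.zero_rpow hp.ne']
  | succ n ih =>
    rw [Finset.sum_Icc_succ_top (by omega)]
    have hpos : (0 : ℝ) < (n : ℝ) + 1 := by positivity
    have h1 : (n : ℝ) ^ (1 - s) ≤ ((n : ℝ) + 1) ^ (1 - s) - (1 - s) * ((n : ℝ) + 1) ^ (-s) := by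
      have h2 := rpow_one_add_le_one_add_mul_self (s := -(1 / ((n : ℝ) + 1)))
        (by rw [neg_le_neg_iff, div_le_one hpos]; linarith [Nat.cast_nonneg (α := ℝ) n]) hp.le
        (by linarith)
      have h3 : (n : ℝ) = ((n : ℝ) + 1) * (1 + -(1 / ((n : ℝ) + 1))) := by field_simp; ring
      have h4 : (0 : ℝ) ≤ 1 + -(1 / ((n : ℝ) + 1)) := by
        have : 1 / ((n : ℝ) + 1) ≤ 1 := by
          rw [div_le_one hpos]; linarith [Nat.cast_nonneg (α := ℝ) n]
        linarith
      have h5 : ((n : ℝ) + 1) ^ (-s) = ((n : ℝ) + 1) ^ (1 - s) / ((n : ℝ) + 1) := by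
        rw [show -s = 1 - s - 1 by ring, Real.rpow_sub_one hpos.ne']
      calc (n : ℝ) ^ (1 - s) = ((n : ℝ) + 1) ^ (1 - s) * (1 + -(1 / ((n : ℝ) + 1))) ^ (1 - s) := by
            conv_lhs => rw [h3]
            exact Real.mul_rpow hpos.le h4
        _ ≤ ((n : ℝ) + 1) ^ (1 - s) * (1 + (1 - s) * -(1 / ((n : ℝ) + 1))) := by gcongr
        _ = _ := by rw [h5]; field_simp; ring
    have h6 : (n : ℝ) ^ (1 - s) / (1 - s) ≤
        ((n : ℝ) + 1) ^ (1 - s) / (1 - s) - ((n : ℝ) + 1) ^ (-s) := by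
      rw [div_le_iff₀ hp, sub_mul, div_mul_cancel₀ _ hp.ne']
      linarith
    push_cast
    linarith

/-- With a = k^{α/2} and b = (k+1)^{α/2} the term is (b² - a²)/a = (b - a)(b + a)/a ≤ 3(b - a),
because b ≤ 2a, and this telescopes. -/
theorem sum_rpow_sub_mul_rpow_neg_le {α : ℝ} (h0 : 0 ≤ α) (h1 : α ≤ 1) {s j : ℕ} (hs : 1 ≤ s)
    (hsj : s ≤ j) :
    ∑ k ∈ Finset.Ico s j, (((k : ℝ) + 1) ^ α - (k : ℝ) ^ α) * (k : ℝ) ^ (-(α / 2))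
      ≤ 3 * (j : ℝ) ^ (α / 2) := by
  have hterm : ∀ k ∈ Finset.Ico s j, (((k : ℝ) + 1) ^ α - (k : ℝ) ^ α) * (k : ℝ) ^ (-(α / 2))
      ≤ 3 * (((k + 1 : ℕ) : ℝ) ^ (α / 2)) - 3 * ((k : ℝ) ^ (α / 2)) := by
    intro k hk
    have hk1 : 1 ≤ k := hs.trans (Finset.mem_Ico.1 hk).1
    have hk0 : (0 : ℝ) < k := by exact_mod_cast hk1
    have h2 : ∀ x : ℝ, 0 ≤ x → x ^ α = x ^ (α / 2) * x ^ (α / 2) := by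
      intro x hx
      rw [← Real.rpow_add_of_nonneg hx (by linarith) (by linarith)]
      ring_nf
    have hapos : 0 < (k : ℝ) ^ (α / 2) := Real.rpow_pos_of_pos hk0 _
    have hab : (k : ℝ) ^ (α / 2) ≤ ((k : ℝ) + 1) ^ (α / 2) := by gcongr; linarith
    have hba := natCast_rpow_mul_le hk1 (p := α / 2) (by linarith) (by linarith)
    rw [h2 _ hk0.le, h2 _ (by positivity : (0 : ℝ) ≤ (k : ℝ) + 1), Real.rpow_neg hk0.le]
    push_cast
    set a := (k : ℝ) ^ (α / 2)
    set b := ((k : ℝ) + 1) ^ (α / 2)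
    rw [mul_inv_le_iff₀ hapos]
    nlinarith
  refine (Finset.sum_le_sum hterm).trans ?_
  rw [Finset.sum_Ico_sub (fun k : ℕ => 3 * ((k : ℝ) ^ (α / 2))) hsj]
  have : (0 : ℝ) ≤ 3 * ((s : ℝ) ^ (α / 2)) := by positivity
  linarith

/-- Summation by parts over `[s, j)`. -/
theorem sum_smul_sub_eq {E : Type*} [AddCommGroup E] [Module ℝ E] (c : ℕ → ℝ) (x : ℕ → E)
    {s j : ℕ} (hsj : s ≤ j) :
    ∑ k ∈ Finset.Ico s j, c k • (x k - x (k + 1))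
      = c s • x s - c j • x j + ∑ k ∈ Finset.Ico s j, (c (k + 1) - c k) • x (k + 1) := by
  induction j, hsj using Nat.le_induction with
  | base => simp
  | succ j hj ih =>
    rw [Finset.sum_Ico_succ_top hj, Finset.sum_Ico_succ_top hj, ih]
    module

/-- Put y = (n+1)^{-α}. Replacing n^{-2α} by y² costs a factor 1 + 3/n, and 1/n is negligible
against c y since α < 1. Half of the contraction c y pays for this factor; the other half absorbs B
y³ as soon as K ≥ 2B/c. -/
theorem exists_le_mul_rpow_of_recursion {u : ℕ → ℝ} {α c B : ℝ} (hα0 : 0 < α) (hα1 : α < 1)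
    (hc : 0 < c) (hu : ∀ n, 0 ≤ u n)
    (h : ∀ᶠ n : ℕ in atTop, u (n + 1)
      ≤ (1 - c * ((n : ℝ) + 1) ^ (-α)) * u n + B * (((n : ℝ) + 1) ^ (-α)) ^ 3) :
    ∃ K, 0 ≤ K ∧ ∀ n, 1 ≤ n → u n ≤ K * (n : ℝ) ^ (-(2 * α)) := by
  have ht : Tendsto (fun n : ℕ => (n : ℝ) + 1) atTop atTop :=
    tendsto_atTop_add_const_right _ _ tendsto_natCast_atTop_atTop
  have hy0 : Tendsto (fun n : ℕ => ((n : ℝ) + 1) ^ (-α)) atTop (𝓝 0) :=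
    (tendsto_rpow_neg_atTop hα0).comp ht
  have hbig : Tendsto (fun n : ℕ => ((n : ℝ) + 1) ^ (1 - α)) atTop atTop :=
    (tendsto_rpow_atTop (by linarith)).comp ht
  obtain ⟨N, hN⟩ := eventually_atTop.1 (h.and ((eventually_ge_atTop 1).and
    ((hy0.eventually (gt_mem_nhds (inv_pos.2 hc))).and (hbig.eventually_ge_atTop (12 / c)))))
  -- The first summand closes the induction; the second covers the finitely many indices up to N,
  -- where the recursion may fail.
  set K := |2 * B / c| + ∑ k ∈ Finset.range (N + 1), u k * (k : ℝ) ^ (2 * α) with hK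
  have hsum : ∀ k, 0 ≤ u k * (k : ℝ) ^ (2 * α) := fun k => mul_nonneg (hu k) (by positivity)
  have hK0 : 0 ≤ K := add_nonneg (abs_nonneg _) (Finset.sum_nonneg fun k _ => hsum k)
  have hKB : B ≤ K * c / 2 := by
    have h1 : 2 * B / c ≤ K := (le_abs_self _).trans
      (le_add_of_nonneg_right (Finset.sum_nonneg fun k _ => hsum k))
    rw [div_le_iff₀ hc] at h1
    linarith
  refine ⟨K, hK0, ?_⟩
  have hsmall : ∀ n, 1 ≤ n → n ≤ N → u n ≤ K * (n : ℝ) ^ (-(2 * α)) := by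
    intro n hn hnN
    have hn0 : (0 : ℝ) < n := by exact_mod_cast hn
    rw [Real.rpow_neg hn0.le, ← div_eq_mul_inv, le_div_iff₀ (by positivity)]
    have h1 := Finset.single_le_sum (f := fun k : ℕ => u k * (k : ℝ) ^ (2 * α))
      (fun k _ => hsum k) (Finset.mem_range.2 (Nat.lt_succ_of_le hnN))
    have h2 := abs_nonneg (2 * B / c)
    linarith
  intro n hn
  rcases le_total n N with hle | hle
  · exact hsmall n hn hle
  induction n, hle using Nat.le_induction with
  | base => exact hsmall N hn le_rfl
  | succ n hNn ih =>
    obtain ⟨hrec, hn1, hy1, hbg⟩ := hN n hNn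
    have ih := ih hn1
    have hn0 : (0 : ℝ) < n := by exact_mod_cast hn1
    have hn1' : (1 : ℝ) ≤ n := by exact_mod_cast hn1
    have hp : (0 : ℝ) < (n : ℝ) + 1 := by positivity
    set y := ((n : ℝ) + 1) ^ (-α) with hy
    have hypos : 0 < y := Real.rpow_pos_of_pos hp _
    have hcy : c * y ≤ 1 := by
      have := mul_lt_mul_of_pos_left hy1 hc
      rw [mul_inv_cancel₀ hc.ne'] at this
      exact this.le
    have hy2 : ((n : ℝ) + 1) ^ (-(2 * α)) = y ^ 2 := by
      rw [hy, ← Real.rpow_natCast, ← Real.rpow_mul hp.le]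
      congr 1; push_cast; ring
    -- The threshold 12/c gives c (n+1) y ≥ 12, hence c n y ≥ 6 because n + 1 ≤ 2n.
    have h3n : 3 / (n : ℝ) ≤ c * y / 2 := by
      have e1 : ((n : ℝ) + 1) ^ (1 - α) = ((n : ℝ) + 1) * y := by
        rw [hy, sub_eq_add_neg, Real.rpow_add hp, Real.rpow_one]
      rw [e1, div_le_iff₀ hc] at hbg
      rw [div_le_iff₀ hn0]
      nlinarith [mul_pos hypos hc]
    have hratio : (n : ℝ) ^ (-(2 * α)) ≤ (1 + 3 / n) * y ^ 2 := by
      have e2 : ((n : ℝ) + 1) ^ (2 * α) ≤ (n : ℝ) ^ (2 * α) * (1 + 3 / n) := by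
        have e3 : (n : ℝ) + 1 = n * (1 + 1 / n) := by field_simp
        have e4 : (1 : ℝ) ≤ 1 + 1 / n := by simp
        rw [e3, Real.mul_rpow hn0.le (by positivity)]
        gcongr
        calc (1 + 1 / (n : ℝ)) ^ (2 * α) ≤ (1 + 1 / (n : ℝ)) ^ (2 : ℝ) :=
              Real.rpow_le_rpow_of_exponent_le e4 (by linarith)
          _ = 1 + 2 / n + (1 / n) * (1 / n) := by rw [Real.rpow_two]; ring
          _ ≤ 1 + 2 / n + (1 / n) * 1 := by
              gcongr
              rw [div_le_one hn0]; exact hn1'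
          _ = 1 + 3 / n := by ring
      rw [← hy2, Real.rpow_neg hn0.le, Real.rpow_neg hp.le, ← div_eq_mul_inv,
        le_div_iff₀ (by positivity), inv_mul_le_iff₀ (by positivity)]
      exact e2
    push_cast
    rw [hy2]
    have h5 : (1 - c * y) * u n ≤ (1 - c * y) * (K * ((1 + 3 / n) * y ^ 2)) := by
      have h6 : u n ≤ K * ((1 + 3 / n) * y ^ 2) :=
        ih.trans (mul_le_mul_of_nonneg_left hratio hK0)
      exact mul_le_mul_of_nonneg_left h6 (by linarith)
    have h7 : (1 - c * y) * (1 + 3 / (n : ℝ)) ≤ 1 - c * y / 2 := by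
      have : 0 ≤ 3 / (n : ℝ) := by positivity
      nlinarith [mul_pos hc hypos]
    have h8 : (1 - c * y) * (K * ((1 + 3 / n) * y ^ 2)) ≤ K * y ^ 2 * (1 - c * y / 2) := by
      have := mul_le_mul_of_nonneg_left h7 (by positivity : 0 ≤ K * y ^ 2)
      linarith
    have h9 : B * y ^ 3 ≤ K * c / 2 * y ^ 3 := by gcongr
    nlinarith

end PowerSums

/-! ### Sizes of the batches and of the normalization. -/

section BatchGeometry

variable {a : ℕ → ℕ}

theorem le_of_strictMonoOn (h1 : a 1 = 1) (ha : StrictMonoOn a (Set.Ici 1)) {k : ℕ} (hk : 1 ≤ k) :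
    k ≤ a k := by
  induction k, hk using Nat.le_induction with
  | base => omega
  | succ k hk ih =>
    have : a k < a (k + 1) := ha (Set.mem_Ici.2 hk) (Set.mem_Ici.2 (by omega)) (Nat.lt_succ_self k)
    omega

theorem exists_block (h1 : a 1 = 1) (ha : StrictMonoOn a (Set.Ici 1)) {i : ℕ} (hi : 1 ≤ i) :
    ∃ m, 1 ≤ m ∧ a m ≤ i ∧ i < a (m + 1) := by
  induction i, hi using Nat.le_induction with
  | base =>
    refine ⟨1, le_rfl, h1.le, ?_⟩
    have : a 1 < a (1 + 1) :=
      ha (Set.mem_Ici.2 le_rfl) (Set.mem_Ici.2 (by omega)) (Nat.lt_succ_self 1)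
    omega
  | succ i _ ih =>
    obtain ⟨m, hm, h2, h3⟩ := ih
    rcases Nat.lt_or_ge (i + 1) (a (m + 1)) with h | h
    · exact ⟨m, hm, by omega, h⟩
    · refine ⟨m + 1, by omega, h, ?_⟩
      have : a (m + 1) < a (m + 1 + 1) := ha (Set.mem_Ici.2 (by omega : 1 ≤ m + 1)) (Set.mem_Ici.2 (by omega : 1 ≤ m + 1 + 1))
        (Nat.lt_succ_self (m + 1))
      omega

theorem blockStart_pos_le (h1 : a 1 = 1) (ha : StrictMonoOn a (Set.Ici 1)) {i : ℕ} (hi : 1 ≤ i) :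
    1 ≤ blockStart a i ∧ blockStart a i ≤ i := by
  obtain ⟨m, hm, h2, h3⟩ := exists_block h1 ha hi
  rw [blockStart_eq h1 ha hm h2 h3]
  exact ⟨hm.trans (le_of_strictMonoOn h1 ha hm), h2⟩

/-- A complete block of length b contributes 1 + ⋯ + b ≥ b²/2. The M - 1 complete blocks before a_M
have total length a_M - 1, and Cauchy-Schwarz bounds the sum of their squared lengths from below. -/
theorem sum_batchSize_ge (h1 : a 1 = 1) (ha : StrictMonoOn a (Set.Ici 1)) {M : ℕ} (hM : 1 ≤ M) :
    ((a M : ℝ) - 1) ^ 2 ≤ 2 * M * ∑ i ∈ Finset.Ico 1 (a M), (batchSize a i : ℝ) := by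
  have hmono : ∀ m, 1 ≤ m → a m ≤ a (m + 1) := fun m hm =>
    ha.monotoneOn (Set.mem_Ici.2 hm) (Set.mem_Ici.2 (by omega)) (Nat.le_succ m)
  have hblock : ∀ m, 1 ≤ m → ((a (m + 1) : ℝ) - a m) ^ 2
      ≤ 2 * ∑ i ∈ Finset.Ico (a m) (a (m + 1)), (batchSize a i : ℝ) := by
    intro m hm
    have e1 : ∑ i ∈ Finset.Ico (a m) (a (m + 1)), (batchSize a i : ℝ)
        = ∑ r ∈ Finset.range (a (m + 1) - a m), ((r : ℝ) + 1) := by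
      rw [Finset.sum_Ico_eq_sum_range]
      refine Finset.sum_congr rfl fun r hr => ?_
      have hr' := Finset.mem_range.1 hr
      rw [batchSize, blockStart_eq h1 ha hm (Nat.le_add_right _ _) (by omega),
        Nat.add_sub_cancel_left]
      push_cast; ring
    have e2 : ∀ b : ℕ, (b : ℝ) ^ 2 ≤ 2 * ∑ r ∈ Finset.range b, ((r : ℝ) + 1) := by
      intro b
      induction b with
      | zero => simp
      | succ b ih =>
        rw [Finset.sum_range_succ]
        push_cast
        nlinarith
    rw [e1, ← Nat.cast_sub (hmono m hm)]
    exact e2 _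
  have hsum : ∑ m ∈ Finset.Ico 1 M, ((a (m + 1) : ℝ) - a m) ^ 2
      ≤ 2 * ∑ i ∈ Finset.Ico 1 (a M), (batchSize a i : ℝ) := by
    induction M, hM using Nat.le_induction with
    | base => simp [h1]
    | succ M hM ih =>
      rw [Finset.sum_Ico_succ_top hM, ← Finset.sum_Ico_consecutive (fun i => (batchSize a i : ℝ))
        (hM.trans (le_of_strictMonoOn h1 ha hM)) (hmono M hM), mul_add]
      exact add_le_add ih (hblock M hM)
  have htel : ∑ m ∈ Finset.Ico 1 M, ((a (m + 1) : ℝ) - a m) = a M - 1 := by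
    rw [Finset.sum_Ico_sub (fun m => (a m : ℝ)) hM, h1]
    simp
  have hcs := sq_sum_le_card_mul_sum_sq (s := Finset.Ico 1 M)
    (f := fun m => (a (m + 1) : ℝ) - a m)
  rw [htel, Nat.card_Ico] at hcs
  have hM' : ((M - 1 : ℕ) : ℝ) ≤ M := by exact_mod_cast Nat.sub_le M 1
  have h0 : 0 ≤ ∑ m ∈ Finset.Ico 1 M, ((a (m + 1) : ℝ) - a m) ^ 2 :=
    Finset.sum_nonneg fun m _ => sq_nonneg _
  calc ((a M : ℝ) - 1) ^ 2 ≤ ((M - 1 : ℕ) : ℝ) * ∑ m ∈ Finset.Ico 1 M, ((a (m + 1) : ℝ) - a m) ^ 2 := hcs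
    _ ≤ M * (2 * ∑ i ∈ Finset.Ico 1 (a M), (batchSize a i : ℝ)) := by gcongr
    _ = _ := by ring

theorem batchStart_le {C β : ℝ} (hC : 0 < C) {k : ℕ} (hk : 2 ≤ k) :
    (batchStart C β k : ℝ) ≤ C * (k : ℝ) ^ β := by
  rw [batchStart, if_neg (by omega)]
  exact Nat.floor_le (by positivity)

theorem batchStart_gt {C β : ℝ} {k : ℕ} (hk : 2 ≤ k) :
    C * (k : ℝ) ^ β - 1 < batchStart C β k := by
  rw [batchStart, if_neg (by omega)]
  exact Nat.sub_one_lt_floor _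

theorem batchStart_sub_le {C β : ℝ} (hC : 0 < C) (hβ : 1 ≤ β) {k : ℕ} (hk : 1 ≤ k) :
    (batchStart C β (k + 1) : ℝ) - batchStart C β k
      ≤ C * (β * ((k : ℝ) + 1) ^ (β - 1)) + 1 + C := by
  have h1 := batchStart_le (β := β) hC (by omega : 2 ≤ k + 1)
  push_cast at h1
  have hp : (0 : ℝ) < (k : ℝ) + 1 := by positivity
  have hk' : (1 : ℝ) ≤ k := by exact_mod_cast hk
  have h2 : ((k : ℝ) + 1) ^ β - (k : ℝ) ^ β ≤ β * ((k : ℝ) + 1) ^ (β - 1) := by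
    have h3 : (k : ℝ) = ((k : ℝ) + 1) * (1 + -(1 / ((k : ℝ) + 1))) := by field_simp; ring
    have h5 : 1 / ((k : ℝ) + 1) ≤ 1 := by rw [div_le_one hp]; linarith
    have h4 := one_add_mul_self_le_rpow_one_add (s := -(1 / ((k : ℝ) + 1))) (by linarith) hβ
    have h6 : ((k : ℝ) + 1) ^ (β - 1) = ((k : ℝ) + 1) ^ β / ((k : ℝ) + 1) :=
      Real.rpow_sub_one hp.ne' β
    have h7 : (k : ℝ) ^ β = ((k : ℝ) + 1) ^ β * (1 + -(1 / ((k : ℝ) + 1))) ^ β := by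
      conv_lhs => rw [h3]
      exact Real.mul_rpow hp.le (by linarith)
    have h8 : ((k : ℝ) + 1) ^ β * (1 + β * -(1 / ((k : ℝ) + 1))) ≤ (k : ℝ) ^ β := by
      rw [h7]; gcongr
    have h9 : ((k : ℝ) + 1) ^ β * (1 + β * -(1 / ((k : ℝ) + 1)))
        = ((k : ℝ) + 1) ^ β - β * ((k : ℝ) + 1) ^ (β - 1) := by rw [h6]; field_simp; ring
    linarith
  -- The -1 is the loss from the floor; the extra -C covers k = 1, where the start is set to 1
  -- whatever C is.
  have h10 : C * (k : ℝ) ^ β - 1 - C ≤ batchStart C β k := by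
    rcases Nat.lt_or_ge k 2 with h | h
    · obtain rfl : k = 1 := by omega
      simp [batchStart]
    · linarith [batchStart_gt (C := C) (β := β) h]
  have h11 := mul_le_mul_of_nonneg_left h2 hC.le
  linarith

/-- The sizes of the averaging horizon, of the batches and of the normalization, when `n` lies
between the `M`-th and the `(M + 1)`-st batch start. -/
theorem exists_batch_bounds {C β : ℝ} (hC : 0 < C) (hβ : 1 < β)
    (ha : StrictMonoOn (batchStart C β) (Set.Ici 1)) :
    ∃ c₁ c₂ : ℝ, 0 < c₁ ∧ 0 < c₂ ∧ ∀ᶠ M : ℕ in atTop, 1 ≤ M ∧ ∀ n : ℕ, batchStart C β M ≤ n →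
      n < batchStart C β (M + 1) →
        c₁ * (M : ℝ) ^ β ≤ n ∧ (n : ℝ) ≤ c₂ * (M : ℝ) ^ β ∧
        (∀ i ∈ Finset.Icc 1 n, (batchSize (batchStart C β) i : ℝ) ≤ c₂ * (M : ℝ) ^ (β - 1)) ∧
        c₁ * (M : ℝ) ^ (2 * β - 1)
          ≤ ∑ i ∈ Finset.Icc 1 n, (batchSize (batchStart C β) i : ℝ) := by
  have h1 : batchStart C β 1 = 1 := by simp [batchStart]
  have htend : Tendsto (fun M : ℕ => C * (M : ℝ) ^ β) atTop atTop :=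
    ((tendsto_rpow_atTop (by linarith)).comp tendsto_natCast_atTop_atTop).const_mul_atTop hC
  set D := C * (β * 2 ^ (β - 1)) + 1 + C with hD
  have hDpos : 0 < D := by positivity
  -- Once C M^β ≥ 4, both a_M and a_M - 1 are at least (C/2) M^β; squaring and dividing by 2M gives
  -- C²/8.
  refine ⟨min (C / 2) (C ^ 2 / 8), max (C * 2 ^ β) D, by positivity, by positivity, ?_⟩
  filter_upwards [eventually_ge_atTop 2, htend.eventually_ge_atTop 4] with M hM hM4
  refine ⟨by omega, fun n hn hn' => ?_⟩
  have hM1 : (1 : ℝ) ≤ M := by exact_mod_cast (by omega : 1 ≤ M)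
  have hM0 : (0 : ℝ) < M := by linarith
  have hMβ : 0 < (M : ℝ) ^ β := by positivity
  have hlow := batchStart_gt (C := C) (β := β) hM
  have hnR : (batchStart C β M : ℝ) ≤ n := by exact_mod_cast hn
  refine ⟨?_, ?_, ?_, ?_⟩
  · have : min (C / 2) (C ^ 2 / 8) * (M : ℝ) ^ β ≤ C / 2 * (M : ℝ) ^ β := by
      gcongr; exact min_le_left _ _
    linarith
  · have h2 := batchStart_le (β := β) hC (by omega : 2 ≤ M + 1)
    have h3 : (n : ℝ) ≤ batchStart C β (M + 1) := by exact_mod_cast hn'.le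
    have h4 : ((M + 1 : ℕ) : ℝ) ^ β ≤ 2 ^ β * (M : ℝ) ^ β := by
      rw [← Real.mul_rpow (by norm_num) hM0.le]
      push_cast
      gcongr; linarith
    have h5 := mul_le_mul_of_nonneg_left h4 hC.le
    have h6 : C * 2 ^ β * (M : ℝ) ^ β ≤ max (C * 2 ^ β) D * (M : ℝ) ^ β := by
      gcongr; exact le_max_left _ _
    linarith
  · intro i hi
    obtain ⟨hi1, hin⟩ := Finset.mem_Icc.1 hi
    obtain ⟨m, hm, h2, h3⟩ := exists_block h1 ha hi1
    have hmM : m ≤ M := by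
      by_contra hlt
      have := ha.monotoneOn (Set.mem_Ici.2 (by omega : 1 ≤ M + 1)) (Set.mem_Ici.2 hm)
        (by omega : M + 1 ≤ m)
      omega
    have h4 : (batchSize (batchStart C β) i : ℝ)
        ≤ (batchStart C β (m + 1) : ℝ) - batchStart C β m := by
      rw [batchSize, blockStart_eq h1 ha hm h2 h3, ← Nat.cast_sub (by omega)]
      exact_mod_cast (by omega)
    have h5 := batchStart_sub_le (β := β) hC hβ.le hm
    have h6 : ((m : ℝ) + 1) ^ (β - 1) ≤ 2 ^ (β - 1) * (M : ℝ) ^ (β - 1) := by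
      rw [← Real.mul_rpow (by norm_num) hM0.le]
      have : (m : ℝ) ≤ M := by exact_mod_cast hmM
      gcongr
      linarith
    have h7 : 1 ≤ (M : ℝ) ^ (β - 1) := Real.one_le_rpow hM1 (by linarith)
    calc (batchSize (batchStart C β) i : ℝ) ≤ C * (β * ((m : ℝ) + 1) ^ (β - 1)) + 1 + C :=
          h4.trans h5
      _ ≤ C * (β * (2 ^ (β - 1) * (M : ℝ) ^ (β - 1))) + 1 * (M : ℝ) ^ (β - 1)
          + C * (M : ℝ) ^ (β - 1) := by
          gcongr
          · linarith
          · exact le_mul_of_one_le_right hC.le h7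
      _ = D * (M : ℝ) ^ (β - 1) := by rw [hD]; ring
      _ ≤ _ := by gcongr; exact le_max_right _ _
  · have h2 := sum_batchSize_ge h1 ha (by omega : 1 ≤ M)
    have h3 : ∑ i ∈ Finset.Ico 1 (batchStart C β M), (batchSize (batchStart C β) i : ℝ)
        ≤ ∑ i ∈ Finset.Icc 1 n, (batchSize (batchStart C β) i : ℝ) := by
      refine Finset.sum_le_sum_of_subset_of_nonneg (fun i hi => ?_) fun i _ _ => by positivity
      have := Finset.mem_Ico.1 hi
      exact Finset.mem_Icc.2 ⟨this.1, by omega⟩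
    refine le_trans ?_ h3
    have h4 : (C / 2 * (M : ℝ) ^ β) ^ 2 ≤ ((batchStart C β M : ℝ) - 1) ^ 2 := by
      gcongr
      linarith
    have h5 : (M : ℝ) ^ (2 * β - 1) * M = ((M : ℝ) ^ β) ^ 2 := by
      rw [Real.rpow_sub_one hM0.ne', div_mul_cancel₀ _ hM0.ne', mul_comm 2 β, Real.rpow_mul hM0.le,
        Real.rpow_two]
    have h6 : min (C / 2) (C ^ 2 / 8) * (M : ℝ) ^ (2 * β - 1)
        ≤ C ^ 2 / 8 * (M : ℝ) ^ (2 * β - 1) := by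
      gcongr; exact min_le_right _ _
    refine h6.trans (le_of_mul_le_mul_left ?_ (by positivity : (0 : ℝ) < 2 * M))
    calc 2 * (M : ℝ) * (C ^ 2 / 8 * (M : ℝ) ^ (2 * β - 1))
        = C ^ 2 / 4 * ((M : ℝ) ^ (2 * β - 1) * M) := by ring
      _ = (C / 2 * (M : ℝ) ^ β) ^ 2 := by rw [h5]; ring
      _ ≤ _ := h4.trans h2

end BatchGeometry

/-! ### Differentiation of the risk under the integral sign. -/

section StochasticGradient

variable {d : ℕ} {𝓧 : Type*}

theorem inner_lossGrad {f : Vec d → 𝓧 → ℝ} (y v : Vec d) (z : 𝓧) :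
    inner ℝ (lossGrad f y z) v = fderiv ℝ (fun u => f u z) y v := by
  simp [lossGrad, gradient]

theorem continuous_lossGrad {f : Vec d → 𝓧 → ℝ} {z : 𝓧} (h : ContDiff ℝ 1 (fun y => f y z)) :
    Continuous fun y => lossGrad f y z :=
  (InnerProductSpace.toDual ℝ (Vec d)).symm.continuous.comp (h.continuous_fderiv one_ne_zero)

theorem hasDerivAt_loss_segment {f : Vec d → 𝓧 → ℝ} {z : 𝓧} (h : ContDiff ℝ 1 (fun y => f y z))
    (y v : Vec d) (s : ℝ) :
    HasDerivAt (fun s : ℝ => f (y + s • v) z) (inner ℝ (lossGrad f (y + s • v) z) v) s := by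
  rw [inner_lossGrad]
  have h1 : HasFDerivAt (fun u => f u z) (fderiv ℝ (fun u => f u z) (y + s • v))
    (y + s • v) := (h.differentiable one_ne_zero _).hasFDerivAt
  have h2 : HasDerivAt (fun s : ℝ => y + s • v) v s := by
    simpa using ((hasDerivAt_id s).smul_const v).const_add y
  exact h1.comp_hasDerivAt s h2

variable [MeasurableSpace 𝓧]

/-- Each directional derivative is a pointwise limit of difference quotients along 1/(n+1), which
are measurable in z. -/
theorem measurable_lossGrad {f : Vec d → 𝓧 → ℝ} (hf_meas : ∀ x, Measurable (f x))
    (hf_C1 : ∀ z, ContDiff ℝ 1 (fun y => f y z)) (y : Vec d) : Measurable (lossGrad f y) := by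
  have key : ∀ v : Vec d, Measurable fun z => inner ℝ (lossGrad f y z) v := by
    intro v
    have hu : Tendsto (fun n : ℕ => (1 : ℝ) / ((n : ℝ) + 1)) atTop (𝓝[≠] 0) := by
      rw [tendsto_nhdsWithin_iff]
      exact ⟨tendsto_one_div_add_atTop_nhds_zero_nat, Eventually.of_forall fun n =>
        by simp only [Set.mem_compl_iff, Set.mem_singleton_iff]; positivity⟩
    refine measurable_of_tendsto_metrizable
      (f := fun (n : ℕ) z => ((1 : ℝ) / ((n : ℝ) + 1))⁻¹ •
        (f (y + ((1 : ℝ) / ((n : ℝ) + 1)) • v) z - f y z)) (fun n => ?_) ?_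
    · exact ((hf_meas _).sub (hf_meas _)).const_mul _
    · rw [tendsto_pi_nhds]
      intro z
      have h1 : HasFDerivAt (fun u => f u z) (fderiv ℝ (fun u => f u z) y) y :=
        ((hf_C1 z).differentiable one_ne_zero y).hasFDerivAt
      have h2 : HasLineDerivAt ℝ (fun u => f u z) (fderiv ℝ (fun u => f u z) y v) y v :=
        h1.hasLineDerivAt v
      have h3 := h2.tendsto_slope_zero
      rw [inner_lossGrad]
      exact h3.comp hu
  have h2 : Measurable fun z => (WithLp.ofLp (lossGrad f y z)) := by
    rw [measurable_pi_iff]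
    intro p
    have := key (EuclideanSpace.single p 1)
    simpa [EuclideanSpace.inner_single_right] using this
  exact (MeasurableEquiv.toLp 2 (Fin d → ℝ)).measurable.comp h2

theorem measurable_uncurry_lossGrad {f : Vec d → 𝓧 → ℝ} (hf_meas : ∀ x, Measurable (f x))
    (hf_C1 : ∀ z, ContDiff ℝ 1 (fun y => f y z)) :
    Measurable (Function.uncurry (lossGrad f)) :=
  measurable_uncurry_of_continuous_of_measurable (fun z => continuous_lossGrad (hf_C1 z))
    (measurable_lossGrad hf_meas hf_C1)

theorem integrable_lossGrad {f : Vec d → 𝓧 → ℝ} {P : Measure 𝓧}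
    (hf_UI : ∀ y : Vec d, ∃ U ∈ 𝓝 y, UniformIntegrable (fun u : U => lossGrad f u.1) 1 P)
    (y : Vec d) : Integrable (lossGrad f y) P := by
  obtain ⟨U, hU, hUI⟩ := hf_UI y
  exact memLp_one_iff_integrable.1 (hUI.memLp ⟨y, mem_of_mem_nhds hU⟩)

/-- Vitali's theorem along sequences: pointwise convergence comes from continuity of the gradient in
x, and local uniform integrability upgrades it to L¹ convergence. -/
theorem continuous_integral_lossGrad {f : Vec d → 𝓧 → ℝ} {P : Measure 𝓧} [IsProbabilityMeasure P]
    (hf_C1 : ∀ z, ContDiff ℝ 1 (fun y => f y z))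
    (hf_UI : ∀ y : Vec d, ∃ U ∈ 𝓝 y, UniformIntegrable (fun u : U => lossGrad f u.1) 1 P) :
    Continuous fun y => ∫ z, lossGrad f y z ∂P := by
  rw [continuous_iff_continuousAt]
  intro y
  obtain ⟨U, hU, hUI⟩ := hf_UI y
  have hint := integrable_lossGrad hf_UI
  refine tendsto_of_seq_tendsto fun w hw => ?_
  obtain ⟨N, hN⟩ := (eventually_atTop.1 (hw.eventually hU))
  rw [← tendsto_add_atTop_iff_nat N]
  refine tendsto_integral_of_L1' _ (hint y).1 (Eventually.of_forall fun n => hint _) ?_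
  refine tendsto_Lp_finite_of_tendsto_ae le_rfl ENNReal.one_ne_top (fun n => (hint _).1)
    (memLp_one_iff_integrable.2 (hint y)) ?_ ?_
  · intro ε hε
    obtain ⟨δ, hδ, h⟩ := hUI.2.1 hε
    exact ⟨δ, hδ, fun n s hs hs' => h ⟨w (n + N), hN _ (by omega)⟩ s hs hs'⟩
  · refine Eventually.of_forall fun z => ?_
    exact ((continuous_lossGrad (hf_C1 z)).tendsto y).comp
      (hw.comp (tendsto_add_atTop_nat N))

/-- The fundamental theorem of calculus for each z, then Fubini. The statement is local in t because
the uniform L¹ bound that justifies Fubini is available only while the segment stays in U. -/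
theorem risk_segment {f : Vec d → 𝓧 → ℝ} {P : Measure 𝓧} [IsProbabilityMeasure P]
    (hf_meas : ∀ x, Measurable (f x)) (hf_int : ∀ x, Integrable (f x) P)
    (hf_C1 : ∀ z, ContDiff ℝ 1 (fun y => f y z))
    (hf_UI : ∀ y : Vec d, ∃ U ∈ 𝓝 y, UniformIntegrable (fun u : U => lossGrad f u.1) 1 P)
    (y v : Vec d) :
    ∀ᶠ t : ℝ in 𝓝 0, risk f P (y + t • v) - risk f P y
      = ∫ s in (0 : ℝ)..t, inner ℝ (∫ z, lossGrad f (y + s • v) z ∂P) v := by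
  obtain ⟨U, hU, hUI⟩ := hf_UI y
  obtain ⟨Cb, hCb⟩ := hUI.2.2
  have hcont : Continuous fun t : ℝ => y + t • v := by fun_prop
  have hV : (fun t : ℝ => y + t • v) ⁻¹' U ∈ 𝓝 (0 : ℝ) :=
    hcont.continuousAt.preimage_mem_nhds (by simpa using hU)
  obtain ⟨r, hr, hball⟩ := Metric.mem_nhds_iff.1 hV
  filter_upwards [Metric.ball_mem_nhds (0 : ℝ) hr] with t ht
  have hsub : ∀ s ∈ Set.uIoc 0 t, y + s • v ∈ U := by
    intro s hs
    apply hball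
    rw [Metric.mem_ball, dist_zero_right, Real.norm_eq_abs] at ht ⊢
    have := Set.abs_sub_left_of_mem_uIcc (Set.uIoc_subset_uIcc hs)
    simp only [sub_zero] at this
    linarith
  have hmeas : Measurable (fun q : ℝ × 𝓧 => inner ℝ (lossGrad f (y + q.1 • v) q.2) v) := by
    have h1 : Measurable fun q : ℝ × 𝓧 => lossGrad f (y + q.1 • v) q.2 :=
      (measurable_uncurry_lossGrad hf_meas hf_C1).comp
        ((hcont.measurable.comp measurable_fst).prodMk measurable_snd)
    exact h1.inner_const
  have hL1 : ∀ s ∈ Set.uIoc 0 t, ∫ z, ‖inner ℝ (lossGrad f (y + s • v) z) v‖ ∂P ≤ Cb * ‖v‖ := by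
    intro s hs
    have hi := integrable_lossGrad hf_UI (y + s • v)
    calc ∫ z, ‖inner ℝ (lossGrad f (y + s • v) z) v‖ ∂P
        ≤ ∫ z, ‖lossGrad f (y + s • v) z‖ * ‖v‖ ∂P :=
          integral_mono (hi.inner_const v).norm (hi.norm.mul_const _)
            (fun z => norm_inner_le_norm _ _)
      _ = (∫ z, ‖lossGrad f (y + s • v) z‖ ∂P) * ‖v‖ := integral_mul_const _ _
      _ ≤ Cb * ‖v‖ := by
          gcongr
          have h := hCb ⟨y + s • v, hsub s hs⟩
          rw [eLpNorm_one_eq_lintegral_enorm] at h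
          rw [integral_norm_eq_lintegral_enorm hi.1]
          exact ENNReal.toReal_le_coe_of_le_coe h
  have hprod : Integrable (fun q : ℝ × 𝓧 => inner ℝ (lossGrad f (y + q.1 • v) q.2) v)
      ((volume.restrict (Set.uIoc 0 t)).prod P) := by
    rw [integrable_prod_iff hmeas.aestronglyMeasurable]
    have hsec : ∀ s : ℝ, Integrable (fun z => inner ℝ (lossGrad f (y + s • v) z) v) P := by
      intro s
      have hi := integrable_lossGrad hf_UI (y + s • v)
      exact hi.inner_const v
    refine ⟨Eventually.of_forall hsec, ?_⟩
    have : IsFiniteMeasure (volume.restrict (Set.uIoc 0 t)) :=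
      ⟨by rw [Measure.restrict_apply_univ, Set.uIoc]; exact measure_Ioc_lt_top⟩
    refine Integrable.mono' (g := fun _ => Cb * ‖v‖) (integrable_const _) ?_ ?_
    · exact (hmeas.norm.stronglyMeasurable.integral_prod_right').aestronglyMeasurable
    · filter_upwards [ae_restrict_mem measurableSet_uIoc] with s hs
      rw [Real.norm_of_nonneg (integral_nonneg fun z => norm_nonneg _)]
      exact hL1 s hs
  calc risk f P (y + t • v) - risk f P y
      = ∫ z, (f (y + t • v) z - f y z) ∂P := (integral_sub (hf_int _) (hf_int _)).symm
    _ = ∫ z, (∫ s in (0 : ℝ)..t, inner ℝ (lossGrad f (y + s • v) z) v) ∂P := by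
        refine integral_congr_ae (Eventually.of_forall fun z => ?_)
        have hd : ∀ s ∈ Set.uIcc 0 t, HasDerivAt (fun s : ℝ => f (y + s • v) z)
            (inner ℝ (lossGrad f (y + s • v) z) v) s :=
          fun s _ => hasDerivAt_loss_segment (hf_C1 z) y v s
        have hci : Continuous fun s : ℝ => inner ℝ (lossGrad f (y + s • v) z) v :=
          ((continuous_lossGrad (hf_C1 z)).comp hcont).inner continuous_const
        simp only
        rw [intervalIntegral.integral_eq_sub_of_hasDerivAt hd (hci.intervalIntegrable _ _)]
        simp
    _ = ∫ s in (0 : ℝ)..t, ∫ z, inner ℝ (lossGrad f (y + s • v) z) v ∂P :=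
        (intervalIntegral_integral_swap hprod).symm
    _ = _ := by
        refine intervalIntegral.integral_congr fun s _ => ?_
        rw [real_inner_comm, ← integral_inner (integrable_lossGrad hf_UI _)]
        simp_rw [real_inner_comm]

/-- The risk is differentiable by hypothesis, so only its directional derivatives need
identification. They are read off `risk_segment` at t = 0, the integrand there being continuous in
s. -/
theorem gradient_risk {f : Vec d → 𝓧 → ℝ} {P : Measure 𝓧} [IsProbabilityMeasure P]
    (hf_meas : ∀ x, Measurable (f x)) (hf_int : ∀ x, Integrable (f x) P)
    (hF_C1 : ContDiff ℝ 1 (risk f P))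
    (hf_C1 : ∀ z, ContDiff ℝ 1 (fun y => f y z))
    (hf_UI : ∀ y : Vec d, ∃ U ∈ 𝓝 y, UniformIntegrable (fun u : U => lossGrad f u.1) 1 P)
    (y : Vec d) : gradient (risk f P) y = ∫ z, lossGrad f y z ∂P := by
  refine ext_inner_right ℝ fun v => ?_
  have hG := continuous_integral_lossGrad hf_C1 hf_UI
  have hc : Continuous fun s : ℝ => inner ℝ (∫ z, lossGrad f (y + s • v) z ∂P) v :=
    (hG.comp (by fun_prop : Continuous fun s : ℝ => y + s • v)).inner continuous_const
  have h1 : HasDerivAt (fun t : ℝ => ∫ s in (0 : ℝ)..t,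
      inner ℝ (∫ z, lossGrad f (y + s • v) z ∂P) v)
      (inner ℝ (∫ z, lossGrad f (y + (0 : ℝ) • v) z ∂P) v) 0 :=
    hc.integral_hasStrictDerivAt 0 0 |>.hasDerivAt
  have h2 : HasDerivAt (fun t : ℝ => risk f P (y + t • v) - risk f P y)
      (inner ℝ (gradient (risk f P) y) v) 0 := by
    have h3 : HasFDerivAt (risk f P) (fderiv ℝ (risk f P) y) y :=
      (hF_C1.differentiable one_ne_zero y).hasFDerivAt
    have h4 : HasDerivAt (fun t : ℝ => risk f P (y + t • v)) (fderiv ℝ (risk f P) y v) 0 :=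
      h3.hasLineDerivAt v
    have h5 : inner ℝ (gradient (risk f P) y) v = fderiv ℝ (risk f P) y v := by
      simp [gradient]
    rw [h5]
    exact h4.sub_const _
  have h3 := h1.congr_of_eventuallyEq (risk_segment hf_meas hf_int hf_C1 hf_UI y v)
  have h4 := h2.unique h3
  simpa using h4

end StochasticGradient

/-! ### The natural filtration and the martingale difference property of the noise. -/

section Filtration

variable {d : ℕ} {𝓧 Ω : Type*} [MeasurableSpace 𝓧]

theorem measurable_past (ξ : ℕ → Ω → 𝓧) {i n : ℕ} (hi : 1 ≤ i) (hin : i ≤ n) :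
    Measurable[past ξ n] (ξ i) :=
  (comap_measurable (ξ i)).mono (le_iSup₂_of_le i (Finset.mem_Icc.2 ⟨hi, hin⟩) le_rfl) le_rfl

theorem measurable_sgd {f : Vec d → 𝓧 → ℝ} (hf_meas : ∀ x, Measurable (f x))
    (hf_C1 : ∀ z, ContDiff ℝ 1 (fun y => f y z)) (step : ℕ → ℝ) (x₀ : Vec d) (ξ : ℕ → Ω → 𝓧)
    {n i : ℕ} (hin : i ≤ n) : Measurable[past ξ n] (sgd f step x₀ ξ i) := by
  induction i with
  | zero => exact measurable_const
  | succ i ih =>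
    have h1 := ih (by omega)
    have h2 : Measurable[past ξ n] fun ω => lossGrad f (sgd f step x₀ ξ i ω) (ξ (i + 1) ω) :=
      (measurable_uncurry_lossGrad hf_meas hf_C1).comp
        (h1.prodMk (measurable_past ξ (Nat.succ_pos i) hin))
    exact Measurable.sub h1 (h2.const_smul (step (i + 1)))

theorem measurable_noise {f : Vec d → 𝓧 → ℝ} {P : Measure 𝓧} (hf_meas : ∀ x, Measurable (f x))
    (hf_C1 : ∀ z, ContDiff ℝ 1 (fun y => f y z)) (hG : Measurable (gradient (risk f P)))
    (step : ℕ → ℝ) (x₀ : Vec d) (ξ : ℕ → Ω → 𝓧) (n : ℕ) :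
    Measurable[past ξ (n + 1)] (noise f P ξ (sgd f step x₀ ξ) (n + 1)) := by
  have h1 := measurable_sgd hf_meas hf_C1 step x₀ ξ (Nat.le_succ n)
  have h2 := (measurable_uncurry_lossGrad hf_meas hf_C1).comp
      (h1.prodMk (measurable_past ξ (Nat.succ_pos n) le_rfl))
  exact Measurable.sub (hG.comp h1) h2

/-- The freezing lemma in the centred case: given m, X may be treated as fixed while Z keeps its law
P. -/
theorem condExp_comp_eq_zero_of_indep {E G : Type*} [NormedAddCommGroup E] [NormedSpace ℝ E]
    [CompleteSpace E] [MeasurableSpace G] {m m0 : MeasurableSpace Ω}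
    {μ : Measure Ω} [IsProbabilityMeasure μ]
    {P : Measure 𝓧} (hm : m ≤ m0) {X : Ω → G} (hX : Measurable[m] X)
    {Z : Ω → 𝓧} (hZ : Measurable Z) (hlaw : μ.map Z = P)
    (hind : Indep m (MeasurableSpace.comap Z inferInstance) μ)
    {φ : G → 𝓧 → E} (hφ : StronglyMeasurable (Function.uncurry φ))
    (hφ0 : ∀ y, ∫ z, φ y z ∂P = 0) (hint : Integrable (fun ω => φ (X ω) (Z ω)) μ) :
    μ[fun ω => φ (X ω) (Z ω) | m] =ᵐ[μ] 0 := by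
  refine (ae_eq_condExp_of_forall_setIntegral_eq hm hint
    (fun s _ _ => integrableOn_zero) (fun s hs _ => ?_) stronglyMeasurable_zero.aestronglyMeasurable).symm
  have hX0 : Measurable X := hX.mono hm le_rfl
  have hP : IsProbabilityMeasure P := hlaw ▸ Measure.isProbabilityMeasure_map hZ.aemeasurable
  -- Pairing X with the indicator of the test event s keeps everything m-measurable, so independence
  -- from Z covers both at once and Fubini applies to the product law.
  let Y : Ω → ℝ × G := fun ω => (s.indicator (fun _ => (1 : ℝ)) ω, X ω)
  have hYm : Measurable[m] Y := (measurable_const.indicator hs).prodMk hX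
  have hY : Measurable Y := hYm.mono hm le_rfl
  have hindYZ : IndepFun Y Z μ := by
    rw [IndepFun_iff_Indep]
    exact indep_of_indep_of_le_left hind hYm.comap_le
  have hmap := (indepFun_iff_map_prod_eq_prod_map_map hY.aemeasurable hZ.aemeasurable).1 hindYZ
  let ψ : (ℝ × G) × 𝓧 → E := fun q => q.1.1 • φ q.1.2 q.2
  have hψ : StronglyMeasurable ψ :=
    (measurable_fst.comp measurable_fst).stronglyMeasurable.smul
      (hφ.comp_measurable ((measurable_snd.comp measurable_fst).prodMk measurable_snd))
  have heq : (fun ω => ψ (Y ω, Z ω)) = s.indicator (fun ω => φ (X ω) (Z ω)) := by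
    ext ω
    by_cases hω : ω ∈ s <;> simp [ψ, Y, hω]
  have hi : Integrable (fun ω => ψ (Y ω, Z ω)) μ := heq ▸ hint.indicator (hm s hs)
  have hi2 : Integrable ψ ((μ.map Y).prod (μ.map Z)) := by
    rw [← hmap]
    exact (integrable_map_measure hψ.aestronglyMeasurable (hY.prodMk hZ).aemeasurable).2 hi
  calc ∫ ω in s, (0 : Ω → E) ω ∂μ = 0 := by simp
    _ = ∫ q, ∫ z, ψ (q, z) ∂(μ.map Z) ∂(μ.map Y) := by
        simp only [ψ, integral_smul, hlaw, hφ0, smul_zero, integral_zero]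
    _ = ∫ q, ψ q ∂((μ.map Y).prod (μ.map Z)) := (integral_prod ψ hi2).symm
    _ = ∫ ω, ψ (Y ω, Z ω) ∂μ := by
        rw [← hmap]
        exact integral_map (hY.prodMk hZ).aemeasurable hψ.aestronglyMeasurable
    _ = ∫ ω in s, φ (X ω) (Z ω) ∂μ := by
        rw [heq, integral_indicator (hm s hs)]

variable [m0 : MeasurableSpace Ω]

/-- The natural filtration of the sample. -/
def pastFiltration {ξ : ℕ → Ω → 𝓧} (hξ_meas : ∀ i, 1 ≤ i → Measurable (ξ i)) :
    Filtration ℕ m0 where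
  seq := past ξ
  mono' := fun _ _ hij => iSup₂_le fun k hk =>
    le_iSup₂_of_le k (Finset.Icc_subset_Icc_right hij hk) le_rfl
  le' := fun _ => iSup₂_le fun k hk => (hξ_meas k (Finset.mem_Icc.1 hk).1).comap_le

theorem indep_past {μ : Measure Ω} {ξ : ℕ → Ω → 𝓧}
    (hξ_meas : ∀ i, 1 ≤ i → Measurable (ξ i))
    (hξ_indep : iIndepFun (fun i : ℕ => ξ (i + 1)) μ) (n : ℕ) :
    Indep (past ξ n) (MeasurableSpace.comap (ξ (n + 1)) inferInstance) μ := by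
  have h := indep_iSup_of_disjoint (m := fun i : ℕ => MeasurableSpace.comap (ξ (i + 1)) inferInstance)
    (fun i => (hξ_meas (i + 1) (by omega)).comap_le) hξ_indep
    (S := Set.Iio n) (T := {n}) (by simp)
  refine indep_of_indep_of_le_left (indep_of_indep_of_le_right h ?_) ?_
  · exact le_iSup₂_of_le n (Set.mem_singleton n) le_rfl
  · refine iSup₂_le fun k hk => ?_
    obtain ⟨h1, h2⟩ := Finset.mem_Icc.1 hk
    obtain ⟨j, rfl⟩ : ∃ j, k = j + 1 := ⟨k - 1, by omega⟩
    exact le_iSup₂_of_le j (Set.mem_Iio.2 (by omega)) le_rfl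

theorem condExp_noise {f : Vec d → 𝓧 → ℝ} {P : Measure 𝓧} [IsProbabilityMeasure P]
    {μ : Measure Ω} [IsProbabilityMeasure μ] {ξ : ℕ → Ω → 𝓧}
    (hf_meas : ∀ x, Measurable (f x)) (hf_int : ∀ x, Integrable (f x) P)
    (hF_C1 : ContDiff ℝ 1 (risk f P)) (hG : Measurable (gradient (risk f P)))
    (hf_C1 : ∀ z, ContDiff ℝ 1 (fun y => f y z))
    (hf_UI : ∀ y : Vec d, ∃ U ∈ 𝓝 y, UniformIntegrable (fun u : U => lossGrad f u.1) 1 P)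
    (hξ_meas : ∀ i, 1 ≤ i → Measurable (ξ i))
    (hξ_indep : iIndepFun (fun i : ℕ => ξ (i + 1)) μ)
    (hξ_law : ∀ i, 1 ≤ i → μ.map (ξ i) = P) (step : ℕ → ℝ) (x₀ : Vec d) (n : ℕ)
    (hint : Integrable (noise f P ξ (sgd f step x₀ ξ) (n + 1)) μ) :
    μ[noise f P ξ (sgd f step x₀ ξ) (n + 1) | past ξ n] =ᵐ[μ] 0 := by
  refine condExp_comp_eq_zero_of_indep ((pastFiltration hξ_meas).le n)
    (X := sgd f step x₀ ξ n) (Z := ξ (n + 1)) (P := P)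
    (φ := fun y z => gradient (risk f P) y - lossGrad f y z)
    (measurable_sgd hf_meas hf_C1 step x₀ ξ le_rfl) (hξ_meas _ (Nat.succ_pos n))
    (hξ_law _ (Nat.succ_pos n)) (indep_past hξ_meas hξ_indep n) ?_ ?_ hint
  · exact ((hG.comp measurable_fst).sub
      (measurable_uncurry_lossGrad hf_meas hf_C1)).stronglyMeasurable
  · intro y
    rw [integral_sub (integrable_const _) (integrable_lossGrad hf_UI y), integral_const,
      gradient_risk hf_meas hf_int hF_C1 hf_C1 hf_UI]
    simp

end Filtration

/-! ### Fourth moments and compensated products of martingale sums. -/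

section MartingaleDifference

variable {Ω : Type*} {d : ℕ} {m m0 : MeasurableSpace Ω} {μ : Measure Ω}

theorem integral_inner_eq_zero_of_condExp [IsFiniteMeasure μ] (hm : m ≤ m0) {T e : Ω → Vec d}
    (hT : StronglyMeasurable[m] T) (he : Integrable e μ) (h0 : μ[e | m] =ᵐ[μ] 0)
    (hi : Integrable (fun ω => inner ℝ (T ω) (e ω)) μ) :
    ∫ ω, inner ℝ (T ω) (e ω) ∂μ = 0 := by
  have h := condExp_bilin_of_stronglyMeasurable_left (m := m) (innerSL ℝ (E := Vec d)) hT hi he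
  rw [← integral_condExp hm]
  refine integral_eq_zero_of_ae (h.trans ?_)
  filter_upwards [h0] with ω hω
  simp [hω]

theorem _root_.MeasureTheory.MemLp.integrable_norm_pow_four {X : Ω → Vec d} (hX : MemLp X 4 μ) :
    Integrable (fun ω => ‖X ω‖ ^ 4) μ := by
  have := MemLp.integrable_norm_pow (p := 4) (by exact_mod_cast hX) (by norm_num)
  exact this

theorem integrable_of_abs_le_pow_four [IsFiniteMeasure μ] {X Y : Ω → Vec d} (hX : MemLp X 4 μ)
    (hY : MemLp Y 4 μ) {h : Ω → ℝ} (hh : AEStronglyMeasurable h μ) (C : ℝ)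
    (hb : ∀ ω, |h ω| ≤ C * (1 + ‖X ω‖ ^ 4 + ‖Y ω‖ ^ 4)) : Integrable h μ :=
  Integrable.mono' ((((integrable_const (1 : ℝ)).add hX.integrable_norm_pow_four).add
    hY.integrable_norm_pow_four).const_mul C) hh (Eventually.of_forall hb)

theorem aestronglyMeasurable_coord {X : Ω → Vec d} (hX : AEStronglyMeasurable X μ) (p : Fin d) :
    AEStronglyMeasurable (fun ω => X ω p) μ :=
  (EuclideanSpace.proj (𝕜 := ℝ) p).continuous.comp_aestronglyMeasurable hX

theorem stronglyMeasurable_coord {X : Ω → Vec d} (hX : StronglyMeasurable[m] X) (p : Fin d) :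
    StronglyMeasurable[m] (fun ω => X ω p) :=
  (EuclideanSpace.proj (𝕜 := ℝ) p).continuous.comp_stronglyMeasurable hX

theorem abs_coord_le (x : Vec d) (p : Fin d) : |x p| ≤ ‖x‖ := by
  simpa using PiLp.norm_apply_le x p

theorem mul_pow_two_le_add {a b : ℝ} : a ^ 2 * b ^ 2 ≤ a ^ 4 + b ^ 4 := by
  nlinarith [sq_nonneg (a ^ 2 - b ^ 2), sq_nonneg (a ^ 2), sq_nonneg (b ^ 2)]

theorem sq_coord_mul_coord_le (x y : Vec d) (p q : Fin d) :
    (x p * y q) ^ 2 ≤ ‖x‖ ^ 2 * ‖y‖ ^ 2 := by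
  rw [mul_pow]
  gcongr ?_ * ?_
  · exact sq_le_sq.2 ((abs_coord_le x p).trans (le_abs_self _))
  · exact sq_le_sq.2 ((abs_coord_le y q).trans (le_abs_self _))

theorem memLp_two_coord_mul_coord [IsFiniteMeasure μ] {X Y : Ω → Vec d} (hX : MemLp X 4 μ)
    (hY : MemLp Y 4 μ) (p q : Fin d) : MemLp (fun ω => X ω p * Y ω q) 2 μ := by
  have hm : AEStronglyMeasurable (fun ω => X ω p * Y ω q) μ :=
    (aestronglyMeasurable_coord hX.1 p).mul (aestronglyMeasurable_coord hY.1 q)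
  rw [memLp_two_iff_integrable_sq hm]
  refine integrable_of_abs_le_pow_four hX hY (hm.pow 2) 1 fun ω => ?_
  rw [abs_of_nonneg (sq_nonneg _)]
  have h1 := sq_coord_mul_coord_le (X ω) (Y ω) p q
  have h2 := mul_pow_two_le_add (a := ‖X ω‖) (b := ‖Y ω‖)
  linarith

/-- Conditional orthogonality and Young's inequality for the fourth moment of a sum. -/
theorem integral_norm_add_pow_four_le [IsFiniteMeasure μ] (hm : m ≤ m0) {v e : Ω → Vec d}
    (hvm : StronglyMeasurable[m] v) (hv : MemLp v 4 μ) (he : MemLp e 4 μ)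
    (h0 : μ[e | m] =ᵐ[μ] 0) {θ : ℝ} (hθ : 0 < θ) :
    ∫ ω, ‖v ω + e ω‖ ^ 4 ∂μ
      ≤ (1 + 4 * θ) * ∫ ω, ‖v ω‖ ^ 4 ∂μ + (3 + 4 / θ) * ∫ ω, ‖e ω‖ ^ 4 ∂μ := by
  -- Here a = ‖v‖, b = ‖e‖, c = ⟨v, e⟩. The term 4a²c is not estimated: it is the pairing of e with
  -- the m-measurable vector ‖v‖² v, so it integrates to zero.
  have hpt : ∀ a b c : ℝ, 0 ≤ a → 0 ≤ b → |c| ≤ a * b →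
      (a ^ 2 + 2 * c + b ^ 2) ^ 2 ≤ (1 + 4 * θ) * a ^ 4 + (3 + 4 / θ) * b ^ 4
        + 4 * (a ^ 2 * c) := by
    intro a b c ha hb hc
    have hc2 : c ^ 2 ≤ a ^ 2 * b ^ 2 := by
      rw [← mul_pow]; exact sq_le_sq.2 (hc.trans (le_abs_self _))
    have h3 : c * b ^ 2 ≤ a * b ^ 3 := by
      have := mul_le_mul_of_nonneg_right ((le_abs_self c).trans hc) (sq_nonneg b)
      nlinarith
    have h4 : 2 * (a * b ^ 3) ≤ a ^ 2 * b ^ 2 + b ^ 4 := by nlinarith [sq_nonneg (a * b - b ^ 2)]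
    have h5 : 8 * (a ^ 2 * b ^ 2) ≤ 4 * θ * a ^ 4 + 4 / θ * b ^ 4 := by
      have : 0 ≤ 4 / θ * (θ * a ^ 2 - b ^ 2) ^ 2 := by positivity
      have h6 : 4 / θ * (θ * a ^ 2 - b ^ 2) ^ 2
          = 4 * θ * a ^ 4 - 8 * (a ^ 2 * b ^ 2) + 4 / θ * b ^ 4 := by
        field_simp; ring
      linarith
    nlinarith
  have hiT : Integrable (fun ω => inner ℝ (‖v ω‖ ^ 2 • v ω) (e ω)) μ := by
    refine integrable_of_abs_le_pow_four hv he
      (((hv.1.norm.pow 2).smul hv.1).inner he.1) 2 fun ω => ?_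
    refine (abs_real_inner_le_norm _ _).trans ?_
    rw [norm_smul, norm_pow, norm_norm]
    nlinarith [sq_nonneg (‖v ω‖ ^ 2 - ‖v ω‖ * ‖e ω‖), sq_nonneg (‖v ω‖ ^ 2 - ‖e ω‖ ^ 2),
      sq_nonneg (‖v ω‖ ^ 2), sq_nonneg (‖e ω‖ ^ 2)]
  have hT0 : ∫ ω, inner ℝ (‖v ω‖ ^ 2 • v ω) (e ω) ∂μ = 0 := integral_inner_eq_zero_of_condExp hm ((hvm.norm.pow 2).smul hvm)
    (he.integrable (by norm_num)) h0 hiT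
  have hi4 := hv.integrable_norm_pow_four.const_mul (1 + 4 * θ)
  have hie := he.integrable_norm_pow_four.const_mul (3 + 4 / θ)
  calc ∫ ω, ‖v ω + e ω‖ ^ 4 ∂μ
      ≤ ∫ ω, ((1 + 4 * θ) * ‖v ω‖ ^ 4 + (3 + 4 / θ) * ‖e ω‖ ^ 4
          + 4 * inner ℝ (‖v ω‖ ^ 2 • v ω) (e ω)) ∂μ := by
        refine integral_mono (hv.add he).integrable_norm_pow_four
          ((hi4.add hie).add (hiT.const_mul 4)) fun ω => ?_
        have h := hpt ‖v ω‖ ‖e ω‖ (inner ℝ (v ω) (e ω)) (norm_nonneg _) (norm_nonneg _)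
          (abs_real_inner_le_norm _ _)
        simp only [real_inner_smul_left]
        rw [← norm_add_sq_real] at h
        linarith [h, show (‖v ω + e ω‖ ^ 2) ^ 2 = ‖v ω + e ω‖ ^ 4 by ring]
    _ = _ := by
        have e1 : ∫ ω, ((1 + 4 * θ) * ‖v ω‖ ^ 4 + (3 + 4 / θ) * ‖e ω‖ ^ 4
          + 4 * inner ℝ (‖v ω‖ ^ 2 • v ω) (e ω)) ∂μ = _ :=
          integral_add (hi4.add hie) (hiT.const_mul 4)
        have e2 : ∫ ω, ((1 + 4 * θ) * ‖v ω‖ ^ 4 + (3 + 4 / θ) * ‖e ω‖ ^ 4) ∂μ = _ :=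
          integral_add hi4 hie
        refine e1.trans ?_
        rw [e2, integral_const_mul, integral_const_mul, integral_const_mul, hT0]
        simp

/-- A sequence of martingale differences with finite fourth moments; `e k` is revealed at time
`k + 1`. -/
structure IsMartingaleDiff (ℱ : Filtration ℕ m0) (e : ℕ → Ω → Vec d) (μ : Measure Ω) : Prop where
  stronglyMeasurable : ∀ k, StronglyMeasurable[ℱ (k + 1)] (e k)
  memLp : ∀ k, MemLp (e k) 4 μ
  condExp : ∀ k, μ[e k | ℱ k] =ᵐ[μ] 0

/-- The sum of the terms with index in `[s, j)`. -/
def windowSum {M : Type*} [AddCommMonoid M] (e : ℕ → Ω → M) (s j : ℕ) (ω : Ω) : M :=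
  ∑ k ∈ Finset.Ico s j, e k ω

theorem windowSum_succ {M : Type*} [AddCommMonoid M] (e : ℕ → Ω → M) {s j : ℕ} (h : s ≤ j)
    (ω : Ω) : windowSum e s (j + 1) ω = windowSum e s j ω + e j ω :=
  Finset.sum_Ico_succ_top h _

namespace IsMartingaleDiff

variable {ℱ : Filtration ℕ m0} {e : ℕ → Ω → Vec d}

theorem stronglyMeasurable_windowSum (he : IsMartingaleDiff ℱ e μ) (s j : ℕ) :
    StronglyMeasurable[ℱ j] (windowSum e s j) :=
  Finset.stronglyMeasurable_fun_sum _ fun k hk =>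
    (he.stronglyMeasurable k).mono (ℱ.mono (Finset.mem_Ico.1 hk).2)

theorem memLp_windowSum (he : IsMartingaleDiff ℱ e μ) (s j : ℕ) :
    MemLp (windowSum e s j) 4 μ :=
  memLp_finsetSum _ fun k _ => he.memLp k

/-- Adding one difference to a sum of l terms, with Young parameter θ = 1/(4l), raises 16 c l² by at
most 16 c l + 16 c l + 3c, which is below 16 c ((l+1)² - l²). The empty sum is separate because this
θ needs l > 0. -/
theorem integral_windowSum_pow_four_le [IsFiniteMeasure μ] (he : IsMartingaleDiff ℱ e μ) {c : ℝ}
    (hc : ∀ k, ∫ ω, ‖e k ω‖ ^ 4 ∂μ ≤ c) (s l : ℕ) :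
    ∫ ω, ‖windowSum e s (s + l) ω‖ ^ 4 ∂μ ≤ 16 * c * (l : ℝ) ^ 2 := by
  have hc0 : 0 ≤ c := (integral_nonneg fun ω => by positivity).trans (hc 0)
  induction l with
  | zero => simp [windowSum]
  | succ l ih =>
    have hs : ∀ ω, windowSum e s (s + (l + 1)) ω = windowSum e s (s + l) ω + e (s + l) ω :=
      windowSum_succ e (Nat.le_add_right s l)
    simp only [hs]
    rcases Nat.eq_zero_or_pos l with rfl | hl
    · simp only [windowSum, add_zero, Finset.Ico_self, Finset.sum_empty, zero_add]
      refine (hc s).trans ?_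
      norm_num
      linarith
    · have hl' : (0 : ℝ) < l := by exact_mod_cast hl
      have h := integral_norm_add_pow_four_le (ℱ.le (s + l))
        (he.stronglyMeasurable_windowSum s (s + l)) (he.memLp_windowSum s (s + l))
        (he.memLp (s + l)) (he.condExp (s + l)) (θ := 1 / (4 * l)) (by positivity)
      refine h.trans ?_
      have h1 : (1 + 4 * (1 / (4 * (l : ℝ)))) * ∫ ω, ‖windowSum e s (s + l) ω‖ ^ 4 ∂μ
          ≤ (1 + 4 * (1 / (4 * (l : ℝ)))) * (16 * c * (l : ℝ) ^ 2) := by gcongr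
      have h2 : (3 + 4 / (1 / (4 * (l : ℝ)))) * ∫ ω, ‖e (s + l) ω‖ ^ 4 ∂μ
          ≤ (3 + 4 / (1 / (4 * (l : ℝ)))) * c := by gcongr; exact hc _
      have h3 : (1 + 4 * (1 / (4 * (l : ℝ)))) * (16 * c * (l : ℝ) ^ 2)
          = 16 * c * l ^ 2 + 16 * c * l := by field_simp
      have h4 : (3 + 4 / (1 / (4 * (l : ℝ)))) * c = 3 * c + 16 * c * l := by field_simp; ring
      push_cast
      nlinarith [mul_nonneg hc0 hl'.le]

/-- The conditional covariance of the coordinates `p`, `q` of the `k`-th difference. -/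
noncomputable def _root_.OnlineSGD.condCov (ℱ : Filtration ℕ m0) (e : ℕ → Ω → Vec d) (μ : Measure Ω)
    (p q : Fin d) (k : ℕ) : Ω → ℝ :=
  μ[fun ω => e k ω p * e k ω q | ℱ k]

/-- The compensated product of the coordinates `p`, `q` of a window sum. -/
noncomputable def _root_.OnlineSGD.compProd (ℱ : Filtration ℕ m0) (e : ℕ → Ω → Vec d) (μ : Measure Ω)
    (p q : Fin d) (s j : ℕ) (ω : Ω) : ℝ :=
  windowSum e s j ω p * windowSum e s j ω q - windowSum (condCov ℱ e μ p q) s j ω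

theorem stronglyMeasurable_compProd (he : IsMartingaleDiff ℱ e μ) (p q : Fin d) (s j : ℕ) :
    StronglyMeasurable[ℱ j] (compProd ℱ e μ p q s j) := by
  have h := he.stronglyMeasurable_windowSum s j
  refine ((stronglyMeasurable_coord h p).mul (stronglyMeasurable_coord h q)).sub ?_
  exact Finset.stronglyMeasurable_fun_sum _ fun k hk =>
    stronglyMeasurable_condExp.mono (ℱ.mono (Finset.mem_Ico.1 hk).2.le)

variable [IsFiniteMeasure μ]

theorem memLp_condCov (he : IsMartingaleDiff ℱ e μ) (p q : Fin d) (k : ℕ) :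
    MemLp (condCov ℱ e μ p q k) 2 μ :=
  (memLp_two_coord_mul_coord (he.memLp k) (he.memLp k) p q).condExp one_le_two

theorem integral_condCov_sq_le (he : IsMartingaleDiff ℱ e μ) (p q : Fin d) (k : ℕ) :
    ∫ ω, condCov ℱ e μ p q k ω ^ 2 ∂μ ≤ ∫ ω, ‖e k ω‖ ^ 4 ∂μ := by
  have h := memLp_two_coord_mul_coord (he.memLp k) (he.memLp k) p q
  have hi : Integrable (fun ω => ‖e k ω p * e k ω q‖ ^ (2 : ℝ)) μ := by
    simpa only [Real.rpow_two, Real.norm_eq_abs, sq_abs] using h.integrable_sq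
  have hle := integral_norm_condExp_rpow_le (m := ℱ k) one_le_two hi
  simp only [Real.rpow_two, Real.norm_eq_abs, sq_abs] at hle
  refine hle.trans (integral_mono h.integrable_sq (he.memLp k).integrable_norm_pow_four fun ω => ?_)
  exact (sq_coord_mul_coord_le _ _ p q).trans_eq (by ring)

theorem memLp_compProd (he : IsMartingaleDiff ℱ e μ) (p q : Fin d) (s j : ℕ) :
    MemLp (compProd ℱ e μ p q s j) 2 μ :=
  (memLp_two_coord_mul_coord (he.memLp_windowSum s j) (he.memLp_windowSum s j) p q).sub
    (memLp_finsetSum _ fun k _ => he.memLp_condCov p q k)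

/-- Expanding (x - y)² ≤ 2x² + 2y², the product part contributes 2·16 c l² by the fourth moment
bound and the compensator 2 c l² by Cauchy-Schwarz and conditional Jensen. -/
theorem integral_compProd_sq_le (he : IsMartingaleDiff ℱ e μ) {c : ℝ}
    (hc : ∀ k, ∫ ω, ‖e k ω‖ ^ 4 ∂μ ≤ c) (p q : Fin d) (s l : ℕ) :
    ∫ ω, compProd ℱ e μ p q s (s + l) ω ^ 2 ∂μ ≤ 34 * c * (l : ℝ) ^ 2 := by
  have h1 := he.integral_windowSum_pow_four_le hc s l
  have hi1 := (he.memLp_windowSum s (s + l)).integrable_norm_pow_four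
  have hi2 : ∀ k, Integrable (fun ω => condCov ℱ e μ p q k ω ^ 2) μ :=
    fun k => (he.memLp_condCov p q k).integrable_sq
  have hi3 : Integrable (fun ω => ∑ k ∈ Finset.Ico s (s + l), condCov ℱ e μ p q k ω ^ 2) μ :=
    integrable_finsetSum _ fun k _ => hi2 k
  calc ∫ ω, compProd ℱ e μ p q s (s + l) ω ^ 2 ∂μ
      ≤ ∫ ω, (2 * ‖windowSum e s (s + l) ω‖ ^ 4
          + 2 * l * ∑ k ∈ Finset.Ico s (s + l), condCov ℱ e μ p q k ω ^ 2) ∂μ := by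
        refine integral_mono (he.memLp_compProd p q s (s + l)).integrable_sq
          ((hi1.const_mul 2).add (hi3.const_mul (2 * l))) fun ω => ?_
        have h2 := sq_coord_mul_coord_le (windowSum e s (s + l) ω) (windowSum e s (s + l) ω) p q
        have h3 := sq_sum_le_card_mul_sum_sq (s := Finset.Ico s (s + l))
          (f := fun k => condCov ℱ e μ p q k ω)
        rw [Nat.card_Ico, Nat.add_sub_cancel_left] at h3
        simp only [compProd]
        have h4 : (windowSum e s (s + l) ω p * windowSum e s (s + l) ω q
          - windowSum (condCov ℱ e μ p q) s (s + l) ω) ^ 2 ≤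
          2 * (windowSum e s (s + l) ω p * windowSum e s (s + l) ω q) ^ 2
          + 2 * (windowSum (condCov ℱ e μ p q) s (s + l) ω) ^ 2 := by
          nlinarith [sq_nonneg (windowSum e s (s + l) ω p * windowSum e s (s + l) ω q
            + windowSum (condCov ℱ e μ p q) s (s + l) ω)]
        have h5 : (windowSum (condCov ℱ e μ p q) s (s + l) ω) ^ 2 ≤
          l * ∑ k ∈ Finset.Ico s (s + l), condCov ℱ e μ p q k ω ^ 2 := h3
        nlinarith
    _ = 2 * ∫ ω, ‖windowSum e s (s + l) ω‖ ^ 4 ∂μ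
          + 2 * l * ∑ k ∈ Finset.Ico s (s + l), ∫ ω, condCov ℱ e μ p q k ω ^ 2 ∂μ := by
        rw [integral_add (hi1.const_mul 2) (hi3.const_mul (2 * l)), integral_const_mul,
          integral_const_mul, integral_finsetSum _ fun k _ => hi2 k]
    _ ≤ 2 * (16 * c * (l : ℝ) ^ 2) + 2 * l * ∑ k ∈ Finset.Ico s (s + l), c := by
        gcongr with k _
        exact (he.integral_condCov_sq_le p q k).trans (hc k)
    _ = 34 * c * (l : ℝ) ^ 2 := by
        rw [Finset.sum_const, Nat.card_Ico, Nat.add_sub_cancel_left]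
        simp only [nsmul_eq_mul]
        ring

/-- For fixed s the compensated product is a martingale in its upper end, starting from 0 at s,
hence orthogonal to everything known at time s. -/
theorem integral_mul_compProd_eq_zero (he : IsMartingaleDiff ℱ e μ) {s : ℕ} {h : Ω → ℝ}
    (hm : StronglyMeasurable[ℱ s] h) (h2 : MemLp h 2 μ) (p q : Fin d) (l : ℕ) :
    ∫ ω, h ω * compProd ℱ e μ p q s (s + l) ω ∂μ = 0 := by
  induction l with
  | zero => simp [compProd, windowSum]
  | succ l ih =>
    set j := s + l with hj
    have hmj : StronglyMeasurable[ℱ j] h := hm.mono (ℱ.mono (Nat.le_add_right s l))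
    set T : Ω → Vec d := windowSum e s j with hTdef
    have hT := he.memLp_windowSum s j
    have hTm := he.stronglyMeasurable_windowSum s j
    -- Packs the two cross terms T_p e_q + T_q e_p, weighted by h, into one inner product of e with
    -- a vector known at time j.
    let G : Ω → Vec d := fun ω =>
      (h ω * T ω p) • EuclideanSpace.single q 1 + (h ω * T ω q) • EuclideanSpace.single p 1
    have hG : ∀ ω, inner ℝ (G ω) (e j ω) = h ω * (T ω p * e j ω q) + h ω * (T ω q * e j ω p) := by
      intro ω
      simp [G, inner_add_left, real_inner_smul_left, EuclideanSpace.inner_single_left]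
      ring
    have hGm : StronglyMeasurable[ℱ j] G :=
      ((hmj.mul (stronglyMeasurable_coord hTm p)).smul_const _).add
        ((hmj.mul (stronglyMeasurable_coord hTm q)).smul_const _)
    have hi1 : Integrable (fun ω => h ω * (T ω p * e j ω q)) μ :=
      h2.integrable_mul (memLp_two_coord_mul_coord hT (he.memLp j) p q)
    have hi2 : Integrable (fun ω => h ω * (T ω q * e j ω p)) μ :=
      h2.integrable_mul (memLp_two_coord_mul_coord hT (he.memLp j) q p)
    have hiG : Integrable (fun ω => inner ℝ (G ω) (e j ω)) μ := by
      simp only [hG]; exact hi1.add hi2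
    have hG0 := integral_inner_eq_zero_of_condExp (ℱ.le j) hGm
      ((he.memLp j).integrable (by norm_num)) (he.condExp j) hiG
    have hee := memLp_two_coord_mul_coord (he.memLp j) (he.memLp j) p q
    have hi3 : Integrable (fun ω => h ω * (e j ω p * e j ω q)) μ := h2.integrable_mul hee
    have hi4 : Integrable (fun ω => h ω * condCov ℱ e μ p q j ω) μ :=
      h2.integrable_mul (he.memLp_condCov p q j)
    have hi5 : Integrable (fun ω => h ω * compProd ℱ e μ p q s j ω) μ :=
      h2.integrable_mul (he.memLp_compProd p q s j)
    have hcond : ∫ ω, h ω * (e j ω p * e j ω q) ∂μ = ∫ ω, h ω * condCov ℱ e μ p q j ω ∂μ := by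
      rw [← integral_condExp (ℱ.le j)]
      exact integral_congr_ae (condExp_mul_of_stronglyMeasurable_left hmj hi3
        (hee.integrable one_le_two))
    have hsplit : ∀ ω, h ω * compProd ℱ e μ p q s (s + (l + 1)) ω
        = h ω * compProd ℱ e μ p q s j ω + inner ℝ (G ω) (e j ω)
          + (h ω * (e j ω p * e j ω q) - h ω * condCov ℱ e μ p q j ω) := by
      intro ω
      have h1 : windowSum e s (s + (l + 1)) ω = T ω + e j ω :=
        windowSum_succ e (Nat.le_add_right s l) ω
      have h2 : windowSum (condCov ℱ e μ p q) s (s + (l + 1)) ω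
          = windowSum (condCov ℱ e μ p q) s j ω + condCov ℱ e μ p q j ω :=
        windowSum_succ _ (Nat.le_add_right s l) ω
      rw [hG]
      simp only [compProd, h1, h2, PiLp.add_apply, hTdef]
      ring
    simp only [hsplit]
    refine (integral_add (hi5.add hiG) (hi3.sub hi4)).trans ?_
    have e1 := integral_add hi5 hiG
    have e2 := integral_sub hi3 hi4
    rw [ih, hG0] at e1
    rw [hcond] at e2
    simp only [Pi.add_apply, Pi.sub_apply]
    rw [e1, e2]
    simp

end IsMartingaleDiff

/-- Expand the square. A pair (i, j) contributes only if the earlier index lies in the window of the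
later one; each window holds at most ℓ indices, and either index may be the later one, whence the
factor 2. -/
theorem integral_sum_sq_le_of_local_correlation {V : ℕ → Ω → ℝ} {t : ℕ → ℕ} {n : ℕ} {ℓ B : ℝ}
    (hV : ∀ i, MemLp (V i) 2 μ) (ht : ∀ j ∈ Finset.Icc 1 n, ((j + 1 - t j : ℕ) : ℝ) ≤ ℓ)
    (horth : ∀ i j, i < t j → t j ≤ j → ∫ ω, V i ω * V j ω ∂μ = 0)
    (htj : ∀ j ∈ Finset.Icc 1 n, t j ≤ j) (hB : ∀ i ∈ Finset.Icc 1 n, ∫ ω, V i ω ^ 2 ∂μ ≤ B) :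
    ∫ ω, (∑ i ∈ Finset.Icc 1 n, V i ω) ^ 2 ∂μ ≤ 2 * n * ℓ * B := by
  have hint : ∀ i j, Integrable (fun ω => V i ω * V j ω) μ :=
    fun i j => (hV i).integrable_mul (hV j)
  rcases Nat.eq_zero_or_pos n with rfl | hn
  · simp
  have hB0 : 0 ≤ B := (integral_nonneg fun ω => sq_nonneg _).trans
    (hB 1 (Finset.mem_Icc.2 ⟨le_rfl, hn⟩))
  have hcs : ∀ i ∈ Finset.Icc 1 n, ∀ j ∈ Finset.Icc 1 n, ∫ ω, V i ω * V j ω ∂μ ≤ B := by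
    intro i hi j hj
    have hii := (hV i).integrable_sq
    have hjj := (hV j).integrable_sq
    have h1 : ∫ ω, V i ω * V j ω ∂μ ≤ ∫ ω, (V i ω ^ 2 + V j ω ^ 2) / 2 ∂μ :=
      integral_mono (hint i j) ((hii.add hjj).div_const 2) fun ω => by
        simp only; nlinarith [sq_nonneg (V i ω - V j ω)]
    rw [integral_div, integral_add hii hjj] at h1
    linarith [hB i hi, hB j hj]
  have hterm : ∀ i ∈ Finset.Icc 1 n, ∀ j ∈ Finset.Icc 1 n, ∫ ω, V i ω * V j ω ∂μ
      ≤ (if i ∈ Finset.Ico (t j) (j + 1) then B else 0)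
        + (if j ∈ Finset.Ico (t i) (i + 1) then B else 0) := by
    intro i hi j hj
    have key := hcs i hi j hj
    simp only [Finset.mem_Ico]
    rcases le_total i j with hij | hij
    · by_cases h : t j ≤ i
      · rw [if_pos ⟨h, by omega⟩]
        split_ifs <;> linarith
      · rw [horth i j (by omega) (htj j hj)]
        split_ifs <;> linarith
    · by_cases h : t i ≤ j
      · rw [if_pos (⟨h, by omega⟩ : t i ≤ j ∧ j < i + 1)]
        split_ifs <;> linarith
      · simp_rw [mul_comm (V i _)]
        rw [horth j i (by omega) (htj i hi)]
        split_ifs <;> linarith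
  have hcount : ∀ j ∈ Finset.Icc 1 n,
      ∑ i ∈ Finset.Icc 1 n, (if i ∈ Finset.Ico (t j) (j + 1) then B else 0) ≤ ℓ * B := by
    intro j hj
    rw [← Finset.sum_filter, Finset.sum_const, nsmul_eq_mul]
    gcongr
    refine le_trans ?_ (ht j hj)
    rw [← Nat.card_Ico]
    exact_mod_cast Finset.card_le_card fun i hi => (Finset.mem_filter.1 hi).2
  calc ∫ ω, (∑ i ∈ Finset.Icc 1 n, V i ω) ^ 2 ∂μ
      = ∑ i ∈ Finset.Icc 1 n, ∑ j ∈ Finset.Icc 1 n, ∫ ω, V i ω * V j ω ∂μ := by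
        simp_rw [sq, Finset.sum_mul_sum]
        rw [integral_finsetSum _ fun i _ => integrable_finsetSum _ fun j _ => hint i j]
        exact Finset.sum_congr rfl fun i _ => integral_finsetSum _ fun j _ => hint i j
    _ ≤ ∑ i ∈ Finset.Icc 1 n, ∑ j ∈ Finset.Icc 1 n,
          ((if i ∈ Finset.Ico (t j) (j + 1) then B else 0)
            + (if j ∈ Finset.Ico (t i) (i + 1) then B else 0)) :=
        Finset.sum_le_sum fun i hi => Finset.sum_le_sum fun j hj => hterm i hi j hj
    _ = ∑ j ∈ Finset.Icc 1 n, ∑ i ∈ Finset.Icc 1 n,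
          (if i ∈ Finset.Ico (t j) (j + 1) then B else 0)
        + ∑ j ∈ Finset.Icc 1 n, ∑ i ∈ Finset.Icc 1 n,
          (if i ∈ Finset.Ico (t j) (j + 1) then B else 0) := by
        simp_rw [Finset.sum_add_distrib]
        rw [Finset.sum_comm]
    _ ≤ ∑ _j ∈ Finset.Icc 1 n, ℓ * B + ∑ _j ∈ Finset.Icc 1 n, ℓ * B :=
        add_le_add (Finset.sum_le_sum hcount) (Finset.sum_le_sum hcount)
    _ = 2 * n * ℓ * B := by
        simp only [Finset.sum_const, Nat.card_Icc, nsmul_eq_mul, Nat.add_sub_cancel]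
        ring

end MartingaleDifference

/-! ### Moment bounds for the SGD error. -/

section Moments

variable {Ω : Type*} {d : ℕ} {m0 : MeasurableSpace Ω} {μ : Measure Ω}

theorem memLp_two_norm_sq {X : Ω → Vec d} (hX : MemLp X 4 μ) : MemLp (fun ω => ‖X ω‖ ^ 2) 2 μ := by
  have hm : AEStronglyMeasurable (fun ω => ‖X ω‖ ^ 2) μ := hX.1.norm.pow 2
  rw [memLp_two_iff_integrable_sq hm]
  refine hX.integrable_norm_pow_four.congr (Eventually.of_forall fun ω => ?_)
  simp only; ring

section Probability

variable [IsProbabilityMeasure μ]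

/-- From |Z| ≤ w + Z²/w. It replaces Cauchy-Schwarz with a target scale w, so that no square root of
K appears in later constants. -/
theorem integral_abs_le_of_integral_sq_le {Z : Ω → ℝ} (hZ : MemLp Z 2 μ) {K w : ℝ} (hw : 0 < w)
    (h : ∫ ω, Z ω ^ 2 ∂μ ≤ K * w ^ 2) : ∫ ω, |Z ω| ∂μ ≤ (1 + K) * w := by
  have hi := hZ.integrable_sq
  have hK : 0 ≤ K := by
    have h0 : 0 ≤ K * w ^ 2 := (integral_nonneg fun ω => sq_nonneg (Z ω)).trans h
    exact nonneg_of_mul_nonneg_left h0 (by positivity)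
  have h1 : ∫ ω, |Z ω| ∂μ ≤ ∫ ω, (w + w⁻¹ * Z ω ^ 2) ∂μ := by
    refine integral_mono (hZ.integrable one_le_two).abs
      ((integrable_const _).add (hi.const_mul _)) fun ω => ?_
    simp only
    have h2 : w * |Z ω| ≤ w * (w + w⁻¹ * Z ω ^ 2) := by
      rw [mul_add, ← mul_assoc, mul_inv_cancel₀ hw.ne', ← sq_abs]
      nlinarith [sq_nonneg (w - |Z ω|), sq_nonneg (|Z ω|), sq_nonneg w]
    exact le_of_mul_le_mul_left h2 hw
  rw [integral_add (integrable_const _) (hi.const_mul _), integral_const_mul] at h1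
  simp only [integral_const, probReal_univ, one_smul] at h1
  have h3 : w⁻¹ * ∫ ω, Z ω ^ 2 ∂μ ≤ w⁻¹ * (K * w ^ 2) := by gcongr
  have h4 : w⁻¹ * (K * w ^ 2) = K * w := by field_simp
  linarith

theorem memLp_two_of_four {X : Ω → Vec d} (hX : MemLp X 4 μ) : MemLp X 2 μ :=
  hX.mono_exponent (by norm_num)

theorem integral_norm_sq_le_of_pow_four {X : Ω → Vec d} (hX : MemLp X 4 μ) {K w : ℝ} (hw : 0 < w)
    (h : ∫ ω, ‖X ω‖ ^ 4 ∂μ ≤ K * w ^ 2) : ∫ ω, ‖X ω‖ ^ 2 ∂μ ≤ (1 + K) * w := by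
  have := integral_abs_le_of_integral_sq_le (memLp_two_norm_sq hX) hw
    (by simpa only [← pow_mul] using h)
  simpa only [abs_pow, abs_norm] using this

theorem integral_norm_le_of_norm_sq {X : Ω → Vec d} (hX : MemLp X 4 μ) {K w : ℝ} (hw : 0 < w)
    (h : ∫ ω, ‖X ω‖ ^ 2 ∂μ ≤ K * w ^ 2) : ∫ ω, ‖X ω‖ ∂μ ≤ (1 + K) * w := by
  have := integral_abs_le_of_integral_sq_le (memLp_two_of_four hX).norm hw h
  simpa only [abs_norm] using this

end Probability

variable {ℱ : Filtration ℕ m0} {e δ : ℕ → Ω → Vec d} {h : Vec d → Vec d} {step : ℕ → ℝ}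

/-- `δ` follows the stochastic gradient recursion for the vector field `h` (a gradient field,
centred at its zero) with noise `e`. -/
structure IsSGDError (ℱ : Filtration ℕ m0) (e : ℕ → Ω → Vec d) (μ : Measure Ω)
    (δ : ℕ → Ω → Vec d) (h : Vec d → Vec d) (step : ℕ → ℝ) : Prop where
  noise : IsMartingaleDiff ℱ e μ
  stronglyMeasurable : ∀ k, StronglyMeasurable[ℱ k] (δ k)
  memLp_zero : MemLp (δ 0) 4 μ
  continuous : Continuous h
  recursion : ∀ k ω, δ (k + 1) ω = (δ k ω - step (k + 1) • h (δ k ω)) + step (k + 1) • e k ω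

namespace IsSGDError

theorem memLp_field (H : IsSGDError ℱ e μ δ h step) {L : ℝ} (hL : ∀ v, ‖h v‖ ≤ L * ‖v‖) {k : ℕ}
    (hk : MemLp (δ k) 4 μ) : MemLp (fun ω => h (δ k ω)) 4 μ :=
  hk.of_le_mul (H.continuous.comp_aestronglyMeasurable hk.1) (Eventually.of_forall fun _ => hL _)

theorem memLp (H : IsSGDError ℱ e μ δ h step) {L : ℝ} (hL : ∀ v, ‖h v‖ ≤ L * ‖v‖) (k : ℕ) :
    MemLp (δ k) 4 μ := by
  induction k with
  | zero => exact H.memLp_zero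
  | succ k ih =>
    have h1 : δ (k + 1) = fun ω => (δ k ω - step (k + 1) • h (δ k ω)) + step (k + 1) • e k ω :=
      funext (H.recursion k)
    rw [h1]
    have h2 := (H.memLp_field hL ih).const_smul (step (k + 1))
    have h3 := (H.noise.memLp k).const_smul (step (k + 1))
    exact (ih.sub h2).add h3

variable [IsProbabilityMeasure μ]

/-- The deterministic part of the step contracts: ‖δ - s h(δ)‖² ≤ (1 - 2sm + s²L²)‖δ‖² ≤ (1 -
sm)‖δ‖². The noise enters through the fourth moment inequality for a conditionally centred
perturbation. -/
theorem integral_pow_four_succ_le (H : IsSGDError ℱ e μ δ h step) {m L c : ℝ} (hm : 0 < m)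
    (hmono : ∀ v, m * ‖v‖ ^ 2 ≤ inner ℝ (h v) v) (hL : ∀ v, ‖h v‖ ≤ L * ‖v‖)
    (hmom : ∀ k, ∫ ω, ‖e k ω‖ ^ 4 ∂μ ≤ c * (1 + ∫ ω, ‖δ k ω‖ ^ 4 ∂μ)) {k : ℕ}
    (hs : 0 < step (k + 1)) (hsL : step (k + 1) * L ^ 2 ≤ m) (hsm : step (k + 1) * m ≤ 1) :
    ∫ ω, ‖δ (k + 1) ω‖ ^ 4 ∂μ ≤ (1 - 3 / 4 * (step (k + 1) * m)) * ∫ ω, ‖δ k ω‖ ^ 4 ∂μ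
      + (3 * step (k + 1) + 64 / m) * step (k + 1) ^ 3 * (c * (1 + ∫ ω, ‖δ k ω‖ ^ 4 ∂μ)) := by
  set s := step (k + 1) with hsdef
  have hδ := H.memLp hL k
  have hδ4 := hδ.integrable_norm_pow_four
  let v : Ω → Vec d := fun ω => δ k ω - s • h (δ k ω)
  have hvm : StronglyMeasurable[ℱ k] v :=
    (H.stronglyMeasurable k).sub
      ((H.continuous.comp_stronglyMeasurable (H.stronglyMeasurable k)).const_smul s)
  have hv : MemLp v 4 μ := hδ.sub ((H.memLp_field hL hδ).const_smul s)
  have hse : MemLp (fun ω => s • e k ω) 4 μ := (H.noise.memLp k).const_smul s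
  have h0 : μ[fun ω => s • e k ω | ℱ k] =ᵐ[μ] 0 := by
    refine (condExp_smul s (e k) (ℱ k)).trans ?_
    filter_upwards [H.noise.condExp k] with ω hω
    simp [hω]
  have hv2 : ∀ ω, ‖v ω‖ ^ 2 ≤ (1 - s * m) * ‖δ k ω‖ ^ 2 := by
    intro ω
    have h1 : ‖v ω‖ ^ 2 = ‖δ k ω‖ ^ 2 - 2 * (s * inner ℝ (h (δ k ω)) (δ k ω))
        + s ^ 2 * ‖h (δ k ω)‖ ^ 2 := by
      simp only [v]
      rw [norm_sub_sq_real, real_inner_smul_right, norm_smul, mul_pow, real_inner_comm,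
        Real.norm_eq_abs, sq_abs]
    have h2 := mul_le_mul_of_nonneg_left (hmono (δ k ω)) hs.le
    have h3 : ‖h (δ k ω)‖ ^ 2 ≤ L ^ 2 * ‖δ k ω‖ ^ 2 := by
      rw [← mul_pow]; gcongr; exact hL _
    have h4 : s ^ 2 * ‖h (δ k ω)‖ ^ 2 ≤ s * m * ‖δ k ω‖ ^ 2 := by
      calc s ^ 2 * ‖h (δ k ω)‖ ^ 2 ≤ s ^ 2 * (L ^ 2 * ‖δ k ω‖ ^ 2) := by gcongr
        _ = s * (s * L ^ 2) * ‖δ k ω‖ ^ 2 := by ring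
        _ ≤ s * m * ‖δ k ω‖ ^ 2 := by gcongr
    rw [h1]
    nlinarith
  have hv4 : ∫ ω, ‖v ω‖ ^ 4 ∂μ ≤ (1 - s * m) * ∫ ω, ‖δ k ω‖ ^ 4 ∂μ := by
    rw [← integral_const_mul]
    refine integral_mono hv.integrable_norm_pow_four (hδ4.const_mul _) fun ω => ?_
    have h1 : (‖v ω‖ ^ 2) ^ 2 ≤ ((1 - s * m) * ‖δ k ω‖ ^ 2) ^ 2 := by gcongr; exact hv2 ω
    have h2 : 0 ≤ s * m := by positivity
    have h3 : (1 - s * m) ^ 2 ≤ 1 - s * m := by nlinarith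
    calc ‖v ω‖ ^ 4 = (‖v ω‖ ^ 2) ^ 2 := by ring
      _ ≤ (1 - s * m) ^ 2 * ‖δ k ω‖ ^ 4 := h1.trans_eq (by ring)
      _ ≤ (1 - s * m) * ‖δ k ω‖ ^ 4 := by gcongr
  -- With θ = sm/16 the Young loss is sm/4, leaving 1 - 3sm/4 of the contraction, while 4/θ =
  -- 64/(sm) turns s⁴ into s³.
  have hkey := integral_norm_add_pow_four_le (ℱ.le k) hvm hv hse h0 (θ := s * m / 16)
    (by positivity)
  have hrec : ∀ ω, δ (k + 1) ω = v ω + s • e k ω := H.recursion k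
  simp_rw [hrec]
  have hu0 : 0 ≤ ∫ ω, ‖δ k ω‖ ^ 4 ∂μ := integral_nonneg fun ω => by positivity
  have he4 : ∫ ω, ‖s • e k ω‖ ^ 4 ∂μ = s ^ 4 * ∫ ω, ‖e k ω‖ ^ 4 ∂μ := by
    rw [← integral_const_mul]
    refine integral_congr_ae (Eventually.of_forall fun ω => ?_)
    simp only
    rw [norm_smul, mul_pow, Real.norm_of_nonneg hs.le]
  refine hkey.trans (add_le_add ?_ ?_)
  · calc (1 + 4 * (s * m / 16)) * ∫ ω, ‖v ω‖ ^ 4 ∂μ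
        ≤ (1 + 4 * (s * m / 16)) * ((1 - s * m) * ∫ ω, ‖δ k ω‖ ^ 4 ∂μ) := by gcongr
      _ ≤ _ := by
        rw [← mul_assoc]
        gcongr
        nlinarith [sq_nonneg (s * m)]
  · rw [he4]
    calc (3 + 4 / (s * m / 16)) * (s ^ 4 * ∫ ω, ‖e k ω‖ ^ 4 ∂μ)
        ≤ (3 + 4 / (s * m / 16)) * (s ^ 4 * (c * (1 + ∫ ω, ‖δ k ω‖ ^ 4 ∂μ))) := by
          gcongr; exact hmom k
      _ = _ := by field_simp; ring

/-- For small steps the part of the noise moment proportional to E‖δ‖⁴ is at most (m/4) s E‖δ‖⁴. It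
is absorbed by the contraction, leaving the rate sm/2 and a forcing term of order s³. -/
theorem exists_integral_pow_four_le {η α : ℝ} (hη : 0 < η) (hα0 : 0 < α) (hα1 : α < 1)
    (H : IsSGDError ℱ e μ δ h (stepSize η α)) {m L c : ℝ} (hm : 0 < m) (hc : 0 ≤ c)
    (hmono : ∀ v, m * ‖v‖ ^ 2 ≤ inner ℝ (h v) v) (hL : ∀ v, ‖h v‖ ≤ L * ‖v‖)
    (hmom : ∀ k, ∫ ω, ‖e k ω‖ ^ 4 ∂μ ≤ c * (1 + ∫ ω, ‖δ k ω‖ ^ 4 ∂μ)) :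
    ∃ K, 0 ≤ K ∧ ∀ n, 1 ≤ n → ∫ ω, ‖δ n ω‖ ^ 4 ∂μ ≤ K * (n : ℝ) ^ (-(2 * α)) := by
  refine exists_le_mul_rpow_of_recursion (c := η * m / 2) (B := (3 + 64 / m) * η ^ 3 * c)
    hα0 hα1 (by positivity) (fun n => integral_nonneg fun ω => by positivity) ?_
  have ht : Tendsto (fun n : ℕ => stepSize η α (n + 1)) atTop (𝓝 0) := by
    have h1 : Tendsto (fun n : ℕ => (n : ℝ) + 1) atTop atTop :=
      tendsto_atTop_add_const_right _ _ tendsto_natCast_atTop_atTop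
    have h2 := ((tendsto_rpow_neg_atTop hα0).comp h1).const_mul η
    simpa [stepSize, Function.comp_def] using h2
  have hcont : ∀ g : ℝ → ℝ, Continuous g → g 0 = 0 → ∀ b : ℝ, 0 < b →
      ∀ᶠ n : ℕ in atTop, g (stepSize η α (n + 1)) < b := by
    intro g hg hg0 b hb
    have h1 := (hg.tendsto 0).comp ht
    rw [hg0] at h1
    exact h1.eventually (gt_mem_nhds hb)
  filter_upwards [hcont (fun s => s * L ^ 2) (by fun_prop) (by simp) m hm,
    hcont (fun s => s * m) (by fun_prop) (by simp) 1 one_pos,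
    hcont (fun s => s) (by fun_prop) (by simp) 1 one_pos,
    hcont (fun s => (3 * s + 64 / m) * s ^ 2 * c) (by fun_prop) (by simp) (m / 4) (by positivity)]
    with n h1 h2 h3 h4
  have hs : 0 < stepSize η α (n + 1) := by unfold stepSize; positivity
  have key := H.integral_pow_four_succ_le hm hmono hL hmom hs h1.le h2.le
  have hsy : stepSize η α (n + 1) = η * ((n : ℝ) + 1) ^ (-α) := by simp [stepSize]
  set u := ∫ ω, ‖δ n ω‖ ^ 4 ∂μ
  have hu0 : 0 ≤ u := integral_nonneg fun ω => by positivity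
  set y := ((n : ℝ) + 1) ^ (-α)
  set s := stepSize η α (n + 1)
  have e1 : (1 - η * m / 2 * y) * u = (1 - s * m / 2) * u := by rw [hsy]; ring
  have e2 : (3 + 64 / m) * η ^ 3 * c * y ^ 3 = (3 * 1 + 64 / m) * s ^ 3 * c := by rw [hsy]; ring
  rw [e1, e2]
  have h5 : (3 * s + 64 / m) * s ^ 3 * c ≤ (3 * 1 + 64 / m) * s ^ 3 * c := by
    have : 0 ≤ 64 / m := by positivity
    gcongr
  have h6 : (3 * s + 64 / m) * s ^ 3 * c * u ≤ m / 4 * s * u := by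
    have := mul_le_mul_of_nonneg_right h4.le (mul_nonneg hs.le hu0)
    linarith
  nlinarith

end IsSGDError

end Moments

/-! ### Sums of scaled increments. -/

section PartialSums

variable {Ω : Type*} {d : ℕ} {m0 : MeasurableSpace Ω} {μ : Measure Ω}
  {δ : ℕ → Ω → Vec d}

theorem norm_add_sub_sq_le {E : Type*} [SeminormedAddCommGroup E] (a b c : E) :
    ‖a - b + c‖ ^ 2 ≤ 3 * (‖a‖ ^ 2 + ‖b‖ ^ 2 + ‖c‖ ^ 2) := by
  have h1 : ‖a - b + c‖ ≤ ‖a‖ + ‖b‖ + ‖c‖ :=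
    (norm_add_le _ _).trans (by gcongr; exact norm_sub_le _ _)
  have h2 : ‖a - b + c‖ ^ 2 ≤ (‖a‖ + ‖b‖ + ‖c‖) ^ 2 := by gcongr
  nlinarith [sq_nonneg (‖a‖ - ‖b‖), sq_nonneg (‖a‖ - ‖c‖), sq_nonneg (‖b‖ - ‖c‖)]

theorem integral_norm_add_sub_sq_le {X Y Z : Ω → Vec d} (hX : MemLp X 2 μ) (hY : MemLp Y 2 μ)
    (hZ : MemLp Z 2 μ) : ∫ ω, ‖X ω - Y ω + Z ω‖ ^ 2 ∂μ
      ≤ 3 * (∫ ω, ‖X ω‖ ^ 2 ∂μ + ∫ ω, ‖Y ω‖ ^ 2 ∂μ + ∫ ω, ‖Z ω‖ ^ 2 ∂μ) := by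
  have hi : ∀ {X : Ω → Vec d}, MemLp X 2 μ → Integrable (fun ω => ‖X ω‖ ^ 2) μ :=
    fun h => h.norm.integrable_sq
  have h1 : ∫ ω, ‖X ω - Y ω + Z ω‖ ^ 2 ∂μ
      ≤ ∫ ω, 3 * (‖X ω‖ ^ 2 + ‖Y ω‖ ^ 2 + ‖Z ω‖ ^ 2) ∂μ :=
    integral_mono (hi ((hX.sub hY).add hZ)) ((((hi hX).add (hi hY)).add (hi hZ)).const_mul 3)
      fun ω => norm_add_sub_sq_le _ _ _
  have e1 : ∫ ω, (‖X ω‖ ^ 2 + ‖Y ω‖ ^ 2 + ‖Z ω‖ ^ 2) ∂μ = _ :=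
    integral_add ((hi hX).add (hi hY)) (hi hZ)
  have e2 : ∫ ω, (‖X ω‖ ^ 2 + ‖Y ω‖ ^ 2) ∂μ = _ := integral_add (hi hX) (hi hY)
  rw [integral_const_mul] at h1
  rwa [e1, e2] at h1

/-- The mean square of the sum of the scaled increments `(δ_k - δ_{k+1}) / η_{k+1}`. -/
theorem integral_norm_sum_increments_sq_le {η α K : ℝ} (hη : 0 < η) (hα0 : 0 < α) (hα1 : α < 1)
    (hδ : ∀ k, MemLp (δ k) 2 μ)
    (hK : ∀ k, 1 ≤ k → ∫ ω, ‖δ k ω‖ ^ 2 ∂μ ≤ K * (k : ℝ) ^ (-α)) {s j : ℕ} (hs : 1 ≤ s)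
    (hsj : s ≤ j) :
    ∫ ω, ‖∑ k ∈ Finset.Ico s j, (stepSize η α (k + 1))⁻¹ • (δ k ω - δ (k + 1) ω)‖ ^ 2 ∂μ
      ≤ 78 * K / η ^ 2 * (j : ℝ) ^ α := by
  have hK0 : 0 ≤ K := by
    have h1 := (integral_nonneg fun ω => sq_nonneg ‖δ 1 ω‖).trans (hK 1 le_rfl)
    simpa using h1
  have hj : 1 ≤ j := hs.trans hsj
  have hj0 : (0 : ℝ) < j := by exact_mod_cast hj
  have hi : ∀ k, Integrable (fun ω => ‖δ k ω‖ ^ 2) μ := fun k => (hδ k).norm.integrable_sq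
  let c : ℕ → ℝ := fun k => (stepSize η α (k + 1))⁻¹
  have hc : ∀ k, c k = ((k : ℝ) + 1) ^ α / η := by
    intro k
    simp only [c, stepSize]
    rw [Real.rpow_neg (by positivity), mul_inv, inv_inv]
    push_cast
    field_simp
  -- For k ≥ 1 this is c k - c (k - 1), the weight left on δ k by summation by parts.
  let w : ℕ → ℝ := fun k => (((k : ℝ) + 1) ^ α - (k : ℝ) ^ α) / η
  have hw0 : ∀ k, 0 ≤ w k := fun k => by
    have : (k : ℝ) ^ α ≤ ((k : ℝ) + 1) ^ α := by gcongr; linarith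
    exact div_nonneg (by linarith) hη.le
  have hend : ∀ k, 1 ≤ k → k ≤ j → ∫ ω, ‖c k • δ k ω‖ ^ 2 ∂μ ≤ 4 * K / η ^ 2 * (j : ℝ) ^ α := by
    intro k hk hkj
    have hk0 : (0 : ℝ) < k := by exact_mod_cast hk
    have hkj' : (k : ℝ) ≤ j := by exact_mod_cast hkj
    have h1 : ∫ ω, ‖c k • δ k ω‖ ^ 2 ∂μ = c k ^ 2 * ∫ ω, ‖δ k ω‖ ^ 2 ∂μ := by
      rw [← integral_const_mul]
      refine integral_congr_ae (Eventually.of_forall fun ω => ?_)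
      simp only
      rw [norm_smul, mul_pow, Real.norm_eq_abs, sq_abs]
    have h2 := natCast_rpow_mul_le hk hα0.le hα1.le
    have h3 : c k ^ 2 ≤ (2 * (k : ℝ) ^ α / η) ^ 2 := by
      rw [hc]; gcongr
    have h4 : (k : ℝ) ^ α * (k : ℝ) ^ (-α) = 1 := by
      rw [← Real.rpow_add hk0, add_neg_cancel, Real.rpow_zero]
    calc ∫ ω, ‖c k • δ k ω‖ ^ 2 ∂μ = c k ^ 2 * ∫ ω, ‖δ k ω‖ ^ 2 ∂μ := h1
      _ ≤ (2 * (k : ℝ) ^ α / η) ^ 2 * (K * (k : ℝ) ^ (-α)) := by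
          gcongr; exact hK k hk
      _ = 4 * K / η ^ 2 * (k : ℝ) ^ α * ((k : ℝ) ^ α * (k : ℝ) ^ (-α)) := by ring
      _ = 4 * K / η ^ 2 * (k : ℝ) ^ α := by rw [h4, mul_one]
      _ ≤ _ := by gcongr
  have hsumw : ∑ k ∈ Finset.Ico (s + 1) (j + 1), w k * (k : ℝ) ^ (-(α / 2))
      ≤ 3 * ((j : ℝ) + 1) ^ (α / 2) / η := by
    have h1 := sum_rpow_sub_mul_rpow_neg_le hα0.le hα1.le (by omega : 1 ≤ s + 1)
      (by omega : s + 1 ≤ j + 1)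
    push_cast at h1
    rw [le_div_iff₀ hη, Finset.sum_mul]
    refine le_trans (le_of_eq (Finset.sum_congr rfl fun k _ => ?_)) h1
    simp only [w]; field_simp
  have hmid : ∫ ω, ‖∑ k ∈ Finset.Ico (s + 1) (j + 1), w k • δ k ω‖ ^ 2 ∂μ
      ≤ 18 * K / η ^ 2 * (j : ℝ) ^ α := by
    -- Cauchy-Schwarz weighted by k^{∓α/2}: since E‖δ_k‖² is O(k^{-α}), both factors then reduce to
    -- the sum in `hsumw`, of order j^{α/2}.
    have hpt : ∀ ω, ‖∑ k ∈ Finset.Ico (s + 1) (j + 1), w k • δ k ω‖ ^ 2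
        ≤ (3 * ((j : ℝ) + 1) ^ (α / 2) / η) *
          ∑ k ∈ Finset.Ico (s + 1) (j + 1), w k * (k : ℝ) ^ (α / 2) * ‖δ k ω‖ ^ 2 := by
      intro ω
      have h1 : ‖∑ k ∈ Finset.Ico (s + 1) (j + 1), w k • δ k ω‖
          ≤ ∑ k ∈ Finset.Ico (s + 1) (j + 1), w k * ‖δ k ω‖ := by
        refine (norm_sum_le _ _).trans (le_of_eq (Finset.sum_congr rfl fun k _ => ?_))
        rw [norm_smul, Real.norm_of_nonneg (hw0 k)]
      have h2 := Finset.sum_sq_le_sum_mul_sum_of_sq_le_mul (Finset.Ico (s + 1) (j + 1))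
        (r := fun k => w k * ‖δ k ω‖) (f := fun k => w k * (k : ℝ) ^ (-(α / 2)))
        (g := fun k => w k * (k : ℝ) ^ (α / 2) * ‖δ k ω‖ ^ 2)
        (fun k _ => mul_nonneg (hw0 k) (by positivity))
        (fun k _ => mul_nonneg (mul_nonneg (hw0 k) (by positivity)) (by positivity))
        (fun k hk => by
          have hk0 : (0 : ℝ) < k := by
            have := (Finset.mem_Ico.1 hk).1
            exact_mod_cast (by omega : 0 < k)
          have h4 : (k : ℝ) ^ (-(α / 2)) * (k : ℝ) ^ (α / 2) = 1 := by
            rw [← Real.rpow_add hk0, neg_add_cancel, Real.rpow_zero]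
          refine le_of_eq ?_
          calc (w k * ‖δ k ω‖) ^ 2 = w k ^ 2 * ‖δ k ω‖ ^ 2 * 1 := by ring
            _ = _ := by rw [← h4]; ring)
      calc ‖∑ k ∈ Finset.Ico (s + 1) (j + 1), w k • δ k ω‖ ^ 2
          ≤ (∑ k ∈ Finset.Ico (s + 1) (j + 1), w k * ‖δ k ω‖) ^ 2 := by gcongr
        _ ≤ _ := h2.trans (mul_le_mul_of_nonneg_right hsumw (Finset.sum_nonneg fun k _ =>
            mul_nonneg (mul_nonneg (hw0 k) (by positivity)) (by positivity)))
    have hint : Integrable (fun ω => ∑ k ∈ Finset.Ico (s + 1) (j + 1),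
        w k * (k : ℝ) ^ (α / 2) * ‖δ k ω‖ ^ 2) μ :=
      integrable_finsetSum _ fun k _ => (hi k).const_mul _
    have hL2 : MemLp (fun ω => ∑ k ∈ Finset.Ico (s + 1) (j + 1), w k • δ k ω) 2 μ :=
      memLp_finsetSum _ fun k _ => (hδ k).const_smul (w k)
    have h5 : ∑ k ∈ Finset.Ico (s + 1) (j + 1), w k * (k : ℝ) ^ (α / 2) * ∫ ω, ‖δ k ω‖ ^ 2 ∂μ
        ≤ K * (3 * ((j : ℝ) + 1) ^ (α / 2) / η) := by
      refine le_trans ?_ (mul_le_mul_of_nonneg_left hsumw hK0)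
      rw [Finset.mul_sum]
      refine Finset.sum_le_sum fun k hk => ?_
      have hk1 : 1 ≤ k := by have := (Finset.mem_Ico.1 hk).1; omega
      have hk0 : (0 : ℝ) < k := by exact_mod_cast hk1
      have h4 : (k : ℝ) ^ (α / 2) * (k : ℝ) ^ (-α) = (k : ℝ) ^ (-(α / 2)) := by
        rw [← Real.rpow_add hk0]; congr 1; ring
      calc w k * (k : ℝ) ^ (α / 2) * ∫ ω, ‖δ k ω‖ ^ 2 ∂μ
          ≤ w k * (k : ℝ) ^ (α / 2) * (K * (k : ℝ) ^ (-α)) := by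
            have := hw0 k
            gcongr; exact hK k hk1
        _ = K * (w k * ((k : ℝ) ^ (α / 2) * (k : ℝ) ^ (-α))) := by ring
        _ = _ := by rw [h4]
    have h6 : ((j : ℝ) + 1) ^ (α / 2) * ((j : ℝ) + 1) ^ (α / 2) ≤ 2 * (j : ℝ) ^ α := by
      rw [← Real.rpow_add (by positivity), add_halves]
      exact natCast_rpow_mul_le hj hα0.le hα1.le
    calc ∫ ω, ‖∑ k ∈ Finset.Ico (s + 1) (j + 1), w k • δ k ω‖ ^ 2 ∂μ
        ≤ ∫ ω, (3 * ((j : ℝ) + 1) ^ (α / 2) / η) *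
          ∑ k ∈ Finset.Ico (s + 1) (j + 1), w k * (k : ℝ) ^ (α / 2) * ‖δ k ω‖ ^ 2 ∂μ :=
          integral_mono hL2.norm.integrable_sq (hint.const_mul _) hpt
      _ = (3 * ((j : ℝ) + 1) ^ (α / 2) / η) * ∑ k ∈ Finset.Ico (s + 1) (j + 1),
            w k * (k : ℝ) ^ (α / 2) * ∫ ω, ‖δ k ω‖ ^ 2 ∂μ := by
          rw [integral_const_mul, integral_finsetSum _ fun k _ => (hi k).const_mul _]
          simp_rw [integral_const_mul]
      _ ≤ (3 * ((j : ℝ) + 1) ^ (α / 2) / η) * (K * (3 * ((j : ℝ) + 1) ^ (α / 2) / η)) := by gcongr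
      _ = 9 * K / η ^ 2 * (((j : ℝ) + 1) ^ (α / 2) * ((j : ℝ) + 1) ^ (α / 2)) := by ring
      _ ≤ 9 * K / η ^ 2 * (2 * (j : ℝ) ^ α) := by gcongr
      _ = _ := by ring
  have hsplit : ∀ ω, ∑ k ∈ Finset.Ico s j, (stepSize η α (k + 1))⁻¹ • (δ k ω - δ (k + 1) ω)
      = c s • δ s ω - c j • δ j ω + ∑ k ∈ Finset.Ico (s + 1) (j + 1), w k • δ k ω := by
    intro ω
    rw [sum_smul_sub_eq c (fun k => δ k ω) hsj,
      ← Finset.sum_Ico_add' (fun k => w k • δ k ω) s j 1]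
    congr 1
    refine Finset.sum_congr rfl fun k _ => ?_
    rw [hc, hc]
    simp only [w]
    push_cast
    congr 1
    ring
  simp_rw [hsplit]
  refine (integral_norm_add_sub_sq_le ((hδ s).const_smul (c s)) ((hδ j).const_smul (c j))
    (memLp_finsetSum _ fun k _ => (hδ k).const_smul (w k))).trans ?_
  have h1 := hend s hs hsj
  have h2 := hend j hj le_rfl
  calc _ ≤ 3 * (4 * K / η ^ 2 * (j : ℝ) ^ α + 4 * K / η ^ 2 * (j : ℝ) ^ α
        + 18 * K / η ^ 2 * (j : ℝ) ^ α) :=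
        mul_le_mul_of_nonneg_left (add_le_add (add_le_add h1 h2) hmid) (by norm_num)
    _ = _ := by ring

end PartialSums

/-! ### Comparison of error sums with martingale sums. -/

section Linearization

variable {Ω : Type*} {d : ℕ} {m0 : MeasurableSpace Ω} {μ : Measure Ω}
  {ℱ : Filtration ℕ m0} {e δ : ℕ → Ω → Vec d} {h : Vec d → Vec d} {η α : ℝ}
  {A Ainv : Vec d →L[ℝ] Vec d}

namespace IsSGDError

/-- Solves the recursion for the noise and inverts A; only a left inverse is required. -/
theorem sum_error_eq (hη : 0 < η) (H : IsSGDError ℱ e μ δ h (stepSize η α))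
    (hA : ∀ v, Ainv (A v) = v) (s j : ℕ) (ω : Ω) :
    ∑ k ∈ Finset.Ico s j, δ k ω = Ainv (windowSum e s j ω)
      + Ainv (∑ k ∈ Finset.Ico s j, (stepSize η α (k + 1))⁻¹ • (δ k ω - δ (k + 1) ω)
        - ∑ k ∈ Finset.Ico s j, (h (δ k ω) - A (δ k ω))) := by
  rw [windowSum, ← map_add, ← Finset.sum_sub_distrib, ← Finset.sum_add_distrib, map_sum]
  refine Finset.sum_congr rfl fun k _ => ?_
  have hs : stepSize η α (k + 1) ≠ 0 := by
    unfold stepSize; positivity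
  have h1 : (stepSize η α (k + 1))⁻¹ • (δ k ω - δ (k + 1) ω) = h (δ k ω) - e k ω := by
    rw [H.recursion k ω, inv_smul_eq_iff₀ hs, smul_sub]
    abel
  rw [h1]
  conv_lhs => rw [← hA (δ k ω)]
  congr 1
  abel

/-- Cauchy-Schwarz over the window costs its length; each squared term is at most C²‖δ_k‖⁴, which is
why fourth moments of the error are needed. -/
theorem integral_norm_sum_remainder_sq_le (hδ : ∀ k, MemLp (δ k) 4 μ) {K C : ℝ} {g : Vec d → Vec d}
    (hgc : Continuous g) (hg : ∀ v, ‖g v‖ ≤ C * ‖v‖ ^ 2)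
    (hK : ∀ k, 1 ≤ k → ∫ ω, ‖δ k ω‖ ^ 4 ∂μ ≤ K * (k : ℝ) ^ (-(2 * α))) {s j : ℕ} (hs : 1 ≤ s) :
    MemLp (fun ω => ∑ k ∈ Finset.Ico s j, g (δ k ω)) 2 μ ∧
    ∫ ω, ‖∑ k ∈ Finset.Ico s j, g (δ k ω)‖ ^ 2 ∂μ
      ≤ C ^ 2 * K * ((j - s : ℕ) * ∑ k ∈ Finset.Ico s j, (k : ℝ) ^ (-(2 * α))) := by
  have hL2 : ∀ k, MemLp (fun ω => g (δ k ω)) 2 μ := fun k =>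
    (memLp_two_norm_sq (hδ k)).of_le_mul (c := C) (hgc.comp_aestronglyMeasurable (hδ k).1)
      (Eventually.of_forall fun ω => by
        rw [norm_pow, norm_norm]; exact hg _)
  have hsum : MemLp (fun ω => ∑ k ∈ Finset.Ico s j, g (δ k ω)) 2 μ :=
    memLp_finsetSum _ fun k _ => hL2 k
  refine ⟨hsum, ?_⟩
  have hi : ∀ k, Integrable (fun ω => C ^ 2 * ‖δ k ω‖ ^ 4) μ := fun k =>
    (hδ k).integrable_norm_pow_four.const_mul _
  have hpt : ∀ ω, ‖∑ k ∈ Finset.Ico s j, g (δ k ω)‖ ^ 2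
      ≤ (j - s : ℕ) * ∑ k ∈ Finset.Ico s j, C ^ 2 * ‖δ k ω‖ ^ 4 := by
    intro ω
    have h1 : ‖∑ k ∈ Finset.Ico s j, g (δ k ω)‖ ^ 2
        ≤ (∑ k ∈ Finset.Ico s j, ‖g (δ k ω)‖) ^ 2 := by
      gcongr; exact norm_sum_le _ _
    have h2 := sq_sum_le_card_mul_sum_sq (s := Finset.Ico s j) (f := fun k => ‖g (δ k ω)‖)
    rw [Nat.card_Ico] at h2
    refine (h1.trans h2).trans ?_
    gcongr with k _
    calc ‖g (δ k ω)‖ ^ 2 ≤ (C * ‖δ k ω‖ ^ 2) ^ 2 := by gcongr; exact hg _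
      _ = C ^ 2 * ‖δ k ω‖ ^ 4 := by ring
  calc ∫ ω, ‖∑ k ∈ Finset.Ico s j, g (δ k ω)‖ ^ 2 ∂μ
      ≤ ∫ ω, (j - s : ℕ) * ∑ k ∈ Finset.Ico s j, C ^ 2 * ‖δ k ω‖ ^ 4 ∂μ :=
        integral_mono hsum.norm.integrable_sq
          ((integrable_finsetSum _ fun k _ => hi k).const_mul _) hpt
    _ = (j - s : ℕ) * ∑ k ∈ Finset.Ico s j, C ^ 2 * ∫ ω, ‖δ k ω‖ ^ 4 ∂μ := by
        rw [integral_const_mul, integral_finsetSum _ fun k _ => hi k]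
        simp_rw [integral_const_mul]
    _ ≤ (j - s : ℕ) * ∑ k ∈ Finset.Ico s j, C ^ 2 * (K * (k : ℝ) ^ (-(2 * α))) := by
        gcongr with k hk
        exact hK k (hs.trans (Finset.mem_Ico.1 hk).1)
    _ = _ := by
        simp_rw [Finset.mul_sum]
        exact Finset.sum_congr rfl fun k _ => by ring

theorem memLp_map_sum_increments (hδ : ∀ k, MemLp (δ k) 2 μ) (s j : ℕ) :
    MemLp (fun ω => ∑ k ∈ Finset.Ico s j, (stepSize η α (k + 1))⁻¹ • (δ k ω - δ (k + 1) ω)) 2 μ :=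
  memLp_finsetSum _ fun k _ => ((hδ k).sub (hδ (k + 1))).const_smul (stepSize η α (k + 1))⁻¹

variable [IsProbabilityMeasure μ]

theorem integral_norm_sq_le (hδ : ∀ k, MemLp (δ k) 4 μ) {K : ℝ}
    (hK : ∀ k, 1 ≤ k → ∫ ω, ‖δ k ω‖ ^ 4 ∂μ ≤ K * (k : ℝ) ^ (-(2 * α))) {k : ℕ} (hk : 1 ≤ k) :
    ∫ ω, ‖δ k ω‖ ^ 2 ∂μ ≤ (1 + K) * (k : ℝ) ^ (-α) := by
  have hk0 : (0 : ℝ) < k := by exact_mod_cast hk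
  refine integral_norm_sq_le_of_pow_four (hδ k) (Real.rpow_pos_of_pos hk0 _)
    ((hK k hk).trans_eq ?_)
  rw [← Real.rpow_natCast, ← Real.rpow_mul hk0.le]
  congr 2; push_cast; ring

theorem integral_norm_le (hδ : ∀ k, MemLp (δ k) 4 μ) {K : ℝ}
    (hK : ∀ k, 1 ≤ k → ∫ ω, ‖δ k ω‖ ^ 4 ∂μ ≤ K * (k : ℝ) ^ (-(2 * α))) {k : ℕ} (hk : 1 ≤ k) :
    ∫ ω, ‖δ k ω‖ ∂μ ≤ (2 + K) * (k : ℝ) ^ (-(α / 2)) := by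
  have hk0 : (0 : ℝ) < k := by exact_mod_cast hk
  have h1 := integral_norm_le_of_norm_sq (hδ k) (K := 1 + K) (w := (k : ℝ) ^ (-(α / 2)))
    (Real.rpow_pos_of_pos hk0 _) ((integral_norm_sq_le hδ hK hk).trans_eq ?_)
  · linarith
  rw [← Real.rpow_natCast, ← Real.rpow_mul hk0.le]
  congr 2; push_cast; ring

/-- Sums of the errors over a window agree with the transformed sums of the noise up to a
remainder that is small in mean square. -/
theorem exists_integral_sum_error_sub_le (hη : 0 < η) (hα0 : 0 < α) (hα1 : α < 1)
    (H : IsSGDError ℱ e μ δ h (stepSize η α)) (hδ : ∀ k, MemLp (δ k) 4 μ)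
    (hA : ∀ v, Ainv (A v) = v) {C K : ℝ} (hR : ∀ v, ‖h v - A v‖ ≤ C * ‖v‖ ^ 2)
    (hK : ∀ k, 1 ≤ k → ∫ ω, ‖δ k ω‖ ^ 4 ∂μ ≤ K * (k : ℝ) ^ (-(2 * α))) :
    ∃ D : ℝ, 0 ≤ D ∧ ∀ s j, 1 ≤ s → s ≤ j →
      ∫ ω, ‖∑ k ∈ Finset.Ico s j, δ k ω - Ainv (windowSum e s j ω)‖ ^ 2 ∂μ
        ≤ D * ((j : ℝ) ^ α + (j - s : ℕ) * ∑ k ∈ Finset.Ico s j, (k : ℝ) ^ (-(2 * α))) := by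
  have hδ2 : ∀ k, MemLp (δ k) 2 μ := fun k => memLp_two_of_four (hδ k)
  have hK0 : 0 ≤ K := by
    have h1 := (integral_nonneg fun ω => pow_nonneg (norm_nonneg (δ 1 ω)) 4).trans (hK 1 le_rfl)
    simpa using h1
  refine ⟨‖Ainv‖ ^ 2 * (3 * (78 * (1 + K) / η ^ 2 + C ^ 2 * K)), by positivity,
    fun s j hs hsj => ?_⟩
  have hinc := integral_norm_sum_increments_sq_le hη hα0 hα1 hδ2
    (fun k hk => integral_norm_sq_le hδ hK hk) hs hsj
  obtain ⟨hL2, hrem⟩ := integral_norm_sum_remainder_sq_le (j := j) (g := fun v => h v - A v) hδ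
    (H.continuous.sub A.continuous) hR hK hs
  have hincL2 := memLp_map_sum_increments (η := η) (α := α) hδ2 s j
  set X : Ω → Vec d := fun ω =>
    ∑ k ∈ Finset.Ico s j, (stepSize η α (k + 1))⁻¹ • (δ k ω - δ (k + 1) ω)
  set Y : Ω → Vec d := fun ω => ∑ k ∈ Finset.Ico s j, (h (δ k ω) - A (δ k ω))
  have hXY : ∫ ω, ‖X ω - Y ω‖ ^ 2 ∂μ ≤ 3 * (∫ ω, ‖X ω‖ ^ 2 ∂μ + ∫ ω, ‖Y ω‖ ^ 2 ∂μ) := by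
    have := integral_norm_add_sub_sq_le hincL2 hL2 (MemLp.zero' (ε := Vec d))
    simpa only [add_zero, norm_zero, ne_eq, OfNat.ofNat_ne_zero, not_false_eq_true, zero_pow,
      integral_zero] using this
  have hpt : ∀ ω, ‖∑ k ∈ Finset.Ico s j, δ k ω - Ainv (windowSum e s j ω)‖ ^ 2
      ≤ ‖Ainv‖ ^ 2 * ‖X ω - Y ω‖ ^ 2 := by
    intro ω
    rw [H.sum_error_eq hη hA s j ω, add_sub_cancel_left, ← mul_pow]
    gcongr
    exact Ainv.le_opNorm _
  have hS0 : 0 ≤ (j - s : ℕ) * ∑ k ∈ Finset.Ico s j, (k : ℝ) ^ (-(2 * α)) := by positivity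
  calc ∫ ω, ‖∑ k ∈ Finset.Ico s j, δ k ω - Ainv (windowSum e s j ω)‖ ^ 2 ∂μ
      ≤ ∫ ω, ‖Ainv‖ ^ 2 * ‖X ω - Y ω‖ ^ 2 ∂μ :=
        integral_mono_of_nonneg (Eventually.of_forall fun ω => sq_nonneg _)
          ((hincL2.sub hL2).norm.integrable_sq.const_mul _) (Eventually.of_forall hpt)
    _ = ‖Ainv‖ ^ 2 * ∫ ω, ‖X ω - Y ω‖ ^ 2 ∂μ := integral_const_mul _ _
    _ ≤ ‖Ainv‖ ^ 2 * (3 * (78 * (1 + K) / η ^ 2 * (j : ℝ) ^ α + C ^ 2 * K *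
          ((j - s : ℕ) * ∑ k ∈ Finset.Ico s j, (k : ℝ) ^ (-(2 * α))))) := by
        gcongr
        exact hXY.trans (by gcongr)
    _ ≤ _ := by
        rw [mul_assoc (‖Ainv‖ ^ 2), mul_assoc 3]
        gcongr
        have h1 : 0 ≤ 78 * (1 + K) / η ^ 2 := by positivity
        have h2 : 0 ≤ C ^ 2 * K := by positivity
        have h3 : 0 ≤ (j : ℝ) ^ α := by positivity
        nlinarith [mul_nonneg h1 hS0, mul_nonneg h2 h3]

theorem integral_windowSum_sq_le (he : IsMartingaleDiff ℱ e μ) {c : ℝ}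
    (hc : ∀ k, ∫ ω, ‖e k ω‖ ^ 4 ∂μ ≤ c) {s j : ℕ} (hsj : s < j) :
    ∫ ω, ‖windowSum e s j ω‖ ^ 2 ∂μ ≤ (1 + 16 * c) * (j - s : ℕ) := by
  obtain ⟨l, rfl⟩ := Nat.exists_eq_add_of_lt hsj
  have h1 := he.integral_windowSum_pow_four_le hc s (l + 1)
  have e1 : s + l + 1 - s = l + 1 := by omega
  rw [e1]
  exact integral_norm_sq_le_of_pow_four (he.memLp_windowSum s (s + l + 1))
    (by exact_mod_cast Nat.succ_pos l) h1

/-- Used for the centring by the overall average. The martingale sum, the increments (j^α ≤ j) and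
the remainder (2α > 1) all contribute at most order j. -/
theorem exists_integral_sum_error_le (hη : 0 < η) (hα0 : 1 / 2 < α) (hα1 : α < 1)
    (H : IsSGDError ℱ e μ δ h (stepSize η α)) (hδ : ∀ k, MemLp (δ k) 4 μ)
    (hA : ∀ v, Ainv (A v) = v) {C K c : ℝ} (hR : ∀ v, ‖h v - A v‖ ≤ C * ‖v‖ ^ 2)
    (hK : ∀ k, 1 ≤ k → ∫ ω, ‖δ k ω‖ ^ 4 ∂μ ≤ K * (k : ℝ) ^ (-(2 * α)))
    (hc : ∀ k, ∫ ω, ‖e k ω‖ ^ 4 ∂μ ≤ c) :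
    ∃ D : ℝ, 0 ≤ D ∧ ∀ j : ℕ, 2 ≤ j →
      ∫ ω, ‖∑ k ∈ Finset.Ico 1 j, δ k ω‖ ^ 2 ∂μ ≤ D * j := by
  obtain ⟨D, hD0, hD⟩ := H.exists_integral_sum_error_sub_le hη (by linarith) hα1 hδ hA hR hK
  have hsummable : Summable fun k : ℕ => (k : ℝ) ^ (-(2 * α)) :=
    Real.summable_nat_rpow.2 (by linarith)
  set Z := ∑' k : ℕ, (k : ℝ) ^ (-(2 * α)) with hZ
  have hZ0 : 0 ≤ Z := tsum_nonneg fun k => by positivity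
  have hc0 : 0 ≤ c := (integral_nonneg fun ω => by positivity).trans (hc 0)
  refine ⟨3 * (D * (1 + Z) + ‖Ainv‖ ^ 2 * (1 + 16 * c)), by positivity, fun j hj => ?_⟩
  have hj1 : (1 : ℝ) ≤ j := by exact_mod_cast (by omega : 1 ≤ j)
  have hsum : ∑ k ∈ Finset.Ico 1 j, (k : ℝ) ^ (-(2 * α)) ≤ Z :=
    hsummable.sum_le_tsum _ fun k _ => by positivity
  have h1 := hD 1 j le_rfl (by omega)
  have h2 := integral_windowSum_sq_le H.noise hc (by omega : 1 < j)
  have hj' : ((j - 1 : ℕ) : ℝ) ≤ j := by exact_mod_cast Nat.sub_le j 1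
  have hT : MemLp (fun ω => Ainv (windowSum e 1 j ω)) 2 μ :=
    (Ainv.comp_memLp' (memLp_two_of_four (H.noise.memLp_windowSum 1 j)))
  have hS : MemLp (fun ω => ∑ k ∈ Finset.Ico 1 j, δ k ω) 2 μ :=
    memLp_finsetSum _ fun k _ => memLp_two_of_four (hδ k)
  have h3 := integral_norm_add_sub_sq_le (hS.sub hT) (MemLp.zero' (ε := Vec d)) hT
  simp only [Pi.sub_apply, sub_zero, sub_add_cancel, norm_zero] at h3
  have h4 : ∫ ω, ‖Ainv (windowSum e 1 j ω)‖ ^ 2 ∂μ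
      ≤ ‖Ainv‖ ^ 2 * ∫ ω, ‖windowSum e 1 j ω‖ ^ 2 ∂μ := by
    rw [← integral_const_mul]
    refine integral_mono hT.norm.integrable_sq
      ((memLp_two_of_four (H.noise.memLp_windowSum 1 j)).norm.integrable_sq.const_mul _)
      fun ω => ?_
    simp only
    rw [← mul_pow]; gcongr; exact Ainv.le_opNorm _
  refine h3.trans ?_
  have h5 : (j : ℝ) ^ α ≤ j := by
    calc (j : ℝ) ^ α ≤ (j : ℝ) ^ (1 : ℝ) := Real.rpow_le_rpow_of_exponent_le hj1 hα1.le
      _ = j := Real.rpow_one _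
  have h6 : D * ((j : ℝ) ^ α + (j - 1 : ℕ) * ∑ k ∈ Finset.Ico 1 j, (k : ℝ) ^ (-(2 * α)))
      ≤ D * (j + j * Z) := by gcongr
  have h7 : ‖Ainv‖ ^ 2 * ∫ ω, ‖windowSum e 1 j ω‖ ^ 2 ∂μ ≤ ‖Ainv‖ ^ 2 * ((1 + 16 * c) * j) := by
    gcongr
    exact h2.trans (by gcongr)
  have h8 : ∫ _ω : Ω, (0 : ℝ) ^ 2 ∂μ = 0 := by simp
  rw [h8]
  linarith

end IsSGDError

/-- Each index lies in at most `ℓ` of the windows `[t i, i]`. -/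
theorem sum_sum_window_le {t : ℕ → ℕ} {n : ℕ} {ℓ : ℝ} (hl : ∀ i ∈ Finset.Icc 1 n, 1 ≤ t i)
    (ht : ∀ i ∈ Finset.Icc 1 n, ((i + 1 - t i : ℕ) : ℝ) ≤ ℓ) {g : ℕ → ℝ} (hg : ∀ k, 0 ≤ g k) :
    ∑ i ∈ Finset.Icc 1 n, ∑ k ∈ Finset.Ico (t i) (i + 1), g k ≤ ℓ * ∑ k ∈ Finset.Icc 1 n, g k := by
  have h1 : ∀ i ∈ Finset.Icc 1 n, ∑ k ∈ Finset.Ico (t i) (i + 1), g k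
      = ∑ k ∈ Finset.Icc 1 n, if k ∈ Finset.Ico (t i) (i + 1) then g k else 0 := by
    intro i hi
    rw [← Finset.sum_filter]
    refine Finset.sum_congr (Finset.ext fun k => ?_) fun _ _ => rfl
    have := hl i hi
    have := (Finset.mem_Icc.1 hi).2
    simp only [Finset.mem_filter, Finset.mem_Ico, Finset.mem_Icc]
    omega
  rw [Finset.sum_congr rfl h1, Finset.sum_comm, Finset.mul_sum]
  refine Finset.sum_le_sum fun k _ => ?_
  rw [← Finset.sum_filter, Finset.sum_const, nsmul_eq_mul]
  refine mul_le_mul_of_nonneg_right ?_ (hg k)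
  set S := (Finset.Icc 1 n).filter fun i => k ∈ Finset.Ico (t i) (i + 1) with hS
  rcases S.eq_empty_or_nonempty with h | h
  · rw [h, Finset.card_empty, Nat.cast_zero]
    rename_i hk
    have hn := Finset.mem_Icc.1 hk
    exact (Nat.cast_nonneg _).trans (ht k hk)
  · have hmax := S.max'_mem h
    have hmem := Finset.mem_filter.1 hmax
    have hk := Finset.mem_Ico.1 hmem.2
    refine le_trans ?_ (ht _ hmem.1)
    -- The indices whose window contains k lie between k and the largest of them, hence inside the
    -- window of that largest index; no monotonicity of t is needed.
    have hsub : S ⊆ Finset.Ico k (S.max' h + 1) := by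
      intro i hi
      have h2 := Finset.mem_Ico.1 (Finset.mem_filter.1 hi).2
      have h3 := S.le_max' i hi
      exact Finset.mem_Ico.2 ⟨by omega, by omega⟩
    have h4 := Finset.card_le_card hsub
    rw [Nat.card_Ico] at h4
    exact_mod_cast h4.trans (by omega)

end Linearization

/-! ### Operator norm estimates for matrices. -/

section OperatorNorm

variable {d : ℕ}

theorem opNorm_nonneg (B : Matrix (Fin d) (Fin d) ℝ) : 0 ≤ opNorm B := norm_nonneg _

theorem opNorm_add_le (B D : Matrix (Fin d) (Fin d) ℝ) : opNorm (B + D) ≤ opNorm B + opNorm D := by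
  unfold opNorm; rw [map_add]; exact norm_add_le _ _

theorem opNorm_mul_le (B D : Matrix (Fin d) (Fin d) ℝ) : opNorm (B * D) ≤ opNorm B * opNorm D := by
  unfold opNorm; rw [map_mul]; exact norm_mul_le _ _

theorem opNorm_smul (c : ℝ) (B : Matrix (Fin d) (Fin d) ℝ) : opNorm (c • B) = |c| * opNorm B := by
  unfold opNorm; rw [map_smul, norm_smul, Real.norm_eq_abs]

theorem opNorm_sum_le {ι : Type*} (s : Finset ι) (B : ι → Matrix (Fin d) (Fin d) ℝ) :
    opNorm (∑ i ∈ s, B i) ≤ ∑ i ∈ s, opNorm (B i) := by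
  unfold opNorm; rw [map_sum]; exact norm_sum_le _ _

theorem opNorm_vecMulVec_le (u v : Vec d) :
    opNorm (Matrix.vecMulVec u.ofLp v.ofLp) ≤ ‖u‖ * ‖v‖ := by
  refine ContinuousLinearMap.opNorm_le_bound _ (by positivity) fun x => ?_
  have h1 : Matrix.toEuclideanCLM (n := Fin d) (𝕜 := ℝ) (Matrix.vecMulVec u.ofLp v.ofLp) x
      = (inner ℝ v x) • u := by
    ext p
    rw [Matrix.ofLp_toEuclideanCLM]
    simp only [Matrix.mulVec, dotProduct, Matrix.vecMulVec_apply, PiLp.smul_apply, smul_eq_mul,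
      PiLp.inner_apply, RCLike.inner_apply, conj_trivial, Finset.sum_mul]
    exact Finset.sum_congr rfl fun q _ => by ring
  rw [h1, norm_smul]
  calc ‖inner ℝ v x‖ * ‖u‖ ≤ (‖v‖ * ‖x‖) * ‖u‖ := by gcongr; exact norm_inner_le_norm _ _
    _ = _ := by ring

theorem opNorm_single_le (p q : Fin d) : opNorm (Matrix.single p q (1 : ℝ)) ≤ 1 := by
  have h := opNorm_vecMulVec_le (EuclideanSpace.single p (1 : ℝ)) (EuclideanSpace.single q (1 : ℝ))
  simpa [← Matrix.single_eq_single_vecMulVec_single] using h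

theorem eq_sum_smul_single (B : Matrix (Fin d) (Fin d) ℝ) :
    B = ∑ p, ∑ q, B p q • Matrix.single p q (1 : ℝ) := by
  conv_lhs => rw [Matrix.matrix_eq_sum_single B]
  simp [Matrix.smul_single]

theorem opNorm_le_sum_abs (B : Matrix (Fin d) (Fin d) ℝ) : opNorm B ≤ ∑ p, ∑ q, |B p q| := by
  conv_lhs => rw [eq_sum_smul_single B]
  refine (opNorm_sum_le _ _).trans (Finset.sum_le_sum fun p _ => (opNorm_sum_le _ _).trans
    (Finset.sum_le_sum fun q _ => ?_))
  rw [opNorm_smul]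
  exact mul_le_of_le_one_right (abs_nonneg _) (opNorm_single_le p q)

theorem abs_apply_le_opNorm (B : Matrix (Fin d) (Fin d) ℝ) (p q : Fin d) :
    |B p q| ≤ opNorm B := by
  have h1 : B p q
      = Matrix.toEuclideanCLM (n := Fin d) (𝕜 := ℝ) B (EuclideanSpace.single q 1) p := by
    rw [Matrix.ofLp_toEuclideanCLM]
    simp
  rw [h1]
  refine (abs_coord_le _ p).trans ?_
  have h2 := (Matrix.toEuclideanCLM (n := Fin d) (𝕜 := ℝ) B).le_opNorm
    (EuclideanSpace.single q (1 : ℝ))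
  simpa [opNorm] using h2

theorem integrable_opNorm {Ω : Type*} {m0 : MeasurableSpace Ω} {μ : Measure Ω}
    {B : Ω → Matrix (Fin d) (Fin d) ℝ} (hB : ∀ p q, Integrable (fun ω => B ω p q) μ) :
    Integrable (fun ω => opNorm (B ω)) μ := by
  have h1 : ∀ ω, Matrix.toEuclideanCLM (n := Fin d) (𝕜 := ℝ) (B ω)
      = ∑ p, ∑ q, B ω p q • Matrix.toEuclideanCLM (n := Fin d) (𝕜 := ℝ)
          (Matrix.single p q (1 : ℝ)) := by
    intro ω
    conv_lhs => rw [eq_sum_smul_single (B ω)]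
    simp only [map_sum, map_smul]
  unfold opNorm
  simp only [h1]
  exact (integrable_finsetSum _ fun p _ => integrable_finsetSum _ fun q _ =>
    (hB p q).smul_const _).norm

theorem opNorm_vecMulVec_sub_le (w u : Vec d) :
    opNorm (Matrix.vecMulVec w.ofLp w.ofLp - Matrix.vecMulVec u.ofLp u.ofLp)
      ≤ 2 * (‖u‖ * ‖w - u‖) + ‖w - u‖ ^ 2 := by
  have h1 : Matrix.vecMulVec w.ofLp w.ofLp - Matrix.vecMulVec u.ofLp u.ofLp
      = Matrix.vecMulVec u.ofLp (w - u).ofLp + Matrix.vecMulVec (w - u).ofLp u.ofLp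
        + Matrix.vecMulVec (w - u).ofLp (w - u).ofLp := by
    ext p q
    simp only [Matrix.sub_apply, Matrix.add_apply, Matrix.vecMulVec_apply, PiLp.sub_apply]
    ring
  rw [h1]
  refine (opNorm_add_le _ _).trans ?_
  have h2 := opNorm_add_le (Matrix.vecMulVec u.ofLp (w - u).ofLp)
    (Matrix.vecMulVec (w - u).ofLp u.ofLp)
  have h3 := opNorm_vecMulVec_le u (w - u)
  have h4 := opNorm_vecMulVec_le (w - u) u
  have h5 := opNorm_vecMulVec_le (w - u) (w - u)
  nlinarith

theorem vecMulVec_toEuclideanCLM (B : Matrix (Fin d) (Fin d) ℝ) (v : Vec d) :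
    Matrix.vecMulVec (Matrix.toEuclideanCLM (n := Fin d) (𝕜 := ℝ) B v).ofLp
        (Matrix.toEuclideanCLM (n := Fin d) (𝕜 := ℝ) B v).ofLp
      = B * Matrix.vecMulVec v.ofLp v.ofLp * B.transpose := by
  rw [Matrix.ofLp_toEuclideanCLM, Matrix.mul_vecMulVec, Matrix.vecMulVec_mul,
    Matrix.vecMul_transpose]

end OperatorNorm

/-! ### Averages over the overlapping windows. -/

section BatchMeans

variable {Ω : Type*} {d : ℕ} {m0 : MeasurableSpace Ω} {μ : Measure Ω} [IsProbabilityMeasure μ]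
  {ℱ : Filtration ℕ m0} {e δ : ℕ → Ω → Vec d} {t : ℕ → ℕ} {n : ℕ} {ℓ : ℝ}

theorem integral_abs_sum_compProd_le (he : IsMartingaleDiff ℱ e μ) {c : ℝ}
    (hc : ∀ k, ∫ ω, ‖e k ω‖ ^ 4 ∂μ ≤ c) (htj : ∀ j ∈ Finset.Icc 1 n, t j ≤ j)
    (ht : ∀ j ∈ Finset.Icc 1 n, ((j + 1 - t j : ℕ) : ℝ) ≤ ℓ) (p q : Fin d) {K w : ℝ} (hw : 0 < w)
    (hKw : n * ℓ ^ 3 ≤ K * w ^ 2) :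
    ∫ ω, |∑ i ∈ Finset.Icc 1 n, compProd ℱ e μ p q (t i) (i + 1) ω| ∂μ
      ≤ (1 + 68 * c * K) * w := by
  have hc0 : 0 ≤ c := (integral_nonneg fun ω => by positivity).trans (hc 0)
  have hV : ∀ i, MemLp (compProd ℱ e μ p q (t i) (i + 1)) 2 μ := fun i => he.memLp_compProd p q _ _
  refine integral_abs_le_of_integral_sq_le (memLp_finsetSum _ fun i _ => hV i) hw ?_
  refine (integral_sum_sq_le_of_local_correlation (B := 34 * c * ℓ ^ 2) hV ht ?_ htj ?_).trans ?_
  -- The window ending at i involves e up to index i, known at time i + 1; i < t_j is exactly i + 1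
  -- ≤ t_j.
  · intro i j hij hj
    obtain ⟨l, hl⟩ := Nat.exists_eq_add_of_le (hj.trans (Nat.le_succ j))
    rw [Nat.succ_eq_add_one] at hl
    rw [hl]
    exact he.integral_mul_compProd_eq_zero
      ((he.stronglyMeasurable_compProd p q (t i) (i + 1)).mono (ℱ.mono hij)) (hV i) p q l
  · intro i hi
    obtain ⟨l, hl⟩ := Nat.exists_eq_add_of_le ((htj i hi).trans (Nat.le_succ i))
    rw [Nat.succ_eq_add_one] at hl
    have h1 := he.integral_compProd_sq_le hc p q (t i) l
    have h2 := ht i hi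
    rw [hl, Nat.add_sub_cancel_left] at h2
    rw [hl]
    exact h1.trans (by gcongr)
  · calc 2 * n * ℓ * (34 * c * ℓ ^ 2) = 68 * c * (n * ℓ ^ 3) := by ring
      _ ≤ 68 * c * (K * w ^ 2) := by gcongr
      _ = _ := by ring

/-- Splits each product into its compensated part, which fluctuates with mean zero, and the drift of
the conditional covariances from s. In the drift each index is counted at most ℓ times, and Σ
k^{-α/2} ≤ 2 n^{1-α/2}. -/
theorem integral_abs_sum_windowSum_mul_sub_le (he : IsMartingaleDiff ℱ e μ) {c : ℝ}
    (hc : ∀ k, ∫ ω, ‖e k ω‖ ^ 4 ∂μ ≤ c) (htj : ∀ j ∈ Finset.Icc 1 n, 1 ≤ t j ∧ t j ≤ j)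
    (ht : ∀ j ∈ Finset.Icc 1 n, ((j + 1 - t j : ℕ) : ℝ) ≤ ℓ) (p q : Fin d) {K w : ℝ} (hw : 0 < w)
    (hKw : n * ℓ ^ 3 ≤ K * w ^ 2) {s b α : ℝ} (hα0 : 0 < α) (hα1 : α < 1) (hb : 0 ≤ b)
    (hs : ∀ k, 1 ≤ k → ∫ ω, |condCov ℱ e μ p q k ω - s| ∂μ ≤ b * (k : ℝ) ^ (-(α / 2))) :
    ∫ ω, |∑ i ∈ Finset.Icc 1 n, windowSum e (t i) (i + 1) ω p * windowSum e (t i) (i + 1) ω q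
        - (∑ i ∈ Finset.Icc 1 n, ((i + 1 - t i : ℕ) : ℝ)) * s| ∂μ
      ≤ (1 + 68 * c * K) * w + 2 * b * (ℓ * (n : ℝ) ^ (1 - α / 2)) := by
  have hcov : ∀ k, Integrable (fun ω => |condCov ℱ e μ p q k ω - s|) μ := fun k =>
    (((he.memLp_condCov p q k).integrable one_le_two).sub (integrable_const s)).abs
  have hV : Integrable (fun ω => |∑ i ∈ Finset.Icc 1 n, compProd ℱ e μ p q (t i) (i + 1) ω|) μ :=
    (integrable_finsetSum _ fun i _ => (he.memLp_compProd p q _ _).integrable one_le_two).abs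
  have hpt : ∀ ω, |∑ i ∈ Finset.Icc 1 n,
        windowSum e (t i) (i + 1) ω p * windowSum e (t i) (i + 1) ω q
        - (∑ i ∈ Finset.Icc 1 n, ((i + 1 - t i : ℕ) : ℝ)) * s|
      ≤ |∑ i ∈ Finset.Icc 1 n, compProd ℱ e μ p q (t i) (i + 1) ω|
        + ℓ * ∑ k ∈ Finset.Icc 1 n, |condCov ℱ e μ p q k ω - s| := by
    intro ω
    have h1 : ∑ i ∈ Finset.Icc 1 n, windowSum e (t i) (i + 1) ω p * windowSum e (t i) (i + 1) ω q
        - (∑ i ∈ Finset.Icc 1 n, ((i + 1 - t i : ℕ) : ℝ)) * s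
        = ∑ i ∈ Finset.Icc 1 n, compProd ℱ e μ p q (t i) (i + 1) ω
          + ∑ i ∈ Finset.Icc 1 n, ∑ k ∈ Finset.Ico (t i) (i + 1),
              (condCov ℱ e μ p q k ω - s) := by
      rw [Finset.sum_mul, ← Finset.sum_sub_distrib, ← Finset.sum_add_distrib]
      refine Finset.sum_congr rfl fun i _ => ?_
      rw [Finset.sum_sub_distrib, Finset.sum_const, Nat.card_Ico, nsmul_eq_mul]
      simp only [compProd, windowSum]
      ring
    rw [h1]
    refine (abs_add_le _ _).trans (by
      gcongr
      refine (Finset.abs_sum_le_sum_abs _ _).trans ?_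
      refine (Finset.sum_le_sum fun i _ => Finset.abs_sum_le_sum_abs _ _).trans ?_
      exact sum_sum_window_le (fun i hi => (htj i hi).1) ht fun k => abs_nonneg _)
  have hI := integrable_finsetSum (μ := μ) (Finset.Icc 1 n) fun k _ => hcov k
  have hint : Integrable (fun ω => |∑ i ∈ Finset.Icc 1 n,
        windowSum e (t i) (i + 1) ω p * windowSum e (t i) (i + 1) ω q
        - (∑ i ∈ Finset.Icc 1 n, ((i + 1 - t i : ℕ) : ℝ)) * s|) μ :=
    ((integrable_finsetSum _ fun i _ => (memLp_two_coord_mul_coord (he.memLp_windowSum _ _)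
      (he.memLp_windowSum _ _) p q).integrable one_le_two).sub (integrable_const _)).abs
  have h2 := integral_mono hint (hV.add (hI.const_mul ℓ)) hpt
  refine h2.trans ?_
  have e1 := integral_add hV (hI.const_mul ℓ)
  rw [integral_const_mul, integral_finsetSum _ fun k _ => hcov k] at e1
  refine e1.trans_le (add_le_add (integral_abs_sum_compProd_le he hc (fun j hj => (htj j hj).2) ht
    p q hw hKw) ?_)
  rcases Nat.eq_zero_or_pos n with rfl | hn
  · simp [Real.zero_rpow (by linarith : 1 - α / 2 ≠ 0)]
  have hℓ0 : 0 ≤ ℓ := (Nat.cast_nonneg _).trans (ht 1 (Finset.mem_Icc.2 ⟨le_rfl, hn⟩))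
  have h3 := sum_rpow_neg_le (by linarith : 0 ≤ α / 2) (by linarith : α / 2 < 1) n
  have h4 : (n : ℝ) ^ (1 - α / 2) / (1 - α / 2) ≤ 2 * (n : ℝ) ^ (1 - α / 2) := by
    rw [div_le_iff₀ (by linarith)]
    nlinarith [Real.rpow_nonneg (Nat.cast_nonneg (α := ℝ) n) (1 - α / 2)]
  calc ℓ * ∑ k ∈ Finset.Icc 1 n, ∫ ω, |condCov ℱ e μ p q k ω - s| ∂μ
      ≤ ℓ * ∑ k ∈ Finset.Icc 1 n, b * (k : ℝ) ^ (-(α / 2)) := by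
        gcongr with k hk
        exact hs k (Finset.mem_Icc.1 hk).1
    _ = ℓ * (b * ∑ k ∈ Finset.Icc 1 n, (k : ℝ) ^ (-(α / 2))) := by simp only [Finset.mul_sum]
    _ ≤ ℓ * (b * (2 * (n : ℝ) ^ (1 - α / 2))) := by gcongr; exact h3.trans h4
    _ = _ := by ring

/-- The window sum centred at the overall average. -/
noncomputable def centredWindow (δ : ℕ → Ω → Vec d) (t : ℕ → ℕ) (n i : ℕ) (ω : Ω) : Vec d :=
  ∑ k ∈ Finset.Ico (t i) (i + 1), δ k ω
    - ((i + 1 - t i : ℕ) : ℝ) • ((n : ℝ)⁻¹ • ∑ k ∈ Finset.Ico 1 (n + 1), δ k ω)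

variable {Ainv : Vec d →L[ℝ] Vec d}

/-- Three sources: the increments give n^α per window; the linearization remainder gives ℓ Σ k^{-2α}
over each window, hence ℓ² Z in total; the centring at the average gives ℓ²/n per window. -/
theorem sum_integral_centredWindow_sub_sq_le (he : IsMartingaleDiff ℱ e μ)
    (hδ : ∀ k, MemLp (δ k) 4 μ) {α D D' Z : ℝ} (hα0 : 0 < α) (hα1 : α < 1) (hD : 0 ≤ D)
    (hD' : 0 ≤ D') (hZ : ∀ n : ℕ, ∑ k ∈ Finset.Icc 1 n, (k : ℝ) ^ (-(2 * α)) ≤ Z)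
    (hlin : ∀ s j, 1 ≤ s → s ≤ j →
      ∫ ω, ‖∑ k ∈ Finset.Ico s j, δ k ω - Ainv (windowSum e s j ω)‖ ^ 2 ∂μ
        ≤ D * ((j : ℝ) ^ α + (j - s : ℕ) * ∑ k ∈ Finset.Ico s j, (k : ℝ) ^ (-(2 * α))))
    (hav : ∀ j : ℕ, 2 ≤ j → ∫ ω, ‖∑ k ∈ Finset.Ico 1 j, δ k ω‖ ^ 2 ∂μ ≤ D' * j)
    (hn : 1 ≤ n) (htj : ∀ j ∈ Finset.Icc 1 n, 1 ≤ t j ∧ t j ≤ j)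
    (ht : ∀ j ∈ Finset.Icc 1 n, ((j + 1 - t j : ℕ) : ℝ) ≤ ℓ) :
    ∑ i ∈ Finset.Icc 1 n,
        ∫ ω, ‖centredWindow δ t n i ω - Ainv (windowSum e (t i) (i + 1) ω)‖ ^ 2 ∂μ
      ≤ (6 * D + 3 * D * Z + 6 * D') * (n * (n : ℝ) ^ α + ℓ ^ 2) := by
  have hn0 : (0 : ℝ) < n := by exact_mod_cast hn
  have hn1 : (1 : ℝ) ≤ n := by exact_mod_cast hn
  have hℓ0 : 0 ≤ ℓ := (Nat.cast_nonneg _).trans (ht 1 (Finset.mem_Icc.2 ⟨le_rfl, hn⟩))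
  have hZ0 : 0 ≤ Z := by simpa using hZ 0
  have hδ2 : ∀ k, MemLp (δ k) 2 μ := fun k => memLp_two_of_four (hδ k)
  have hS : ∀ s j, MemLp (fun ω => ∑ k ∈ Finset.Ico s j, δ k ω) 2 μ := fun s j =>
    memLp_finsetSum _ fun k _ => hδ2 k
  have hU : ∀ s j, MemLp (fun ω => Ainv (windowSum e s j ω)) 2 μ := fun s j =>
    Ainv.comp_memLp' (memLp_two_of_four (he.memLp_windowSum s j))
  have hterm : ∀ i ∈ Finset.Icc 1 n,
      ∫ ω, ‖centredWindow δ t n i ω - Ainv (windowSum e (t i) (i + 1) ω)‖ ^ 2 ∂μ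
      ≤ 6 * D * (n : ℝ) ^ α + 3 * D * ℓ * ∑ k ∈ Finset.Ico (t i) (i + 1), (k : ℝ) ^ (-(2 * α))
        + 6 * D' * ℓ ^ 2 / n := by
    intro i hi
    obtain ⟨hi1, hin⟩ := Finset.mem_Icc.1 hi
    have hin' : (i : ℝ) ≤ n := by exact_mod_cast hin
    set r : ℝ := ((i + 1 - t i : ℕ) : ℝ) * (n : ℝ)⁻¹ with hr
    have hrl : r ≤ ℓ * (n : ℝ)⁻¹ := by rw [hr]; gcongr; exact ht i hi
    have hr0 : 0 ≤ r := by positivity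
    have h1 := integral_norm_add_sub_sq_le ((hS (t i) (i + 1)).sub (hU (t i) (i + 1)))
      ((hS 1 (n + 1)).const_smul r) (MemLp.zero' (ε := Vec d))
    have h2 : ∀ ω, centredWindow δ t n i ω - Ainv (windowSum e (t i) (i + 1) ω)
        = (∑ k ∈ Finset.Ico (t i) (i + 1), δ k ω - Ainv (windowSum e (t i) (i + 1) ω))
          - r • ∑ k ∈ Finset.Ico 1 (n + 1), δ k ω := by
      intro ω
      rw [centredWindow, smul_smul, ← hr]
      abel
    have h3 : ∫ ω, ‖r • ∑ k ∈ Finset.Ico 1 (n + 1), δ k ω‖ ^ 2 ∂μ ≤ 2 * D' * ℓ ^ 2 / n := by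
      simp_rw [norm_smul, mul_pow, Real.norm_of_nonneg hr0]
      rw [integral_const_mul]
      have h4 := hav (n + 1) (by omega)
      push_cast at h4
      calc r ^ 2 * ∫ ω, ‖∑ k ∈ Finset.Ico 1 (n + 1), δ k ω‖ ^ 2 ∂μ
          ≤ (ℓ * (n : ℝ)⁻¹) ^ 2 * (D' * (n + n)) := by
            gcongr
            exact h4.trans (by gcongr)
        _ = _ := by field_simp; ring
    have h5 : ∫ ω, ‖∑ k ∈ Finset.Ico (t i) (i + 1), δ k ω
          - Ainv (windowSum e (t i) (i + 1) ω)‖ ^ 2 ∂μ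
        ≤ D * (2 * (n : ℝ) ^ α + ℓ * ∑ k ∈ Finset.Ico (t i) (i + 1), (k : ℝ) ^ (-(2 * α))) := by
      refine (hlin (t i) (i + 1) (htj i hi).1 ((htj i hi).2.trans (Nat.le_succ i))).trans ?_
      gcongr
      · push_cast
        exact (natCast_rpow_mul_le hi1 hα0.le hα1.le).trans (by gcongr)
      · exact ht i hi
    simp only [h2]
    simp only [add_zero, norm_zero, ne_eq, OfNat.ofNat_ne_zero, not_false_eq_true, zero_pow,
      integral_zero] at h1
    refine h1.trans ?_
    have h6 := add_le_add h5 h3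
    have h7 := mul_le_mul_of_nonneg_left h6 (by norm_num : (0 : ℝ) ≤ 3)
    refine h7.trans (le_of_eq ?_)
    ring
  refine (Finset.sum_le_sum hterm).trans ?_
  have hw := sum_sum_window_le (fun i hi => (htj i hi).1) ht
    (g := fun k : ℕ => (k : ℝ) ^ (-(2 * α))) (fun k => by positivity)
  rw [Finset.sum_add_distrib, Finset.sum_add_distrib]
  simp only [Finset.sum_const, Nat.card_Icc, Nat.add_sub_cancel, nsmul_eq_mul]
  have h8 : ∑ i ∈ Finset.Icc 1 n, 3 * D * ℓ * ∑ k ∈ Finset.Ico (t i) (i + 1), (k : ℝ) ^ (-(2 * α))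
      ≤ 3 * D * ℓ * (ℓ * Z) := by
    rw [← Finset.mul_sum]
    gcongr
    exact hw.trans (by gcongr; exact hZ n)
  have h9 : (n : ℝ) * (6 * D' * ℓ ^ 2 / n) = 6 * D' * ℓ ^ 2 := by field_simp
  rw [h9]
  have h10 : 0 ≤ (n : ℝ) * (n : ℝ) ^ α := by positivity
  have h11 : 0 ≤ D * Z := by positivity
  nlinarith [mul_nonneg hD (sq_nonneg ℓ), mul_nonneg hD' h10, mul_nonneg h11 h10]

theorem sum_integral_map_windowSum_sq_le (he : IsMartingaleDiff ℱ e μ) {c : ℝ}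
    (hc : ∀ k, ∫ ω, ‖e k ω‖ ^ 4 ∂μ ≤ c) (htj : ∀ j ∈ Finset.Icc 1 n, 1 ≤ t j ∧ t j ≤ j)
    (ht : ∀ j ∈ Finset.Icc 1 n, ((j + 1 - t j : ℕ) : ℝ) ≤ ℓ) :
    ∑ i ∈ Finset.Icc 1 n, ∫ ω, ‖Ainv (windowSum e (t i) (i + 1) ω)‖ ^ 2 ∂μ
      ≤ ‖Ainv‖ ^ 2 * (1 + 16 * c) * (n * ℓ) := by
  have hc0 : 0 ≤ c := (integral_nonneg fun ω => by positivity).trans (hc 0)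
  have hterm : ∀ i ∈ Finset.Icc 1 n, ∫ ω, ‖Ainv (windowSum e (t i) (i + 1) ω)‖ ^ 2 ∂μ
      ≤ ‖Ainv‖ ^ 2 * ((1 + 16 * c) * ℓ) := by
    intro i hi
    have hT := memLp_two_of_four (he.memLp_windowSum (t i) (i + 1))
    have h1 := IsSGDError.integral_windowSum_sq_le he hc
      (Nat.lt_succ_of_le (htj i hi).2 : t i < i + 1)
    calc ∫ ω, ‖Ainv (windowSum e (t i) (i + 1) ω)‖ ^ 2 ∂μ
        ≤ ∫ ω, ‖Ainv‖ ^ 2 * ‖windowSum e (t i) (i + 1) ω‖ ^ 2 ∂μ := by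
          refine integral_mono (Ainv.comp_memLp' hT).norm.integrable_sq
            (hT.norm.integrable_sq.const_mul _) fun ω => ?_
          simp only
          rw [← mul_pow]; gcongr; exact Ainv.le_opNorm _
      _ = ‖Ainv‖ ^ 2 * ∫ ω, ‖windowSum e (t i) (i + 1) ω‖ ^ 2 ∂μ := integral_const_mul _ _
      _ ≤ _ := by gcongr; exact h1.trans (by gcongr; exact ht i hi)
  refine (Finset.sum_le_sum hterm).trans (le_of_eq ?_)
  simp only [Finset.sum_const, Nat.card_Icc, Nat.add_sub_cancel, nsmul_eq_mul]
  ring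

end BatchMeans

/-! ### From window sums to the error of a covariance estimator. -/

section EstimatorError

variable {Ω : Type*} {d : ℕ} {m0 : MeasurableSpace Ω} {μ : Measure Ω}

theorem integrable_vecMulVec_apply {X : Ω → Vec d} (hX : MemLp X 2 μ) (p q : Fin d) :
    Integrable (fun ω => Matrix.vecMulVec (X ω).ofLp (X ω).ofLp p q) μ := by
  simp only [Matrix.vecMulVec_apply]
  have h : ∀ p, MemLp (fun ω => X ω p) 2 μ := fun p =>
    (EuclideanSpace.proj (𝕜 := ℝ) p).comp_memLp' hX
  exact (h p).integrable_mul (h q)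

/-- Compare w_i wᵢᵀ with (B v_i)(B v_i)ᵀ, and pull B out of the sum of the latter, using its
symmetry. The cross term of the comparison is split by Young's inequality with a free parameter ρ,
to be tuned to the rate. -/
theorem opNorm_average_sub_sandwich_le {ι : Type*} (I : Finset ι) {Λ ρ : ℝ} (hΛ : 0 < Λ)
    (hρ : 0 < ρ) (B S : Matrix (Fin d) (Fin d) ℝ) (hB : B.transpose = B) (w v : ι → Vec d) :
    opNorm (Λ⁻¹ • ∑ i ∈ I, Matrix.vecMulVec (w i).ofLp (w i).ofLp - B * S * B)
      ≤ Λ⁻¹ * (ρ * ∑ i ∈ I, ‖Matrix.toEuclideanCLM (n := Fin d) (𝕜 := ℝ) B (v i)‖ ^ 2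
        + (1 / ρ + 1) * ∑ i ∈ I, ‖w i - Matrix.toEuclideanCLM (n := Fin d) (𝕜 := ℝ) B (v i)‖ ^ 2
        + opNorm B ^ 2 * ∑ p, ∑ q, |∑ i ∈ I, v i p * v i q - Λ * S p q|) := by
  set u : ι → Vec d := fun i => Matrix.toEuclideanCLM (n := Fin d) (𝕜 := ℝ) B (v i) with hu
  set G : Matrix (Fin d) (Fin d) ℝ :=
    ∑ i ∈ I, Matrix.vecMulVec (v i).ofLp (v i).ofLp - Λ • S with hG
  have hdecomp : Λ⁻¹ • ∑ i ∈ I, Matrix.vecMulVec (w i).ofLp (w i).ofLp - B * S * B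
      = Λ⁻¹ • (∑ i ∈ I, (Matrix.vecMulVec (w i).ofLp (w i).ofLp
          - Matrix.vecMulVec (u i).ofLp (u i).ofLp) + B * G * B) := by
    have h1 : ∑ i ∈ I, Matrix.vecMulVec (u i).ofLp (u i).ofLp
        = B * (∑ i ∈ I, Matrix.vecMulVec (v i).ofLp (v i).ofLp) * B := by
      rw [Finset.mul_sum, Finset.sum_mul]
      refine Finset.sum_congr rfl fun i _ => ?_
      rw [hu, vecMulVec_toEuclideanCLM, hB]
    have h2 : B * G * B = B * (∑ i ∈ I, Matrix.vecMulVec (v i).ofLp (v i).ofLp) * B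
        - Λ • (B * S * B) := by
      rw [hG, Matrix.mul_sub, Matrix.sub_mul, Matrix.mul_smul, Matrix.smul_mul]
    rw [Finset.sum_sub_distrib, h1, h2, smul_add, smul_sub, smul_sub, smul_smul,
      inv_mul_cancel₀ hΛ.ne', one_smul]
    abel
  rw [hdecomp, opNorm_smul, abs_of_pos (inv_pos.2 hΛ)]
  refine mul_le_mul_of_nonneg_left ((opNorm_add_le _ _).trans (add_le_add ?_ ?_)) (by positivity)
  · refine (opNorm_sum_le _ _).trans ?_
    rw [Finset.mul_sum, Finset.mul_sum, ← Finset.sum_add_distrib]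
    refine Finset.sum_le_sum fun i _ => (opNorm_vecMulVec_sub_le _ _).trans ?_
    have h3 : 2 * (‖u i‖ * ‖w i - u i‖) ≤ ρ * ‖u i‖ ^ 2 + 1 / ρ * ‖w i - u i‖ ^ 2 := by
      have h4 : 0 ≤ 1 / ρ * (ρ * ‖u i‖ - ‖w i - u i‖) ^ 2 := by positivity
      have h5 : 1 / ρ * (ρ * ‖u i‖ - ‖w i - u i‖) ^ 2
          = ρ * ‖u i‖ ^ 2 - 2 * (‖u i‖ * ‖w i - u i‖) + 1 / ρ * ‖w i - u i‖ ^ 2 := by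
        field_simp; ring
      linarith
    rw [add_mul (1 / ρ)]
    linarith
  · have h6 : opNorm G ≤ ∑ p, ∑ q, |∑ i ∈ I, v i p * v i q - Λ * S p q| := by
      refine (opNorm_le_sum_abs G).trans (le_of_eq ?_)
      refine Finset.sum_congr rfl fun p _ => Finset.sum_congr rfl fun q _ => ?_
      rw [hG]
      simp [Matrix.sub_apply, Matrix.sum_apply, Matrix.vecMulVec_apply]
    calc opNorm (B * G * B) ≤ opNorm (B * G) * opNorm B := opNorm_mul_le _ _
      _ ≤ (opNorm B * opNorm G) * opNorm B :=
          mul_le_mul_of_nonneg_right (opNorm_mul_le _ _) (opNorm_nonneg _)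
      _ = opNorm B ^ 2 * opNorm G := by ring
      _ ≤ _ := by gcongr

theorem integral_opNorm_average_sub_sandwich_le [IsFiniteMeasure μ] {ι : Type*} (I : Finset ι)
    {Λ ρ : ℝ} (hΛ : 0 < Λ) (hρ : 0 < ρ) (B S : Matrix (Fin d) (Fin d) ℝ) (hB : B.transpose = B)
    {w v : ι → Ω → Vec d} (hw : ∀ i, MemLp (w i) 2 μ) (hv : ∀ i, MemLp (v i) 2 μ) {Q R G : ℝ}
    (hQ : ∑ i ∈ I, ∫ ω, ‖Matrix.toEuclideanCLM (n := Fin d) (𝕜 := ℝ) B (v i ω)‖ ^ 2 ∂μ ≤ Q)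
    (hR : ∑ i ∈ I,
      ∫ ω, ‖w i ω - Matrix.toEuclideanCLM (n := Fin d) (𝕜 := ℝ) B (v i ω)‖ ^ 2 ∂μ ≤ R)
    (hG : ∀ p q, ∫ ω, |∑ i ∈ I, v i ω p * v i ω q - Λ * S p q| ∂μ ≤ G) :
    Integrable (fun ω => opNorm
      (Λ⁻¹ • ∑ i ∈ I, Matrix.vecMulVec (w i ω).ofLp (w i ω).ofLp - B * S * B)) μ ∧
    ∫ ω, opNorm (Λ⁻¹ • ∑ i ∈ I, Matrix.vecMulVec (w i ω).ofLp (w i ω).ofLp - B * S * B) ∂μ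
      ≤ Λ⁻¹ * (ρ * Q + (1 / ρ + 1) * R + opNorm B ^ 2 * ((d : ℝ) ^ 2 * G)) := by
  have hint : Integrable (fun ω => opNorm
      (Λ⁻¹ • ∑ i ∈ I, Matrix.vecMulVec (w i ω).ofLp (w i ω).ofLp - B * S * B)) μ := by
    refine integrable_opNorm fun p q => ?_
    simp only [Matrix.sub_apply, Matrix.smul_apply, Matrix.sum_apply]
    exact ((integrable_finsetSum _ fun i _ =>
      integrable_vecMulVec_apply (hw i) p q).smul Λ⁻¹).sub (integrable_const _)
  refine ⟨hint, ?_⟩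
  set N : Vec d →L[ℝ] Vec d := Matrix.toEuclideanCLM (n := Fin d) (𝕜 := ℝ) B with hN
  have hu : ∀ i, MemLp (fun ω => N (v i ω)) 2 μ := fun i => N.comp_memLp' (hv i)
  have hiu : ∀ i, Integrable (fun ω => ‖N (v i ω)‖ ^ 2) μ := fun i => (hu i).norm.integrable_sq
  have hir : ∀ i, Integrable (fun ω => ‖w i ω - N (v i ω)‖ ^ 2) μ :=
    fun i => ((hw i).sub (hu i)).norm.integrable_sq
  have hig : ∀ p q, Integrable (fun ω => |∑ i ∈ I, v i ω p * v i ω q - Λ * S p q|) μ :=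
    fun p q => ((integrable_finsetSum _ fun i _ =>
      integrable_vecMulVec_apply (hv i) p q).sub (integrable_const _)).abs
  have i1 := (integrable_finsetSum I fun i _ => hiu i).const_mul ρ
  have i2 := (integrable_finsetSum I fun i _ => hir i).const_mul (1 / ρ + 1)
  have i3 := (integrable_finsetSum Finset.univ fun p _ =>
    integrable_finsetSum Finset.univ fun q _ => hig p q).const_mul (opNorm B ^ 2)
  have hle := integral_mono hint (((i1.add i2).add i3).const_mul Λ⁻¹)
    fun ω => opNorm_average_sub_sandwich_le I hΛ hρ B S hB (fun i => w i ω) (fun i => v i ω)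
  refine hle.trans ?_
  rw [integral_const_mul]
  refine mul_le_mul_of_nonneg_left ?_ (by positivity)
  have e1 := integral_add (i1.add i2) i3
  have e2 := integral_add i1 i2
  refine (e1.trans (congrArg₂ _ e2 rfl)).trans_le ?_
  rw [integral_const_mul, integral_const_mul, integral_const_mul,
    integral_finsetSum _ fun i _ => hiu i, integral_finsetSum _ fun i _ => hir i,
    integral_finsetSum _ fun p _ => integrable_finsetSum _ fun q _ => hig p q]
  have hGsum : ∑ p, ∫ ω, ∑ q, |∑ i ∈ I, v i ω p * v i ω q - Λ * S p q| ∂μ ≤ (d : ℝ) ^ 2 * G := by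
    calc ∑ p, ∫ ω, ∑ q, |∑ i ∈ I, v i ω p * v i ω q - Λ * S p q| ∂μ
        = ∑ p, ∑ q, ∫ ω, |∑ i ∈ I, v i ω p * v i ω q - Λ * S p q| ∂μ :=
          Finset.sum_congr rfl fun p _ => integral_finsetSum _ fun q _ => hig p q
      _ ≤ ∑ _p : Fin d, ∑ _q : Fin d, G :=
          Finset.sum_le_sum fun p _ => Finset.sum_le_sum fun q _ => hG p q
      _ = (d : ℝ) ^ 2 * G := by simp; ring
  gcongr

end EstimatorError

/-! ### Exponents in terms of the number of batches. -/

section Rates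

theorem exists_rate_bounds {α β c₁ c₂ : ℝ} (hα0 : 0 < α) (hα1 : α < 1) (hβ : 1 / (1 - α) < β)
    (hc₁ : 0 < c₁) (hc₂ : 0 < c₂) :
    ∃ κ : ℝ, 0 < κ ∧ ∀ (M : ℕ), 1 ≤ M → ∀ n : ℝ, c₁ * (M : ℝ) ^ β ≤ n → n ≤ c₂ * (M : ℝ) ^ β →
      ∀ ℓ ρ : ℝ, ℓ = c₂ * (M : ℝ) ^ (β - 1) →
        ρ = (M : ℝ) ^ (-(1 / 2) : ℝ) + (M : ℝ) ^ (((α - 1) * β + 1) / 2) →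
        n ^ α ≤ κ * ρ ^ 2 * ℓ ∧ ℓ ≤ κ * ρ ^ 2 * n ∧ ρ ≤ 2 ∧
          n * ℓ ≤ κ * (c₁ * (M : ℝ) ^ (2 * β - 1)) ∧
          n ^ (-(α / 2)) ≤ κ * (M : ℝ) ^ (-(α * β) / 4) := by
  have hβ1 : 1 < (1 - α) * β := by
    rw [div_lt_iff₀ (by linarith)] at hβ; linarith
  have hβ0 : 0 < β := lt_trans (by have : 0 < 1 - α := by linarith
                                   positivity) hβ
  -- One summand for each comparison carrying κ. The remaining bound ρ ≤ 2 uses (α - 1)β + 1 < 0,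
  -- which is the condition β > 1/(1 - α).
  refine ⟨c₂ ^ α / c₂ + c₂ / c₁ + c₂ ^ 2 / c₁ + c₁ ^ (-(α / 2)), by positivity, ?_⟩
  intro M hM n hn1 hn2 ℓ ρ hℓ hρ
  have hM1 : (1 : ℝ) ≤ M := by exact_mod_cast hM
  have hM0 : (0 : ℝ) < M := by linarith
  have hadd : ∀ x y : ℝ, (M : ℝ) ^ x * (M : ℝ) ^ y = (M : ℝ) ^ (x + y) :=
    fun x y => (Real.rpow_add hM0 x y).symm
  have hpos : ∀ x : ℝ, 0 < (M : ℝ) ^ x := fun x => Real.rpow_pos_of_pos hM0 x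
  have hn0 : 0 < n := lt_of_lt_of_le (mul_pos hc₁ (hpos _)) hn1
  have hρ1 : (M : ℝ) ^ (-1 : ℝ) ≤ ρ ^ 2 := by
    have h1 : (M : ℝ) ^ (-1 : ℝ) = ((M : ℝ) ^ (-(1 / 2) : ℝ)) ^ 2 := by
      rw [sq, hadd]; norm_num
    rw [h1, hρ]
    have := hpos (((α - 1) * β + 1) / 2)
    have := hpos (-(1 / 2))
    gcongr; linarith
  have hρ2 : (M : ℝ) ^ ((α - 1) * β + 1) ≤ ρ ^ 2 := by
    have h1 : (M : ℝ) ^ ((α - 1) * β + 1) = ((M : ℝ) ^ (((α - 1) * β + 1) / 2)) ^ 2 := by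
      rw [sq, hadd, add_halves]
    rw [h1, hρ]
    have := hpos (((α - 1) * β + 1) / 2)
    have := hpos (-(1 / 2))
    gcongr; linarith
  have k1 : 0 < c₂ ^ α / c₂ := by positivity
  have k2 : 0 < c₂ / c₁ := by positivity
  have k3 : 0 < c₂ ^ 2 / c₁ := by positivity
  have k4 : 0 < c₁ ^ (-(α / 2)) := by positivity
  set κ := c₂ ^ α / c₂ + c₂ / c₁ + c₂ ^ 2 / c₁ + c₁ ^ (-(α / 2)) with hκ
  have hℓ0 : 0 < ℓ := hℓ ▸ mul_pos hc₂ (hpos _)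
  have hρ0 : 0 < ρ ^ 2 := lt_of_lt_of_le (hpos _) hρ1
  refine ⟨?_, ?_, ?_, ?_, ?_⟩
  · calc n ^ α ≤ (c₂ * (M : ℝ) ^ β) ^ α := by gcongr
      _ = c₂ ^ α * (M : ℝ) ^ (α * β) := by
          rw [Real.mul_rpow hc₂.le (hpos _).le, ← Real.rpow_mul hM0.le, mul_comm β]
      _ = c₂ ^ α / c₂ * (M : ℝ) ^ ((α - 1) * β + 1) * ℓ := by
          rw [hℓ, show α * β = ((α - 1) * β + 1) + (β - 1) by ring, ← hadd]
          field_simp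
      _ ≤ κ * ρ ^ 2 * ℓ := by gcongr; linarith
  · calc ℓ = c₂ / c₁ * (M : ℝ) ^ (-1 : ℝ) * (c₁ * (M : ℝ) ^ β) := by
          rw [hℓ, sub_eq_add_neg, ← hadd]; field_simp
      _ ≤ κ * ρ ^ 2 * n := by gcongr; linarith
  · have h1 : (M : ℝ) ^ (-(1 / 2) : ℝ) ≤ 1 := Real.rpow_le_one_of_one_le_of_nonpos hM1 (by norm_num)
    have h2 : (M : ℝ) ^ (((α - 1) * β + 1) / 2) ≤ 1 :=
      Real.rpow_le_one_of_one_le_of_nonpos hM1 (by linarith)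
    linarith
  · calc n * ℓ ≤ c₂ * (M : ℝ) ^ β * (c₂ * (M : ℝ) ^ (β - 1)) := by rw [← hℓ]; gcongr
      _ = c₂ ^ 2 / c₁ * (c₁ * (M : ℝ) ^ (2 * β - 1)) := by
          rw [show 2 * β - 1 = β + (β - 1) by ring, ← hadd]; field_simp
      _ ≤ _ := by
          have := hpos (2 * β - 1)
          gcongr; linarith
  · calc n ^ (-(α / 2)) ≤ (c₁ * (M : ℝ) ^ β) ^ (-(α / 2)) :=
          Real.rpow_le_rpow_of_nonpos (mul_pos hc₁ (hpos _)) hn1 (by linarith)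
      _ = c₁ ^ (-(α / 2)) * (M : ℝ) ^ (β * -(α / 2)) := by
          rw [Real.mul_rpow hc₁.le (hpos _).le, ← Real.rpow_mul hM0.le]
      _ ≤ κ * (M : ℝ) ^ (-(α * β) / 4) := by
          have h1 : (M : ℝ) ^ (β * -(α / 2)) ≤ (M : ℝ) ^ (-(α * β) / 4) :=
            Real.rpow_le_rpow_of_exponent_le hM1 (by nlinarith [mul_pos hα0 hβ0])
          have := hpos (-(α * β) / 4)
          gcongr; linarith

end Rates

/-! ### Symmetry, invertibility and global linearization at the minimizer. -/

section Hessian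

variable {d : ℕ} {F : Vec d → ℝ} {y : Vec d}

theorem toEuclideanCLM_hessian (F : Vec d → ℝ) (y : Vec d) :
    Matrix.toEuclideanCLM (n := Fin d) (𝕜 := ℝ) (hessian F y) = fderiv ℝ (gradient F) y := by
  refine ContinuousLinearMap.coe_injective ((EuclideanSpace.basisFun (Fin d) ℝ).toBasis.ext fun j => ?_)
  simp only [OrthonormalBasis.coe_toBasis, EuclideanSpace.basisFun_apply,
    ContinuousLinearMap.coe_coe]
  ext i
  rw [Matrix.ofLp_toEuclideanCLM]
  simp [hessian]

/-- The Riesz map, viewed as the real-linear map T, turns the gradient into the Fréchet derivative.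
Symmetry of the second derivative then needs differentiability of that derivative only at y. -/
theorem hessian_transpose (hF : Differentiable ℝ F) (hd : DifferentiableAt ℝ (gradient F) y) :
    (hessian F y).transpose = hessian F y := by
  let T : Vec d →L[ℝ] StrongDual ℝ (Vec d) := LinearMap.toContinuousLinearMap
    { toFun := fun v => InnerProductSpace.toDual ℝ (Vec d) v
      map_add' := fun u v => map_add _ u v
      map_smul' := fun c v => by simp }
  have h1 : HasFDerivAt (fun u => fderiv ℝ F u) (T.comp (fderiv ℝ (gradient F) y)) y := by
    have h2 := T.hasFDerivAt.comp y hd.hasFDerivAt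
    refine h2.congr_of_eventuallyEq (Eventually.of_forall fun u => ?_)
    exact ((InnerProductSpace.toDual ℝ (Vec d)).apply_symm_apply (fderiv ℝ F u)).symm
  ext i j
  have h3 := second_derivative_symmetric_of_eventually (𝕜 := ℝ)
    (Eventually.of_forall fun u => (hF u).hasFDerivAt) h1
    (EuclideanSpace.single i (1 : ℝ)) (EuclideanSpace.single j (1 : ℝ))
  have h4 : ∀ u w : Vec d, T u w = inner ℝ u w := fun u w => rfl
  simpa [hessian, h4, EuclideanSpace.inner_single_right] using h3

theorem norm_fderiv_gradient_ge {m : ℝ} (hd : DifferentiableAt ℝ (gradient F) y)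
    (hmono : ∀ v, m * ‖v‖ ≤ ‖gradient F (y + v) - gradient F y‖) (v : Vec d) :
    m * ‖v‖ ≤ ‖fderiv ℝ (gradient F) y v‖ := by
  have h1 := (hd.hasFDerivAt.hasLineDerivAt v).tendsto_slope_zero.norm
  refine ge_of_tendsto h1 (eventually_nhdsWithin_of_forall fun s hs => ?_)
  have h2 := hmono (s • v)
  have hs' : 0 < |s| := abs_pos.2 hs
  rw [norm_smul, Real.norm_eq_abs] at h2
  rw [norm_smul, norm_inv, Real.norm_eq_abs, le_inv_mul_iff₀ hs']
  linarith

/-- The lower bound for gradient differences survives in the limit of difference quotients, so the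
derivative is injective, hence invertible in finite dimension. -/
theorem isUnit_hessian {m : ℝ} (hm : 0 < m) (hd : DifferentiableAt ℝ (gradient F) y)
    (hmono : ∀ v, m * ‖v‖ ≤ ‖gradient F (y + v) - gradient F y‖) : IsUnit (hessian F y) := by
  rw [← Matrix.mulVec_injective_iff_isUnit]
  intro u v huv
  have h1 : fderiv ℝ (gradient F) y (WithLp.toLp 2 (u - v)) = 0 := by
    rw [← toEuclideanCLM_hessian, Matrix.toEuclideanCLM_toLp, Matrix.mulVec_sub,
      show (hessian F y).mulVec u = (hessian F y).mulVec v from huv, sub_self]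
    rfl
  have h2 := norm_fderiv_gradient_ge hd hmono (WithLp.toLp 2 (u - v))
  rw [h1, norm_zero] at h2
  have h3 : ‖(WithLp.toLp 2 (u - v) : Vec d)‖ = 0 :=
    le_antisymm (by nlinarith [norm_nonneg (WithLp.toLp 2 (u - v) : Vec d)]) (norm_nonneg _)
  have h4 := norm_eq_zero.1 h3
  exact sub_eq_zero.1 (congrArg WithLp.ofLp h4)

/-- Makes the local expansion global: outside the ball of radius r, linear growth is dominated by a
quadratic because ‖v‖ ≤ ‖v‖²/r. -/
theorem exists_norm_sub_fderiv_le {g : Vec d → Vec d} {L : ℝ} (hL : ∀ v, ‖g (y + v)‖ ≤ L * ‖v‖)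
    (A : Vec d →L[ℝ] Vec d)
    (hO : (fun x => g x - A (x - y)) =O[𝓝 y] fun x => ‖x - y‖ ^ 2) :
    ∃ C, ∀ v, ‖g (y + v) - A v‖ ≤ C * ‖v‖ ^ 2 := by
  obtain ⟨C, hC⟩ := hO.bound
  obtain ⟨r, hr, hball⟩ := Metric.eventually_nhds_iff.1 hC
  refine ⟨|C| + (|L| + ‖A‖) / r, fun v => ?_⟩
  have h0 : 0 ≤ (|L| + ‖A‖) / r := by positivity
  rcases lt_or_ge ‖v‖ r with hv | hv
  · have h1 := hball (show dist (y + v) y < r by simpa using hv)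
    rw [add_sub_cancel_left, norm_pow, norm_norm] at h1
    refine h1.trans ?_
    gcongr
    linarith [le_abs_self C]
  · have h1 : ‖g (y + v) - A v‖ ≤ (|L| + ‖A‖) * ‖v‖ := by
      refine (norm_sub_le _ _).trans ?_
      have h2 := hL v
      have h3 := A.le_opNorm v
      have h4 := mul_le_mul_of_nonneg_right (le_abs_self L) (norm_nonneg v)
      linarith
    have h5 : (|L| + ‖A‖) * ‖v‖ ≤ (|L| + ‖A‖) / r * ‖v‖ ^ 2 := by
      rw [div_mul_eq_mul_div, le_div_iff₀ hr]
      have : 0 ≤ (|L| + ‖A‖) * ‖v‖ := by positivity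
      nlinarith
    have h6 : 0 ≤ |C| * ‖v‖ ^ 2 := by positivity
    linarith

end Hessian

/-! ### Translation invariance of the centred sums. -/

section Batches

/-- Subtracting xstar from every iterate shifts the batch sum and the batch length times the average
by the same vector. This allows the estimator to be written in terms of the errors. -/
theorem centredSum_eq_centredWindow {d : ℕ} {Ω : Type*} {x : ℕ → Ω → Vec d} {a : ℕ → ℕ} (xstar : Vec d) {n i : ℕ}
    (hn : 1 ≤ n) (hi : blockStart a i ≤ i) (ω : Ω) :
    centredSum a (fun i => x i ω) n i
      = centredWindow (fun k ω => x k ω - xstar) (blockStart a) n i ω := by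
  have hn0 : (n : ℝ) ≠ 0 := by exact_mod_cast (by omega : n ≠ 0)
  have h1 : batchSize a i = i + 1 - blockStart a i := by unfold batchSize; omega
  have h2 : ∀ s j : ℕ, ∑ k ∈ Finset.Ico s (j + 1), (x k ω - xstar)
      = ∑ k ∈ Finset.Icc s j, x k ω - ((j + 1 - s : ℕ) : ℝ) • xstar := by
    intro s j
    rw [Finset.sum_sub_distrib, Finset.sum_const, Nat.card_Ico, Nat.cast_smul_eq_nsmul]
    rfl
  rw [centredSum, centredWindow, h2, h2, average, h1, Nat.add_sub_cancel, smul_sub,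
    smul_smul (n : ℝ)⁻¹, inv_mul_cancel₀ hn0, one_smul, smul_sub]
  abel

end Batches

/-! ### The SGD iterates as an instance of the abstract recursion. -/

section SGD

variable {d : ℕ} {𝓧 Ω : Type*} [MeasurableSpace 𝓧] [m0 : MeasurableSpace Ω]

theorem memLp_four_of_integrable {μ : Measure Ω} {X : Ω → Vec d} (hX : AEStronglyMeasurable X μ)
    (h : Integrable (fun ω => ‖X ω‖ ^ 4) μ) : MemLp X 4 μ := by
  rw [← integrable_norm_rpow_iff hX (by norm_num) (by norm_num)]
  refine h.congr (Eventually.of_forall fun ω => ?_)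
  simp only
  rw [← Real.rpow_natCast]
  norm_num

/-- The noise index is shifted by one: e k is ε_{k+1}, centred given ξ_1, …, ξ_k and evaluated at
x_k. -/
theorem isSGDError_sgd {f : Vec d → 𝓧 → ℝ} {P : Measure 𝓧} [IsProbabilityMeasure P]
    {μ : Measure Ω} [IsProbabilityMeasure μ] {ξ : ℕ → Ω → 𝓧}
    (hf_meas : ∀ x, Measurable (f x)) (hf_int : ∀ x, Integrable (f x) P)
    (hF_C1 : ContDiff ℝ 1 (risk f P)) (hf_C1 : ∀ z, ContDiff ℝ 1 (fun y => f y z))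
    (hf_UI : ∀ y : Vec d, ∃ U ∈ 𝓝 y, UniformIntegrable (fun u : U => lossGrad f u.1) 1 P)
    (hξ_meas : ∀ i, 1 ≤ i → Measurable (ξ i))
    (hξ_indep : iIndepFun (fun i : ℕ => ξ (i + 1)) μ)
    (hξ_law : ∀ i, 1 ≤ i → μ.map (ξ i) = P) (step : ℕ → ℝ) (x₀ xstar : Vec d)
    (h4 : ∀ n, 1 ≤ n → Integrable (fun ω => ‖noise f P ξ (sgd f step x₀ ξ) n ω‖ ^ 4) μ) :
    IsSGDError (pastFiltration hξ_meas) (fun k => noise f P ξ (sgd f step x₀ ξ) (k + 1)) μ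
      (fun k ω => sgd f step x₀ ξ k ω - xstar) (fun v => gradient (risk f P) (xstar + v)) step := by
  have hGc : Continuous (gradient (risk f P)) :=
    (InnerProductSpace.toDual ℝ (Vec d)).symm.continuous.comp (hF_C1.continuous_fderiv one_ne_zero)
  have hmeas : ∀ k, StronglyMeasurable[pastFiltration hξ_meas (k + 1)]
      (noise f P ξ (sgd f step x₀ ξ) (k + 1)) := fun k =>
    (measurable_noise hf_meas hf_C1 hGc.measurable step x₀ ξ k).stronglyMeasurable
  have hLp : ∀ k, MemLp (noise f P ξ (sgd f step x₀ ξ) (k + 1)) 4 μ := fun k =>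
    memLp_four_of_integrable
      ((hmeas k).mono ((pastFiltration hξ_meas).le _)).aestronglyMeasurable (h4 (k + 1) (by omega))
  refine ⟨⟨hmeas, hLp, fun k => ?_⟩, fun k => ?_, ?_, ?_, fun k ω => ?_⟩
  · exact condExp_noise hf_meas hf_int hF_C1 hGc.measurable hf_C1 hf_UI hξ_meas hξ_indep hξ_law
      step x₀ k ((hLp k).integrable (by norm_num))
  · exact (Measurable.sub (measurable_sgd hf_meas hf_C1 step x₀ ξ le_rfl)
      measurable_const).stronglyMeasurable
  · exact memLp_const (x₀ - xstar)
  · exact hGc.comp (by fun_prop)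
  · simp only [sgd, noise, Nat.add_sub_cancel, add_sub_cancel]
    module

theorem integral_noise_pow_four_le {f : Vec d → 𝓧 → ℝ} {P : Measure 𝓧}
    {μ : Measure Ω} [IsProbabilityMeasure μ] {ξ : ℕ → Ω → 𝓧} {x : ℕ → Ω → Vec d} {xstar : Vec d}
    (hξ_meas : ∀ i, 1 ≤ i → Measurable (ξ i)) {c : ℝ} {k : ℕ}
    (hx : MemLp (fun ω => x k ω - xstar) 4 μ)
    (h : ∀ᵐ ω ∂μ, (μ[fun ω' => ‖noise f P ξ x (k + 1) ω'‖ ^ 4 | past ξ k]) ω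
        ≤ c * (1 + ‖x k ω - xstar‖ ^ 4)) :
    ∫ ω, ‖noise f P ξ x (k + 1) ω‖ ^ 4 ∂μ ≤ |c| * (1 + ∫ ω, ‖x k ω - xstar‖ ^ 4 ∂μ) := by
  have hi := hx.integrable_norm_pow_four
  rw [← integral_condExp ((pastFiltration hξ_meas).le k)]
  calc ∫ ω, (μ[fun ω' => ‖noise f P ξ x (k + 1) ω'‖ ^ 4 | past ξ k]) ω ∂μ
      ≤ ∫ ω, |c| * (1 + ‖x k ω - xstar‖ ^ 4) ∂μ := by
        refine integral_mono_ae integrable_condExp (((integrable_const _).add hi).const_mul _) ?_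
        filter_upwards [h] with ω hω
        refine hω.trans ?_
        gcongr
        exact le_abs_self c
    _ = |c| * (1 + ∫ ω, ‖x k ω - xstar‖ ^ 4 ∂μ) := by
        rw [integral_const_mul, integral_add (integrable_const _) hi]
        simp

theorem integral_abs_condCov_sub_le {ξ : ℕ → Ω → 𝓧} {f : Vec d → 𝓧 → ℝ} {P : Measure 𝓧}
    {μ : Measure Ω} [IsProbabilityMeasure μ] {x : ℕ → Ω → Vec d} {xstar : Vec d}
    (hξ_meas : ∀ i, 1 ≤ i → Measurable (ξ i)) {S : Matrix (Fin d) (Fin d) ℝ} {c α K : ℝ}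
    (hα0 : 0 < α) (hδ : ∀ k, MemLp (fun ω => x k ω - xstar) 4 μ)
    (hK : ∀ k, 1 ≤ k → ∫ ω, ‖x k ω - xstar‖ ^ 4 ∂μ ≤ K * (k : ℝ) ^ (-(2 * α))) {k : ℕ} (hk : 1 ≤ k)
    (h : ∀ᵐ ω ∂μ, opNorm (condSecondMoment μ (past ξ k) (noise f P ξ x (k + 1)) ω - S)
        ≤ c * (‖x k ω - xstar‖ + ‖x k ω - xstar‖ ^ 2)) (p q : Fin d) :
    ∫ ω, |condCov (pastFiltration hξ_meas) (fun k => noise f P ξ x (k + 1)) μ p q k ω - S p q| ∂μ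
      ≤ |c| * (3 + 2 * K) * (k : ℝ) ^ (-(α / 2)) := by
  have hk1 : (1 : ℝ) ≤ k := by exact_mod_cast hk
  have h1 : Integrable (fun ω => ‖x k ω - xstar‖) μ := ((hδ k).integrable (by norm_num)).norm
  have h2 : Integrable (fun ω => ‖x k ω - xstar‖ ^ 2) μ :=
    (memLp_two_of_four (hδ k)).norm.integrable_sq
  have hK0 : 0 ≤ K := by
    have h1 := (integral_nonneg fun ω => pow_nonneg (norm_nonneg (x 1 ω - xstar)) 4).trans
      (hK 1 le_rfl)
    simpa using h1
  have b1 := IsSGDError.integral_norm_le hδ hK hk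
  have b2 := IsSGDError.integral_norm_sq_le hδ hK hk
  have h3 : (k : ℝ) ^ (-α) ≤ (k : ℝ) ^ (-(α / 2)) :=
    Real.rpow_le_rpow_of_exponent_le hk1 (by linarith)
  calc ∫ ω, |condCov (pastFiltration hξ_meas) (fun k => noise f P ξ x (k + 1)) μ p q k ω
          - S p q| ∂μ
      ≤ ∫ ω, |c| * (‖x k ω - xstar‖ + ‖x k ω - xstar‖ ^ 2) ∂μ := by
        refine integral_mono_ae ?_ ((h1.add h2).const_mul _) ?_
        · exact (Integrable.sub integrable_condExp (integrable_const _)).abs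
        · filter_upwards [h] with ω hω
          have h4 := abs_apply_le_opNorm
            (condSecondMoment μ (past ξ k) (noise f P ξ x (k + 1)) ω - S) p q
          refine (h4.trans hω).trans ?_
          gcongr
          exact le_abs_self c
    _ = |c| * (∫ ω, ‖x k ω - xstar‖ ∂μ + ∫ ω, ‖x k ω - xstar‖ ^ 2 ∂μ) := by
        rw [integral_const_mul, integral_add h1 h2]
    _ ≤ |c| * ((2 + K) * (k : ℝ) ^ (-(α / 2)) + (1 + K) * (k : ℝ) ^ (-(α / 2))) := by
        gcongr
        exact b2.trans (by gcongr)
    _ = _ := by ring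

end SGD

/-! ### Assembly of the error bound for fixed n. -/

section Combination

variable {Ω : Type*} {d : ℕ} {m0 : MeasurableSpace Ω} {μ : Measure Ω} [IsProbabilityMeasure μ]
  {ℱ : Filtration ℕ m0} {e δ : ℕ → Ω → Vec d} {t : ℕ → ℕ} {n : ℕ}

theorem integral_opNorm_batchMeans_sub_sandwich_le (he : IsMartingaleDiff ℱ e μ)
    (hδ : ∀ k, MemLp (δ k) 4 μ) {B S : Matrix (Fin d) (Fin d) ℝ} (hB : B.transpose = B)
    {α c D D' Z b : ℝ} (hα0 : 0 < α) (hα1 : α < 1) (hD : 0 ≤ D) (hD' : 0 ≤ D') (hb : 0 ≤ b)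
    (hc : ∀ k, ∫ ω, ‖e k ω‖ ^ 4 ∂μ ≤ c)
    (hZ : ∀ n : ℕ, ∑ k ∈ Finset.Icc 1 n, (k : ℝ) ^ (-(2 * α)) ≤ Z)
    (hlin : ∀ s j, 1 ≤ s → s ≤ j →
      ∫ ω, ‖∑ k ∈ Finset.Ico s j, δ k ω
          - Matrix.toEuclideanCLM (n := Fin d) (𝕜 := ℝ) B (windowSum e s j ω)‖ ^ 2 ∂μ
        ≤ D * ((j : ℝ) ^ α + (j - s : ℕ) * ∑ k ∈ Finset.Ico s j, (k : ℝ) ^ (-(2 * α))))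
    (hav : ∀ j : ℕ, 2 ≤ j → ∫ ω, ‖∑ k ∈ Finset.Ico 1 j, δ k ω‖ ^ 2 ∂μ ≤ D' * j)
    (hs : ∀ p q k, 1 ≤ k →
      ∫ ω, |condCov ℱ e μ p q k ω - S p q| ∂μ ≤ b * (k : ℝ) ^ (-(α / 2)))
    (hn : 1 ≤ n) (htj : ∀ j ∈ Finset.Icc 1 n, 1 ≤ t j ∧ t j ≤ j) {ℓ κ ρ : ℝ} (hℓ : 0 < ℓ)
    (ht : ∀ j ∈ Finset.Icc 1 n, ((j + 1 - t j : ℕ) : ℝ) ≤ ℓ) (hκ : 0 < κ) (hρ : 0 < ρ)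
    (hρ2 : ρ ≤ 2) (h1 : (n : ℝ) ^ α ≤ κ * ρ ^ 2 * ℓ) (h2 : ℓ ≤ κ * ρ ^ 2 * n) {Λ : ℝ}
    (hΛ : Λ = ∑ i ∈ Finset.Icc 1 n, ((i + 1 - t i : ℕ) : ℝ)) (hnℓ : n * ℓ ≤ κ * Λ) :
    Integrable (fun ω => opNorm (Λ⁻¹ • ∑ i ∈ Finset.Icc 1 n,
      Matrix.vecMulVec (centredWindow δ t n i ω).ofLp (centredWindow δ t n i ω).ofLp
        - B * S * B)) μ ∧
    ∫ ω, opNorm (Λ⁻¹ • ∑ i ∈ Finset.Icc 1 n,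
      Matrix.vecMulVec (centredWindow δ t n i ω).ofLp (centredWindow δ t n i ω).ofLp
        - B * S * B) ∂μ
      ≤ κ * (‖Matrix.toEuclideanCLM (n := Fin d) (𝕜 := ℝ) B‖ ^ 2 * (1 + 16 * c)
          + 6 * κ * (6 * D + 3 * D * Z + 6 * D')
          + opNorm B ^ 2 * ((d : ℝ) ^ 2 * (1 + 68 * c * κ + 2 * b)))
        * (ρ + (n : ℝ) ^ (-(α / 2))) := by
  have hn0 : (0 : ℝ) < n := by exact_mod_cast hn
  have hc0 : 0 ≤ c := (integral_nonneg fun ω => by positivity).trans (hc 0)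
  have hZ0 : 0 ≤ Z := by simpa using hZ 0
  have hpos : 0 < n * ℓ := mul_pos hn0 hℓ
  have hΛ0 : 0 < Λ := by
    by_contra! h
    nlinarith
  have hδ2 : ∀ k, MemLp (δ k) 2 μ := fun k => memLp_two_of_four (hδ k)
  have hS : ∀ s j, MemLp (fun ω => ∑ k ∈ Finset.Ico s j, δ k ω) 2 μ := fun s j =>
    memLp_finsetSum _ fun k _ => hδ2 k
  have hw : ∀ i, MemLp (centredWindow δ t n i) 2 μ := fun i =>
    (hS _ _).sub (((hS 1 (n + 1)).const_smul (n : ℝ)⁻¹).const_smul ((i + 1 - t i : ℕ) : ℝ))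
  have hv : ∀ i, MemLp (windowSum e (t i) (i + 1)) 2 μ := fun i =>
    memLp_two_of_four (he.memLp_windowSum _ _)
  -- The scale w = ρ n ℓ for the fluctuation: its second moment n ℓ³ is at most κ w², since ℓ ≤ κ ρ²
  -- n.
  have hcub : n * ℓ ^ 3 ≤ κ * (ρ * (n * ℓ)) ^ 2 := by
    calc n * ℓ ^ 3 = n * ℓ ^ 2 * ℓ := by ring
      _ ≤ n * ℓ ^ 2 * (κ * ρ ^ 2 * n) := by gcongr
      _ = _ := by ring
  have hG : ∀ p q, ∫ ω, |∑ i ∈ Finset.Icc 1 n,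
      windowSum e (t i) (i + 1) ω p * windowSum e (t i) (i + 1) ω q - Λ * S p q| ∂μ
      ≤ (1 + 68 * c * κ) * (ρ * (n * ℓ)) + 2 * b * (ℓ * (n : ℝ) ^ (1 - α / 2)) := by
    intro p q
    rw [hΛ]
    exact integral_abs_sum_windowSum_mul_sub_le he hc htj ht p q (mul_pos hρ hpos) hcub hα0 hα1 hb
      (hs p q)
  obtain ⟨hint, hle⟩ := integral_opNorm_average_sub_sandwich_le (Finset.Icc 1 n) hΛ0 hρ B S hB hw
    hv (sum_integral_map_windowSum_sq_le he hc htj ht)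
    (sum_integral_centredWindow_sub_sq_le he hδ hα0 hα1 hD hD' hZ hlin hav hn htj ht) hG
  refine ⟨hint, hle.trans ?_⟩
  set r : ℝ := (n : ℝ) ^ (-(α / 2)) with hr
  have hr0 : 0 < r := Real.rpow_pos_of_pos hn0 _
  have hnr : (n : ℝ) ^ (1 - α / 2) = n * r := by
    rw [hr, sub_eq_add_neg, Real.rpow_add hn0, Real.rpow_one]
  set N : ℝ := ‖Matrix.toEuclideanCLM (n := Fin d) (𝕜 := ℝ) B‖ ^ 2 * (1 + 16 * c) with hN
  have hN0 : 0 ≤ N := by positivity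
  set E : ℝ := 6 * D + 3 * D * Z + 6 * D' with hE
  have hE0 : 0 ≤ E := by positivity
  have b1 : ρ * (N * (n * ℓ)) ≤ N * (ρ + r) * (n * ℓ) := by
    rw [show ρ * (N * (n * ℓ)) = N * ρ * (n * ℓ) by ring]
    gcongr; linarith
  -- Both n · n^α and ℓ² are at most κ ρ² n ℓ, so the factor 1/ρ still leaves a multiple of ρ; ρ ≤ 2
  -- gives ρ + ρ² ≤ 3ρ.
  have b2 : (1 / ρ + 1) * (E * (n * (n : ℝ) ^ α + ℓ ^ 2)) ≤ 6 * κ * E * (ρ + r) * (n * ℓ) := by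
    calc (1 / ρ + 1) * (E * (n * (n : ℝ) ^ α + ℓ ^ 2))
        ≤ (1 / ρ + 1) * (E * (n * (κ * ρ ^ 2 * ℓ) + ℓ * (κ * ρ ^ 2 * n))) := by
          rw [sq ℓ]; gcongr
      _ = 2 * κ * E * (ρ + ρ ^ 2) * (n * ℓ) := by field_simp; ring
      _ ≤ 2 * κ * E * (3 * (ρ + r)) * (n * ℓ) := by gcongr; nlinarith
      _ = _ := by ring
  have b3 : (1 + 68 * c * κ) * (ρ * (n * ℓ)) + 2 * b * (ℓ * (n : ℝ) ^ (1 - α / 2))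
      ≤ (1 + 68 * c * κ + 2 * b) * (ρ + r) * (n * ℓ) := by
    rw [hnr]
    have : 0 ≤ ((1 + 68 * c * κ) * r + 2 * b * ρ) * (n * ℓ) := by positivity
    linarith
  calc _ ≤ Λ⁻¹ * (N * (ρ + r) * (n * ℓ) + 6 * κ * E * (ρ + r) * (n * ℓ)
        + opNorm B ^ 2 * ((d : ℝ) ^ 2 * ((1 + 68 * c * κ + 2 * b) * (ρ + r) * (n * ℓ)))) := by
        gcongr
    _ = (Λ⁻¹ * (n * ℓ)) * (N + 6 * κ * E
        + opNorm B ^ 2 * ((d : ℝ) ^ 2 * (1 + 68 * c * κ + 2 * b))) * (ρ + r) := by ring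
    _ ≤ _ := by
        gcongr
        rw [inv_mul_le_iff₀ hΛ0]
        linarith

end Combination

/-! ### Consequences of strong convexity. -/

section Minimizer

variable {d : ℕ} {F : Vec d → ℝ}

theorem gradient_eq_zero_of_forall_le {y : Vec d} (h : ∀ x, F y ≤ F x) : gradient F y = 0 := by
  have h1 : IsLocalMin F y := Eventually.of_forall h
  rw [gradient, h1.fderiv_eq_zero, map_zero]

/-- Adding the strong convexity inequality to itself with the two points exchanged gives the
monotonicity constant m, twice the m/2 of either one. -/
theorem le_inner_gradient_sub {m : ℝ} (h : ∀ x₁ x₂ : Vec d,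
      F x₁ + inner ℝ (gradient F x₁) (x₂ - x₁) + m / 2 * ‖x₁ - x₂‖ ^ 2 ≤ F x₂) (y v : Vec d) :
    m * ‖v‖ ^ 2 ≤ inner ℝ (gradient F (y + v) - gradient F y) v := by
  have h1 := h y (y + v)
  have h2 := h (y + v) y
  simp only [add_sub_cancel_left, sub_add_cancel_left, inner_neg_right, norm_neg] at h1 h2
  rw [inner_sub_left]
  linarith

theorem le_norm_gradient_sub {m : ℝ} (h : ∀ x₁ x₂ : Vec d,
      F x₁ + inner ℝ (gradient F x₁) (x₂ - x₁) + m / 2 * ‖x₁ - x₂‖ ^ 2 ≤ F x₂) (y v : Vec d) :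
    m * ‖v‖ ≤ ‖gradient F (y + v) - gradient F y‖ := by
  rcases (norm_nonneg v).eq_or_lt with h0 | h0
  · rw [← h0, mul_zero]; exact norm_nonneg _
  · have h1 := (le_inner_gradient_sub h y v).trans (real_inner_le_norm _ _)
    nlinarith

end Minimizer

end OnlineSGD

/-! ### The main theorem. -/

theorem theorem1
    {d : ℕ} {𝓧 : Type*} [MeasurableSpace 𝓧] (P : Measure 𝓧) [IsProbabilityMeasure P]
    {Ω : Type*} [MeasurableSpace Ω] (μ : Measure Ω) [IsProbabilityMeasure μ]
    -- the loss and the objective `F(x) = 𝔼 f(x, ξ)`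
    (f : Vec d → 𝓧 → ℝ) (hf_meas : ∀ x, Measurable (f x)) (hf_int : ∀ x, Integrable (f x) P)
    (F : Vec d → ℝ) (hF : F = risk f P)
    -- the i.i.d. sample `ξ 1, ξ 2, …` from `P`
    (ξ : ℕ → Ω → 𝓧) (hξ_meas : ∀ i, 1 ≤ i → Measurable (ξ i))
    (hξ_indep : iIndepFun (fun i : ℕ => ξ (i + 1)) μ)
    (hξ_law : ∀ i, 1 ≤ i → μ.map (ξ i) = P)
    -- the minimizer
    (xstar : Vec d) (hmin : ∀ x, F xstar ≤ F x)
    -- strong convexity, Lipschitz gradient, second order expansion at the minimizer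
    (hF_C1 : ContDiff ℝ 1 F)
    (m : ℝ) (hm : 0 < m)
    (hF_convex : ∀ x₁ x₂ : Vec d,
      F x₁ + inner ℝ (gradient F x₁) (x₂ - x₁) + m / 2 * ‖x₁ - x₂‖ ^ 2 ≤ F x₂)
    (hF_hess : DifferentiableAt ℝ (gradient F) xstar)
    (hF_taylor : (fun x => gradient F x - fderiv ℝ (gradient F) xstar (x - xstar))
      =O[𝓝 xstar] fun x => ‖x - xstar‖ ^ 2)
    (L : ℝ) (hL : 0 < L)
    (hF_lip : ∀ x₁ x₂ : Vec d, ‖gradient F x₁ - gradient F x₂‖ ≤ L * ‖x₁ - x₂‖)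
    -- the SGD iterates
    (η α : ℝ) (hη : 0 < η) (hα : 1 / 2 < α) (hα' : α < 1)
    (x₀ : Vec d) (x : ℕ → Ω → Vec d) (hx : x = sgd f (stepSize η α) x₀ ξ)
    -- regularity of the stochastic gradient
    (hf_C1 : ∀ z, ContDiff ℝ 1 (fun y => f y z))
    (hf_UI : ∀ y : Vec d, ∃ U ∈ 𝓝 y, UniformIntegrable (fun u : U => lossGrad f u.1) 1 P)
    -- expansion of the conditional covariance of the noise around `S`
    (hS : MemLp (lossGrad f xstar) 2 P)
    (c₂ : ℝ)
    (h_cov : ∀ n, 1 ≤ n → ∀ᵐ ω ∂μ,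
      opNorm (condSecondMoment μ (past ξ (n - 1)) (noise f P ξ x n) ω
          - gradSecondMoment f P xstar)
        ≤ c₂ * (‖x (n - 1) ω - xstar‖ + ‖x (n - 1) ω - xstar‖ ^ 2))
    -- fourth conditional moment of the noise
    (c₄ : ℝ)
    (h_four_int : ∀ n, 1 ≤ n → Integrable (fun ω => ‖noise f P ξ x n ω‖ ^ 4) μ)
    (h_four : ∀ n, 1 ≤ n → ∀ᵐ ω ∂μ,
      (μ[fun ω' => ‖noise f P ξ x n ω'‖ ^ 4 | past ξ (n - 1)]) ω
        ≤ c₄ * (1 + ‖x (n - 1) ω - xstar‖ ^ 4))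
    -- the batches
    (C β : ℝ) (hC : 0 < C) (hβ : 1 / (1 - α) < β)
    (a : ℕ → ℕ) (ha : a = batchStart C β) (ha_mono : StrictMonoOn a (Set.Ici 1)) :
    ∃ K : ℝ, ∀ᶠ M : ℕ in atTop, ∀ n : ℕ, a M ≤ n → n < a (M + 1) →
      Integrable (fun ω =>
        opNorm (batchMeansEstimator a (fun i => x i ω) n - sandwich f P xstar)) μ ∧
      ∫ ω, opNorm (batchMeansEstimator a (fun i => x i ω) n - sandwich f P xstar) ∂μ
        ≤ K * ((M : ℝ) ^ (-(α * β) / 4) + (M : ℝ) ^ (-(1 / 2) : ℝ)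
            + (M : ℝ) ^ (((α - 1) * β + 1) / 2)) := by
  subst hF hx ha
  have hα0 : 0 < α := by linarith
  have hgrad := gradient_eq_zero_of_forall_le hmin
  have hLip : ∀ v, ‖gradient (risk f P) (xstar + v)‖ ≤ L * ‖v‖ := fun v => by
    simpa [hgrad] using hF_lip (xstar + v) xstar
  have hmono : ∀ v, m * ‖v‖ ^ 2 ≤ inner ℝ (gradient (risk f P) (xstar + v)) v := fun v => by
    simpa [hgrad] using le_inner_gradient_sub hF_convex xstar v
  have H := isSGDError_sgd hf_meas hf_int hF_C1 hf_C1 hf_UI hξ_meas hξ_indep hξ_law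
    (stepSize η α) x₀ xstar h_four_int
  have hδ := fun k => H.memLp hLip k
  have hmom := fun k => integral_noise_pow_four_le hξ_meas (hδ k) (h_four (k + 1) (by omega))
  obtain ⟨K, hK0, hK⟩ :=
    IsSGDError.exists_integral_pow_four_le hη hα0 hα' H hm (abs_nonneg c₄) hmono hLip hmom
  -- A uniform bound on the fourth moments of the noise. The deterministic starting point enters
  -- separately because the decay bound begins at k = 1.
  obtain ⟨c, hc⟩ : ∃ c : ℝ, ∀ k,
      ∫ ω, ‖noise f P ξ (sgd f (stepSize η α) x₀ ξ) (k + 1) ω‖ ^ 4 ∂μ ≤ c := by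
    refine ⟨|c₄| * (1 + (K + ∫ ω, ‖sgd f (stepSize η α) x₀ ξ 0 ω - xstar‖ ^ 4 ∂μ)),
      fun k => (hmom k).trans ?_⟩
    gcongr
    have h0 : 0 ≤ ∫ ω, ‖sgd f (stepSize η α) x₀ ξ 0 ω - xstar‖ ^ 4 ∂μ :=
      integral_nonneg fun ω => by positivity
    rcases Nat.eq_zero_or_pos k with rfl | hk
    · linarith
    · have h1 : (k : ℝ) ^ (-(2 * α)) ≤ 1 :=
        Real.rpow_le_one_of_one_le_of_nonpos (by exact_mod_cast hk) (by linarith)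
      have h2 := mul_le_mul_of_nonneg_left h1 hK0
      linarith [hK k hk]
  set A := fderiv ℝ (gradient (risk f P)) xstar with hAdef
  set B := (hessian (risk f P) xstar)⁻¹ with hBdef
  have hunit : IsUnit (hessian (risk f P) xstar) :=
    isUnit_hessian hm hF_hess (le_norm_gradient_sub hF_convex xstar)
  have hB : B.transpose = B := by
    rw [hBdef, Matrix.transpose_nonsing_inv,
      hessian_transpose (hF_C1.differentiable one_ne_zero) hF_hess]
  have hA : ∀ v, Matrix.toEuclideanCLM (n := Fin d) (𝕜 := ℝ) B (A v) = v := by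
    intro v
    rw [hAdef, ← toEuclideanCLM_hessian, ← mul_apply_eq_comp, ← map_mul, hBdef,
      Matrix.nonsing_inv_mul _ ((Matrix.isUnit_iff_isUnit_det _).1 hunit), map_one]
    rfl
  obtain ⟨R, hR⟩ := exists_norm_sub_fderiv_le hLip A hF_taylor
  obtain ⟨D, hD0, hD⟩ := H.exists_integral_sum_error_sub_le hη hα0 hα' hδ hA hR hK
  obtain ⟨D', hD'0, hD'⟩ := H.exists_integral_sum_error_le hη hα hα' hδ hA hR hK hc
  have hsummable : Summable fun k : ℕ => (k : ℝ) ^ (-(2 * α)) :=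
    Real.summable_nat_rpow.2 (by linarith)
  have hcov := fun p q k (hk : 1 ≤ k) =>
    integral_abs_condCov_sub_le hξ_meas hα0 hδ hK hk (h_cov (k + 1) (by omega)) p q
  have hβ1 : 1 < β := lt_of_le_of_lt (by rw [le_div_iff₀] <;> linarith) hβ
  obtain ⟨c₁', c₂', hc₁, hc₂, hbatch⟩ := exists_batch_bounds hC hβ1 ha_mono
  obtain ⟨κ, hκ, hrate⟩ := exists_rate_bounds hα0 hα' hβ hc₁ hc₂
  have ha1 : batchStart C β 1 = 1 := by simp [batchStart]
  -- The final factor 1 + κ converts ρ + n^{-α/2} into the three powers of M.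
  refine ⟨κ * (‖Matrix.toEuclideanCLM (n := Fin d) (𝕜 := ℝ) B‖ ^ 2 * (1 + 16 * c)
    + 6 * κ * (6 * D + 3 * D * (∑' k : ℕ, (k : ℝ) ^ (-(2 * α))) + 6 * D')
    + opNorm B ^ 2 * ((d : ℝ) ^ 2 * (1 + 68 * c * κ + 2 * (|c₂| * (3 + 2 * K))))) * (1 + κ), ?_⟩
  filter_upwards [hbatch] with M ⟨hM, hMn⟩ n hn1 hn2
  obtain ⟨hlow, hupp, hsize, hsum⟩ := hMn n hn1 hn2
  obtain ⟨r1, r2, r3, r4, r5⟩ := hrate M hM n hlow hupp _ _ rfl rfl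
  have hM0 : (0 : ℝ) < M := by exact_mod_cast hM
  have hn : 1 ≤ n := hM.trans ((le_of_strictMonoOn ha1 ha_mono hM).trans hn1)
  have htj : ∀ j ∈ Finset.Icc 1 n,
      1 ≤ blockStart (batchStart C β) j ∧ blockStart (batchStart C β) j ≤ j := fun j hj =>
    blockStart_pos_le ha1 ha_mono (Finset.mem_Icc.1 hj).1
  have hbs : ∀ j ∈ Finset.Icc 1 n,
      batchSize (batchStart C β) j = j + 1 - blockStart (batchStart C β) j := fun j hj => by
    have := htj j hj
    unfold batchSize
    omega
  have hest : ∀ ω, batchMeansEstimator (batchStart C β)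
      (fun i => sgd f (stepSize η α) x₀ ξ i ω) n
      = (∑ i ∈ Finset.Icc 1 n, (batchSize (batchStart C β) i : ℝ))⁻¹ • ∑ i ∈ Finset.Icc 1 n,
        Matrix.vecMulVec
          (centredWindow (fun k ω => sgd f (stepSize η α) x₀ ξ k ω - xstar)
            (blockStart (batchStart C β)) n i ω).ofLp
          (centredWindow (fun k ω => sgd f (stepSize η α) x₀ ξ k ω - xstar)
            (blockStart (batchStart C β)) n i ω).ofLp := by
    intro ω
    unfold batchMeansEstimator
    congr 1
    refine Finset.sum_congr rfl fun i hi => ?_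
    rw [centredSum_eq_centredWindow (x := sgd f (stepSize η α) x₀ ξ) xstar hn (htj i hi).2 ω]
  have hpos : ∀ y : ℝ, 0 < (M : ℝ) ^ y := fun y => Real.rpow_pos_of_pos hM0 y
  obtain ⟨hint, hle⟩ := integral_opNorm_batchMeans_sub_sandwich_le H.noise hδ hB hα0 hα' hD0 hD'0
    (mul_nonneg (abs_nonneg c₂) (by positivity : 0 ≤ 3 + 2 * K)) hc
    (fun n => hsummable.sum_le_tsum _ fun k _ => by positivity) hD hD' hcov hn htj
    (mul_pos hc₂ (hpos (β - 1)))
    (fun j hj => by rw [← hbs j hj]; exact hsize j hj) hκ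
    (add_pos (hpos (-(1 / 2))) (hpos (((α - 1) * β + 1) / 2))) r3 r1 r2
    (Finset.sum_congr rfl fun i hi => by rw [hbs i hi])
    (r4.trans (mul_le_mul_of_nonneg_left hsum hκ.le))
  simp only [hest, sandwich]
  refine ⟨hint, hle.trans ?_⟩
  have hc0 : 0 ≤ c := (integral_nonneg fun ω => by positivity).trans (hc 0)
  have hZ0 : 0 ≤ ∑' k : ℕ, (k : ℝ) ^ (-(2 * α)) := tsum_nonneg fun k => by positivity
  rw [mul_assoc _ (1 + κ)]
  gcongr
  have h1 := hpos (-(α * β) / 4)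
  have h2 := mul_pos hκ (add_pos (hpos (-(1 / 2))) (hpos (((α - 1) * β + 1) / 2)))
  linarith
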